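/- **Setting.** Let $T\ge 1$, let $\omega$ be a primitive $T$-th root of unity, and let $\mathfrak g$ be a finite-dimensional complex Lie algebra with a non-degenerate invariant symmetric bilinear form $\langle\cdot,\cdot\rangle$. Let $\sigma$ be a linear automorphism of $\mathfrak g$ with $\sigma^T=1$, and $\tau$ an anti-linear involutive automorphism of $\mathfrak g$ which preserves the eigenspaces of $\sigma$; assume $\langle\sigma x,\sigma y\rangle=\langle x,y\rangle$ and $\langle\tau x,\tau y\rangle=\overline{\langle x,y\rangle}$. Let $\tilde{\mathfrak g}=\mathfrak g\otimes\mathbb C[t,t^{-1}]\oplus\mathbb C\mathsf K\oplus\mathbb C\mathsf D$ be the affine algebra: writing $x_n=x\otimes t^n$, $[x_m,y_n]=[x,y]_{m+n}+m\,\delta_{m+n,0}\langle x,y\rangle\mathsf K$, $[\mathsf D,x_n]=n\,x_n$, $\mathsf K$ central; and $\hat{\mathfrak g}=\mathfrak g\otimes\mathbb C[t,t^{-1}]\oplus\mathbb C\mathsf K$. Extend $\sigma$ and $\tau$ by $\sigma x_n=(\sigma x)_n$, $\tau x_n=(\tau x)_{-n}$, $\sigma\mathsf K=\mathsf K$, $\sigma\mathsf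 D=\mathsf D$, $\tau\mathsf K=-\mathsf K$, $\tau\mathsf D=-\mathsf D$. For $j\in\mathbb Z/T$ let the subscript $(j)$ denote the $\omega^j$-eigenspace of $\sigma$. The dihedral group $\Pi=\langle\mathsf s,\mathsf t\rangle$ of order $2T$ acts on $\mathbb P^1$ by $\mathsf s:z\mapsto\omega z$, $\mathsf t:z\mapsto\bar z$. Let $\boldsymbol z\subset\mathbb P^1$ be a finite set containing $\infty$ with pairwise disjoint $\Pi$-orbits, and let $\mathcal D=\sum_{x\in\boldsymbol z}n_x x$ with all $n_x\ge 1$. Let $\boldsymbol z_{\rm f}=\boldsymbol z\cap\{0,\infty\}$; let $\boldsymbol z_{\rm r}^k$ ($0\le k<T$) be the set of $x\in\boldsymbol z\setminus\{0,\infty\}$ with $\omega^k\bar x=x$, and $\boldsymbol z_{\rm r}'$ the union of these; let $\boldsymbol z_{\rm c}$ be the set of $x\in\boldsymbol z$ with trivial stabiliser. Put $n_{\bar x}=n_x$. Let $\mathcal T_x=\tilde{\mathfrak g}\otimes\mathbb C[\varepsilon_x]/\varepsilon_x^{n_x}$ for $x\neq\infty$ and $\mathcal T_\infty=\tilde{\mathfrak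 g}\otimes\varepsilon_\infty\mathbb C[\varepsilon_\infty]/\varepsilon_\infty^{n_\infty}$. The stabiliser $\Pi_x$ acts on $\mathcal T_x$ by $\sigma,\tau$ on $\tilde{\mathfrak g}$, with $\mathsf s:\varepsilon_x\mapsto\omega^{-1}\varepsilon_x$ for $x\ne\infty$, $\mathsf s:\varepsilon_\infty\mapsto\omega\varepsilon_\infty$, and $\mathsf t:\varepsilon_x\mapsto\varepsilon_x$ anti-linearly. Let $\tilde{\mathfrak g}^{\mathcal D}=\bigoplus_{x\in\boldsymbol z}(\mathcal T_x)^{\Pi_x}$, a real Lie algebra, let $\tilde{\mathfrak g}^{\mathcal D}_{\mathbb C}=\tilde{\mathfrak g}^{\mathcal D}\otimes_{\mathbb R}\mathbb C$, and let $c$ be complex conjugation in the second factor. It is spanned by the following elements. * For $x\in\boldsymbol z_{\rm c}$, $\mathsf X\in\tilde{\mathfrak g}$, $0\le p<n_x$: $\mathsf X^{(x)}_p=\tfrac12\big(\mathsf X\varepsilon_x^p\otimes1-(i\mathsf X)\varepsilon_x^p\otimes i\big)$ and $\mathsf X^{(\bar x)}_p=\tfrac12\big(\mathsf X\varepsilon_x^p\otimes1+(i\mathsf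 X)\varepsilon_x^p\otimes i\big)$. * For all other $x\in\boldsymbol z$: $\mathsf X^{(x)}_p=\tfrac12(\mathsf X+\mathsf X')\varepsilon_x^p\otimes1-\big(\tfrac i2(\mathsf X-\mathsf X')\big)\varepsilon_x^p\otimes i$, where $\mathsf X'=\omega^{-kp}\sigma^k\tau\mathsf X$ if $x\in\boldsymbol z^k_{\rm r}$ ($0\le p<n_x$); $\mathsf X'=\tau\mathsf X$ if $x=0$ ($0\le p<n_0$, $\mathsf X\in\tilde{\mathfrak g}_{(p)}$) or $x=\infty$ ($1\le p<n_\infty$, $\mathsf X\in\tilde{\mathfrak g}_{(-p)}$). Let $\hat{\mathfrak g}^{\mathcal D}_{\mathbb C}$ be the same construction with $\hat{\mathfrak g}$ in place of $\tilde{\mathfrak g}$. Let $\mathsf F_n$ (for either algebra) be the span of the elements $(y_m)^{(x)}_p$, $y\in\mathfrak g$, with $m\ge n$ for $x\in\boldsymbol z$ and with $m\le -n$ for the points $\bar x$, $x\in\boldsymbol z_{\rm c}$. A symmetric algebra $S$ is filtered by the ideals $\mathsf F_n(S)=\mathsf F_nS\cap c(\mathsf F_n)S$; its Lie–Poisson bracket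 extends by continuity to the completion $\hat S=\varprojlim S/\mathsf F_n(S)$. **Levels.** Let $\ell^x_p\in\mathbb C$ be given for $x\in\boldsymbol z\cup\bar{\boldsymbol z}_{\rm c}$, $p\ge0$, with $\ell^x_p=0$ for $p\ge n_x$; $\ell^0_p=\ell^\infty_p=0$ if $T\nmid p$; $\ell^\infty_0=0$ (a convention: there is no such level); $\ell^x_{n_x-1}\ne0$ (for $x=\infty$ only if $n_\infty\ge2$); $\overline{\ell^x_p}=\ell^{\bar x}_p$ for $x\in\boldsymbol z_{\rm c}$, $\overline{\ell^x_p}=\omega^{-kp}\ell^x_p$ for $x\in\boldsymbol z_{\rm r}^k$, and $\ell^x_p\in\mathbb R$ for $x\in\boldsymbol z_{\rm f}$. Put $\epsilon_x=-1$ for $x\in\bar{\boldsymbol z}_{\rm c}$ and $\epsilon_x=1$ otherwise. Let $J_\ell\subset S(\hat{\mathfrak g}^{\mathcal D}_{\mathbb C})$ be the ideal generated by all $\mathsf K^{(x)}_p-\epsilon_x i\ell^x_p$ ($p$ in the above range, and $T\mid p$ if $x\in\{0,\infty\}$), let $S_\ell(\hat{\mathfrak g}^{\mathcal D}_{\mathbb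 C})=S(\hat{\mathfrak g}^{\mathcal D}_{\mathbb C})/J_\ell$ with the induced Poisson bracket and the filtration by the ideals $\mathsf F_n(S_\ell)=\mathsf F_nS_\ell\cap c(\mathsf F_n)S_\ell$ (generated by the images of $\mathsf F_n$ and $c(\mathsf F_n)$), and let $\hat S_\ell(\hat{\mathfrak g}^{\mathcal D}_{\mathbb C})=\varprojlim S_\ell/\mathsf F_n(S_\ell)$, with the Poisson bracket extended by continuity. For a sequence $\ell$ and $n\ge1$ put $$\kappa_p=\sum_{c}(-1)^{|c|}\,\frac{\prod_{j=1}^{|c|}\ell_{n-1-c_j}}{\ell_{n-1}^{|c|+1}},$$ the sum over compositions $c=(c_1,\dots,c_{|c|})$ of $p-n+1$ (so $\kappa_p=0$ for $p<n-1$); write $\kappa^x_p$ for this number with $n=n_x$, $\ell=\ell^x$. **Theorem.** 1. For every $x\in\boldsymbol z\cup\bar{\boldsymbol z}_{\rm c}$ (with $n_\infty\ge2$ if $x=\infty$), with $n=n_x$, the numbers $\kappa^x_0,\dots,\kappa^x_{2n-2}$ are the unique solution of the system $\sum_{p=0}^{n-1}\kappa_{p+q}\,\ell^x_{p+s}=\delta_{q,s}$,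 $0\le q,s\le n-1$. 2. There is a unique linear map $\pi_\ell:\tilde{\mathfrak g}^{\mathcal D}_{\mathbb C}\to\hat S_\ell(\hat{\mathfrak g}^{\mathcal D}_{\mathbb C})$ such that, for all points $x$ and exponents $p,r$ as above (with $T\mid p,r$ in the formulas for $\mathsf K$ and $\mathsf D$ if $x\in\{0,\infty\}$), $$\pi_\ell\big((y_m)^{(x)}_p\big)=(y_m)^{(x)}_p,\qquad \pi_\ell(\mathsf K^{(x)}_p)=\epsilon_x\,i\,\ell^x_p,\qquad \pi_\ell(\mathsf D^{(x)}_r)=\epsilon_x\frac i2\sum_{p,q}\sum_{n\in\mathbb Z}\kappa^x_{p+q-r}\sum_a (I_{a,-n})^{(x)}_p\,(I^a_n)^{(x)}_q .$$ Here $p,q$ run over $0,\dots,n_x-1$ (over $1,\dots,n_\infty-1$ if $x=\infty$), $\kappa^x_{p+q-r}=0$ if $p+q<r$, and $\{I_a\},\{I^a\}$ are dual bases of $\mathfrak g$; if $x\in\{0,\infty\}$ only the pairs with $T\mid p+q$ are taken and $\{I_a\},\{I^a\}$ are dual bases of $\mathfrak g_{(j_p)},\mathfrak g_{(j_q)}$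 with $j_p=p$ for $x=0$ and $j_p=-p$ for $x=\infty$. The sum over $n\in\mathbb Z$ is the element of the inverse limit whose $k$-th component is the class of the partial sum over $|n|<k$. 3. $\pi_\ell$ is a homomorphism of Lie algebras: $\pi_\ell([X,Y])=\{\pi_\ell(X),\pi_\ell(Y)\}$ for all $X,Y\in\tilde{\mathfrak g}^{\mathcal D}_{\mathbb C}$. 4. $\pi_\ell$ extends to a homomorphism of commutative $\mathbb C$-algebras $\hat S(\tilde{\mathfrak g}^{\mathcal D}_{\mathbb C})\to\hat S_\ell(\hat{\mathfrak g}^{\mathcal D}_{\mathbb C})$ which preserves the Poisson brackets and maps, for every $n$, the kernel of the projection to $S(\tilde{\mathfrak g}^{\mathcal D}_{\mathbb C})/\mathsf F_n$ into the kernel of the projection to $S_\ell(\hat{\mathfrak g}^{\mathcal D}_{\mathbb C})/\mathsf F_n$; it is the only continuous algebra homomorphism which extends $\pi_\ell$. -/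

import Mathlib

noncomputable section

open scoped TensorProduct
open LieAlgebra

namespace AffineGaudin

/-- A Poisson bracket on a commutative `ℂ`-algebra: a bilinear Lie bracket which is a
derivation in each argument. -/
structure PoissonBracket (S : Type*) [CommRing S] [Algebra ℂ S] where
  br : S →ₗ[ℂ] S →ₗ[ℂ] S
  skew : ∀ f g, br f g = -br g f
  jacobi : ∀ f g h, br f (br g h) = br (br f g) h + br g (br f h)
  leibniz : ∀ f g h, br (f * g) h = f * br g h + g * br f h

namespace PoissonBracket

variable {S : Type*} [CommRing S] [Algebra ℂ S] (P : PoissonBracket S)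

theorem leibniz_right (f g h : S) : P.br f (g * h) = g * P.br f h + h * P.br f g := by
  rw [P.skew, P.leibniz, P.skew h f, P.skew g f]; ring

theorem br_algebraMap (c : ℂ) (f : S) : P.br (algebraMap ℂ S c) f = 0 := by
  have h : P.br 1 f = 0 := by
    have := P.leibniz 1 1 f
    simp only [mul_one, one_mul] at this
    exact left_eq_add.mp this
  rw [Algebra.algebraMap_eq_smul_one, map_smul, LinearMap.smul_apply, h, smul_zero]

end PoissonBracket

section Symmetric

variable {L : Type*} [LieRing L] [LieAlgebra ℂ L]

/-- The algebra homomorphism `f ↦ f + ε D f` into the dual numbers, where `D` is the derivation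
of the symmetric algebra which extends the linear map `φ`. -/
def derLift (φ : L →ₗ[ℂ] SymmetricAlgebra ℂ L) :
    SymmetricAlgebra ℂ L →ₐ[ℂ] TrivSqZeroExt (SymmetricAlgebra ℂ L) (SymmetricAlgebra ℂ L) :=
  SymmetricAlgebra.lift
    ((TrivSqZeroExt.inlAlgHom ℂ (SymmetricAlgebra ℂ L) (SymmetricAlgebra ℂ L)).toLinearMap ∘ₗ
        SymmetricAlgebra.ι ℂ L +
      ((TrivSqZeroExt.inrHom (SymmetricAlgebra ℂ L) (SymmetricAlgebra ℂ L)).restrictScalars ℂ) ∘ₗ φ)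

theorem derLift_ι (φ : L →ₗ[ℂ] SymmetricAlgebra ℂ L) (X : L) :
    derLift φ (SymmetricAlgebra.ι ℂ L X) =
      TrivSqZeroExt.inl (SymmetricAlgebra.ι ℂ L X) + TrivSqZeroExt.inr (φ X) := by
  simp [derLift]

theorem derLift_fst (φ : L →ₗ[ℂ] SymmetricAlgebra ℂ L) (f : SymmetricAlgebra ℂ L) :
    (derLift φ f).fst = f := by
  induction f using SymmetricAlgebra.induction with
  | algebraMap r => rw [AlgHom.commutes]; rw [TrivSqZeroExt.algebraMap_eq_inl', TrivSqZeroExt.fst_inl]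
  | ι x => rw [derLift_ι]; simp
  | mul a b ha hb => rw [map_mul, TrivSqZeroExt.fst_mul, ha, hb]
  | add a b ha hb => rw [map_add, TrivSqZeroExt.fst_add, ha, hb]

/-- The derivation of the symmetric algebra which extends a linear map, depending linearly
on that map. -/
def extendDer : (L →ₗ[ℂ] SymmetricAlgebra ℂ L) →ₗ[ℂ]
    (SymmetricAlgebra ℂ L →ₗ[ℂ] SymmetricAlgebra ℂ L) where
  toFun φ :=
    { toFun := fun f => (derLift φ f).snd
      map_add' := fun f g => by rw [map_add, TrivSqZeroExt.snd_add]
      map_smul' := fun c f => by rw [map_smul, TrivSqZeroExt.snd_smul]; rfl }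
  map_add' φ ψ := by
    ext f
    simp only [LinearMap.coe_mk, AddHom.coe_mk, LinearMap.add_apply]
    induction f using SymmetricAlgebra.induction with
    | algebraMap r => simp [AlgHom.commutes, TrivSqZeroExt.algebraMap_eq_inl']
    | ι x => simp [derLift_ι]
    | mul a b ha hb =>
      simp only [map_mul, TrivSqZeroExt.snd_mul, ha, hb, derLift_fst, smul_add]
      abel
    | add a b ha hb => simp only [map_add, TrivSqZeroExt.snd_add, ha, hb]; abel
  map_smul' c φ := by
    ext f
    simp only [LinearMap.coe_mk, AddHom.coe_mk, LinearMap.smul_apply, RingHom.id_apply]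
    induction f using SymmetricAlgebra.induction with
    | algebraMap r => simp [AlgHom.commutes, TrivSqZeroExt.algebraMap_eq_inl']
    | ι x => simp [derLift_ι]
    | mul a b ha hb =>
      simp only [map_mul, TrivSqZeroExt.snd_mul, ha, hb, derLift_fst, smul_add]
      simp
    | add a b ha hb => simp only [map_add, TrivSqZeroExt.snd_add, ha, hb, smul_add]

theorem extendDer_ι (φ : L →ₗ[ℂ] SymmetricAlgebra ℂ L) (X : L) :
    extendDer φ (SymmetricAlgebra.ι ℂ L X) = φ X := by
  simp [extendDer, derLift_ι]

theorem extendDer_mul (φ : L →ₗ[ℂ] SymmetricAlgebra ℂ L) (f g : SymmetricAlgebra ℂ L) :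
    extendDer φ (f * g) = f * extendDer φ g + g * extendDer φ f := by
  simp [extendDer, TrivSqZeroExt.snd_mul, derLift_fst, mul_comm g]

theorem extendDer_algebraMap (φ : L →ₗ[ℂ] SymmetricAlgebra ℂ L) (c : ℂ) :
    extendDer φ (algebraMap ℂ _ c) = 0 := by
  simp [extendDer, AlgHom.commutes, TrivSqZeroExt.algebraMap_eq_inl']

/-- The Hamiltonian derivation `{X, ·}` of a Lie algebra element `X`: the derivation of the
symmetric algebra which extends `ad X`. -/
def symAd : L →ₗ[ℂ] (SymmetricAlgebra ℂ L →ₗ[ℂ] SymmetricAlgebra ℂ L) :=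
  extendDer ∘ₗ (SymmetricAlgebra.ι ℂ L).compRight ℂ ∘ₗ (LieModule.toEnd ℂ L L : L →ₗ[ℂ] Module.End ℂ L)

theorem symAd_apply (X : L) : symAd X =
    extendDer (SymmetricAlgebra.ι ℂ L ∘ₗ (LieModule.toEnd ℂ L L X)) := rfl

/-- The bilinear map `(f, g) ↦ {f, g}`, a derivation in `f` with `{X, g} = symAd X g`. -/
def symBr : SymmetricAlgebra ℂ L →ₗ[ℂ] SymmetricAlgebra ℂ L →ₗ[ℂ] SymmetricAlgebra ℂ L :=
  (extendDer ∘ₗ (symAd (L := L)).flip).flip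

theorem symBr_ι_left (X : L) (g : SymmetricAlgebra ℂ L) :
    symBr (SymmetricAlgebra.ι ℂ L X) g = symAd X g := by
  simp [symBr, extendDer_ι]

theorem symBr_ι_ι (X Y : L) : symBr (SymmetricAlgebra.ι ℂ L X) (SymmetricAlgebra.ι ℂ L Y) =
    SymmetricAlgebra.ι ℂ L ⁅X, Y⁆ := by
  rw [symBr_ι_left, symAd_apply, extendDer_ι]; simp

theorem symBr_mul_left (f g h : SymmetricAlgebra ℂ L) :
    symBr (f * g) h = f * symBr g h + g * symBr f h := by
  simp [symBr, extendDer_mul]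

theorem symBr_algebraMap_left (c : ℂ) (h : SymmetricAlgebra ℂ L) :
    symBr (algebraMap ℂ _ c) h = 0 := by
  simp only [symBr, LinearMap.flip_apply, LinearMap.comp_apply, extendDer_algebraMap]

theorem symBr_algebraMap_right (f : SymmetricAlgebra ℂ L) (c : ℂ) :
    symBr f (algebraMap ℂ _ c) = 0 := by
  induction f using SymmetricAlgebra.induction with
  | algebraMap r => exact symBr_algebraMap_left _ _
  | ι x => rw [symBr_ι_left, symAd_apply, extendDer_algebraMap]
  | mul a b ha hb => rw [symBr_mul_left, ha, hb, mul_zero, mul_zero, add_zero]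
  | add a b ha hb => rw [map_add, LinearMap.add_apply, ha, hb, add_zero]

theorem symBr_mul_right (f g h : SymmetricAlgebra ℂ L) :
    symBr f (g * h) = g * symBr f h + h * symBr f g := by
  induction f using SymmetricAlgebra.induction with
  | algebraMap r => simp only [symBr_algebraMap_left, mul_zero, add_zero]
  | ι x => simp only [symBr_ι_left, symAd_apply, extendDer_mul]
  | mul a b ha hb => rw [symBr_mul_left, symBr_mul_left, symBr_mul_left, ha, hb]; ring
  | add a b ha hb => simp only [map_add, LinearMap.add_apply, ha, hb]; ring

theorem symBr_skew (f g : SymmetricAlgebra ℂ L) : symBr f g = -symBr g f := by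
  induction f using SymmetricAlgebra.induction with
  | algebraMap r => rw [symBr_algebraMap_left, symBr_algebraMap_right, neg_zero]
  | mul a b ha hb => rw [symBr_mul_left, symBr_mul_right, ha, hb]; ring
  | add a b ha hb => simp only [map_add, LinearMap.add_apply, ha, hb]; ring
  | ι x =>
    induction g using SymmetricAlgebra.induction with
    | algebraMap r => rw [symBr_algebraMap_left, symBr_algebraMap_right, neg_zero]
    | mul a b ha hb => rw [symBr_mul_left, symBr_mul_right, ha, hb]; ring
    | add a b ha hb => simp only [map_add, LinearMap.add_apply, ha, hb]; ring
    | ι y => rw [symBr_ι_ι, symBr_ι_ι, ← lie_skew, map_neg]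

theorem symBr_jacobi (f g h : SymmetricAlgebra ℂ L) :
    symBr f (symBr g h) = symBr (symBr f g) h + symBr g (symBr f h) := by
  induction f using SymmetricAlgebra.induction with
  | algebraMap r => simp only [symBr_algebraMap_left, map_zero, LinearMap.zero_apply, add_zero]
  | add a b ha hb => simp only [map_add, LinearMap.add_apply, ha, hb]; ring
  | mul a b ha hb =>
    simp only [symBr_mul_left, symBr_mul_right, map_add, LinearMap.add_apply, ha, hb]
    rw [symBr_skew g a, symBr_skew g b]; ring
  | ι x =>
    induction g using SymmetricAlgebra.induction with
    | algebraMap r =>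
      simp only [symBr_algebraMap_left, symBr_algebraMap_right, map_zero, LinearMap.zero_apply,
        add_zero]
    | add a b ha hb => simp only [map_add, LinearMap.add_apply, ha, hb]; ring
    | mul a b ha hb =>
      simp only [symBr_mul_left, symBr_mul_right, map_add, LinearMap.add_apply, ha, hb]
      ring
    | ι y =>
      induction h using SymmetricAlgebra.induction with
      | algebraMap r => simp only [symBr_algebraMap_right, map_zero, add_zero]
      | add a b ha hb => simp only [map_add, ha, hb]; ring
      | mul a b ha hb =>
        simp only [symBr_mul_right, map_add, ha, hb]
        ring
      | ι z => simp only [symBr_ι_ι, ← map_add, ← leibniz_lie]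

/-- The Poisson bracket on the symmetric algebra of a Lie algebra which extends the Lie bracket. -/
def symPoisson (L : Type*) [LieRing L] [LieAlgebra ℂ L] :
    PoissonBracket (SymmetricAlgebra ℂ L) where
  br := symBr
  skew := symBr_skew
  jacobi := symBr_jacobi
  leibniz := symBr_mul_left

end Symmetric

section Quotient

variable {S : Type*} [CommRing S] [Algebra ℂ S]

theorem PoissonBracket.br_mem_left (P : PoissonBracket S) {J : Ideal S}
    (hJ : ∀ f, ∀ g ∈ J, P.br f g ∈ J) (f g : S) (hf : f ∈ J) : P.br f g ∈ J := by
  rw [P.skew]; exact J.neg_mem (hJ g f hf)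

/-- The bracket of two classes modulo an ideal, computed on representatives. -/
def PoissonBracket.quotFun (P : PoissonBracket S) (J : Ideal S) (a b : S ⧸ J) : S ⧸ J :=
  Ideal.Quotient.mk J (P.br (Function.surjInv Ideal.Quotient.mk_surjective a)
    (Function.surjInv Ideal.Quotient.mk_surjective b))

theorem PoissonBracket.quotFun_mk (P : PoissonBracket S) {J : Ideal S}
    (hJ : ∀ f, ∀ g ∈ J, P.br f g ∈ J) (f g : S) :
    P.quotFun J (Ideal.Quotient.mk J f) (Ideal.Quotient.mk J g) =
      Ideal.Quotient.mk J (P.br f g) := by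
  unfold PoissonBracket.quotFun
  have hf := Function.surjInv_eq (Ideal.Quotient.mk_surjective (I := J)) (Ideal.Quotient.mk J f)
  have hg := Function.surjInv_eq (Ideal.Quotient.mk_surjective (I := J)) (Ideal.Quotient.mk J g)
  set f' := Function.surjInv (Ideal.Quotient.mk_surjective (I := J)) (Ideal.Quotient.mk J f)
  set g' := Function.surjInv (Ideal.Quotient.mk_surjective (I := J)) (Ideal.Quotient.mk J g)
  rw [Ideal.Quotient.eq] at hf hg ⊢
  have : P.br f' g' - P.br f g = P.br (f' - f) g' + P.br f (g' - g) := by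
    simp only [map_sub, LinearMap.sub_apply]; ring
  rw [this]
  exact J.add_mem (P.br_mem_left hJ _ _ hf) (hJ _ _ hg)

/-- The Poisson bracket induced on the quotient by a Poisson ideal. -/
def PoissonBracket.quotient (P : PoissonBracket S) (J : Ideal S)
    (hJ : ∀ f, ∀ g ∈ J, P.br f g ∈ J) : PoissonBracket (S ⧸ J) where
  br := LinearMap.mk₂ ℂ (P.quotFun J)
    (fun a b c => by
      obtain ⟨a, rfl⟩ := Ideal.Quotient.mk_surjective a
      obtain ⟨b, rfl⟩ := Ideal.Quotient.mk_surjective b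
      obtain ⟨c, rfl⟩ := Ideal.Quotient.mk_surjective c
      simp only [← map_add, P.quotFun_mk hJ]
      rw [map_add, LinearMap.add_apply])
    (fun r a c => by
      obtain ⟨a, rfl⟩ := Ideal.Quotient.mk_surjective a
      obtain ⟨c, rfl⟩ := Ideal.Quotient.mk_surjective c
      change P.quotFun J (Ideal.Quotient.mk J (r • a)) (Ideal.Quotient.mk J c) = _
      rw [P.quotFun_mk hJ, P.quotFun_mk hJ, map_smul, LinearMap.smul_apply]
      rfl)
    (fun a b c => by
      obtain ⟨a, rfl⟩ := Ideal.Quotient.mk_surjective a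
      obtain ⟨b, rfl⟩ := Ideal.Quotient.mk_surjective b
      obtain ⟨c, rfl⟩ := Ideal.Quotient.mk_surjective c
      simp only [← map_add, P.quotFun_mk hJ])
    (fun r a c => by
      obtain ⟨a, rfl⟩ := Ideal.Quotient.mk_surjective a
      obtain ⟨c, rfl⟩ := Ideal.Quotient.mk_surjective c
      change P.quotFun J (Ideal.Quotient.mk J a) (Ideal.Quotient.mk J (r • c)) = _
      rw [P.quotFun_mk hJ, P.quotFun_mk hJ, map_smul]
      rfl)
  skew f g := by
    obtain ⟨f, rfl⟩ := Ideal.Quotient.mk_surjective f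
    obtain ⟨g, rfl⟩ := Ideal.Quotient.mk_surjective g
    simp only [LinearMap.mk₂_apply, P.quotFun_mk hJ]
    rw [P.skew, map_neg]
  jacobi f g h := by
    obtain ⟨f, rfl⟩ := Ideal.Quotient.mk_surjective f
    obtain ⟨g, rfl⟩ := Ideal.Quotient.mk_surjective g
    obtain ⟨h, rfl⟩ := Ideal.Quotient.mk_surjective h
    simp only [LinearMap.mk₂_apply, P.quotFun_mk hJ]
    rw [P.jacobi, map_add]
  leibniz f g h := by
    obtain ⟨f, rfl⟩ := Ideal.Quotient.mk_surjective f
    obtain ⟨g, rfl⟩ := Ideal.Quotient.mk_surjective g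
    obtain ⟨h, rfl⟩ := Ideal.Quotient.mk_surjective h
    simp only [LinearMap.mk₂_apply, P.quotFun_mk hJ, ← map_mul]
    rw [P.leibniz, map_add]

theorem PoissonBracket.quotient_mk (P : PoissonBracket S) (J : Ideal S)
    (hJ : ∀ f, ∀ g ∈ J, P.br f g ∈ J) (f g : S) :
    (P.quotient J hJ).br (Ideal.Quotient.mk J f) (Ideal.Quotient.mk J g) =
      Ideal.Quotient.mk J (P.br f g) :=
  P.quotFun_mk hJ f g

end Quotient

section Completion

variable {S : Type*} [CommRing S] [Algebra ℂ S]

/-- The completion `lim S ⧸ F n` of `S` with respect to a descending filtration by ideals,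
as the algebra of compatible sequences of classes. -/
def completion (F : ℕ → Ideal S) (hF : Antitone F) : Subalgebra ℂ (∀ n, S ⧸ F n) where
  carrier := {f | ∀ m n (h : m ≤ n), Ideal.Quotient.factor (hF h) (f n) = f m}
  mul_mem' ha hb m n h := by simp only [Pi.mul_apply, map_mul, ha m n h, hb m n h]
  add_mem' ha hb m n h := by simp only [Pi.add_apply, map_add, ha m n h, hb m n h]
  algebraMap_mem' _ _ _ _ := rfl

variable {F : ℕ → Ideal S} {hF : Antitone F}

/-- The canonical homomorphism from `S` to its completion. -/
def toCompletion (F : ℕ → Ideal S) (hF : Antitone F) : S →ₐ[ℂ] completion F hF where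
  toFun f := ⟨fun n => Ideal.Quotient.mk (F n) f, fun _ _ _ => rfl⟩
  map_one' := rfl
  map_mul' _ _ := rfl
  map_zero' := rfl
  map_add' _ _ := rfl
  commutes' _ := rfl

/-- A representative in `S` of the `n`-th component of an element of the completion. -/
def completionRep (f : completion F hF) (n : ℕ) : S :=
  Function.surjInv Ideal.Quotient.mk_surjective (f.1 n)

theorem mk_completionRep (f : completion F hF) (n : ℕ) :
    Ideal.Quotient.mk (F n) (completionRep f n) = f.1 n :=
  Function.surjInv_eq _ _

theorem mk_completionRep_of_le (f : completion F hF) {m n : ℕ} (h : m ≤ n) :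
    Ideal.Quotient.mk (F m) (completionRep f n) = f.1 m := by
  rw [← f.2 m n h, ← mk_completionRep f n]; rfl

/-- `h` is the limit of the brackets `{a, b}` as `a` tends to `f` and `b` tends to `g`
in the topology of the filtration. -/
def IsLimitBracket (P : PoissonBracket S) (f g h : completion F hF) : Prop :=
  ∀ N, ∃ M, ∀ m ≥ M, ∀ a b : S, Ideal.Quotient.mk (F m) a = f.1 m →
    Ideal.Quotient.mk (F m) b = g.1 m → Ideal.Quotient.mk (F N) (P.br a b) = h.1 N

/-- Continuity of a Poisson bracket for the topology of a filtration. -/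
structure PoissonContinuous (P : PoissonBracket S) (F : ℕ → Ideal S) : Prop where
  stable : ∀ n, ∀ f ∈ F n, ∀ g ∈ F n, P.br f g ∈ F n
  cont : ∀ f n, ∃ m, ∀ g ∈ F m, P.br f g ∈ F n

theorem PoissonContinuous.eventually {P : PoissonBracket S} (hP : PoissonContinuous P F)
    (hF : Antitone F) (a b : S) (N : ℕ) : ∃ M, N ≤ M ∧ ∀ a' b', a' - a ∈ F N → b' - b ∈ F N →
      ∀ a'' b'', a'' - a' ∈ F M → b'' - b' ∈ F M → P.br a'' b'' - P.br a' b' ∈ F N := by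
  obtain ⟨M₁, h₁⟩ := hP.cont a N
  obtain ⟨M₂, h₂⟩ := hP.cont b N
  refine ⟨max N (max M₁ M₂), le_max_left _ _, fun a' b' ha' hb' a'' b'' ha hb => ?_⟩
  have haN := hF (le_max_left N (max M₁ M₂)) ha
  have hbN := hF (le_max_left N (max M₁ M₂)) hb
  have ha₂ := hF ((le_max_right M₁ M₂).trans (le_max_right N _)) ha
  have hb₁ := hF ((le_max_left M₁ M₂).trans (le_max_right N _)) hb
  have e : P.br a'' b'' - P.br a' b' = -P.br b (a'' - a') + P.br (a'' - a') (b'' - b)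
      + (P.br a (b'' - b') + P.br (a' - a) (b'' - b')) := by
    rw [← P.skew]
    simp only [map_sub, LinearMap.sub_apply]; ring
  have hb'' : b'' - b ∈ F N := by
    have := (F N).add_mem hbN hb'
    rwa [sub_add_sub_cancel] at this
  rw [e]
  exact (F N).add_mem ((F N).add_mem ((F N).neg_mem (h₂ _ ha₂)) (hP.stable N _ haN _ hb''))
    ((F N).add_mem (h₁ _ hb₁) (hP.stable N _ ha' _ hbN))

theorem IsLimitBracket.unique {P : PoissonBracket S} {f g h h' : completion F hF}
    (H : IsLimitBracket P f g h) (H' : IsLimitBracket P f g h') : h = h' := by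
  apply Subtype.ext; funext N
  obtain ⟨M, hM⟩ := H N
  obtain ⟨M', hM'⟩ := H' N
  rw [← hM (max M M') (le_max_left _ _) _ _ (mk_completionRep f _) (mk_completionRep g _),
    hM' (max M M') (le_max_right _ _) _ _ (mk_completionRep f _) (mk_completionRep g _)]

theorem PoissonContinuous.exists_limit {P : PoissonBracket S} (hP : PoissonContinuous P F)
    (f g : completion F hF) : ∃ h, IsLimitBracket P f g h := by
  choose M hNM hM using fun N => hP.eventually hF (completionRep f N) (completionRep g N) N
  have key : ∀ N m, M N ≤ m → ∀ a b : S, Ideal.Quotient.mk (F m) a = f.1 m →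
      Ideal.Quotient.mk (F m) b = g.1 m → Ideal.Quotient.mk (F N) (P.br a b) =
        Ideal.Quotient.mk (F N) (P.br (completionRep f (M N)) (completionRep g (M N))) := by
    intro N m hm a b ha hb
    rw [Ideal.Quotient.eq]
    refine hM N _ _ ?_ ?_ _ _ ?_ ?_
    · rw [← Ideal.Quotient.eq, mk_completionRep_of_le f (hNM N), mk_completionRep]
    · rw [← Ideal.Quotient.eq, mk_completionRep_of_le g (hNM N), mk_completionRep]
    · rw [← Ideal.Quotient.eq, mk_completionRep, ← f.2 _ _ hm, ← ha]; rfl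
    · rw [← Ideal.Quotient.eq, mk_completionRep, ← g.2 _ _ hm, ← hb]; rfl
  refine ⟨⟨fun N => Ideal.Quotient.mk (F N)
    (P.br (completionRep f (M N)) (completionRep g (M N))), ?_⟩, fun N => ⟨M N, fun m hm a b ha hb =>
      key N m hm a b ha hb⟩⟩
  intro m n hmn
  have h1 := key m (max (M m) (M n)) (le_max_left _ _) _ _ (mk_completionRep f _)
    (mk_completionRep g _)
  have h2 := key n (max (M m) (M n)) (le_max_right _ _) _ _ (mk_completionRep f _)
    (mk_completionRep g _)
  refine Eq.trans ?_ h1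
  exact (congrArg (Ideal.Quotient.factor (hF hmn)) h2.symm)

/-- The extension by continuity of a Poisson bracket to the completion. -/
def PoissonContinuous.limBr {P : PoissonBracket S} (hP : PoissonContinuous P F)
    (f g : completion F hF) : completion F hF :=
  Classical.choose (hP.exists_limit f g)

theorem PoissonContinuous.limBr_spec {P : PoissonBracket S} (hP : PoissonContinuous P F)
    (f g : completion F hF) : IsLimitBracket P f g (hP.limBr f g) :=
  Classical.choose_spec (hP.exists_limit f g)

theorem PoissonContinuous.limBr_rep {P : PoissonBracket S} (hP : PoissonContinuous P F)
    (f g : completion F hF) (N : ℕ) : ∃ M, ∀ m ≥ M, ∀ a b : S,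
      Ideal.Quotient.mk (F m) a = f.1 m → Ideal.Quotient.mk (F m) b = g.1 m →
        (hP.limBr f g).1 N = Ideal.Quotient.mk (F N) (P.br a b) := by
  obtain ⟨M, hM⟩ := hP.limBr_spec f g N
  exact ⟨M, fun m hm a b ha hb => (hM m hm a b ha hb).symm⟩

/-- The Poisson bracket on the completion, extended by continuity. -/
def PoissonContinuous.completion {P : PoissonBracket S} (hP : PoissonContinuous P F)
    (hF : Antitone F) : PoissonBracket (completion F hF) where
  br := LinearMap.mk₂ ℂ hP.limBr
    (fun f g h => by
      refine (hP.limBr_spec _ _).unique fun N => ?_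
      obtain ⟨M₁, h₁⟩ := hP.limBr_rep f h N
      obtain ⟨M₂, h₂⟩ := hP.limBr_rep g h N
      refine ⟨max M₁ M₂, fun m hm a b ha hb => ?_⟩
      rw [Subalgebra.coe_add, Pi.add_apply,
        h₁ m ((le_max_left _ _).trans hm) _ b (mk_completionRep f m) hb,
        h₂ m ((le_max_right _ _).trans hm) (a - completionRep f m) b
          (by rw [map_sub, ha, mk_completionRep]; simp) hb, ← map_add]
      simp only [map_sub, LinearMap.sub_apply, add_sub_cancel])
    (fun c f g => by
      apply Subtype.ext; funext N
      obtain ⟨M₁, h₁⟩ := hP.limBr_rep f g N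
      obtain ⟨M₂, h₂⟩ := hP.limBr_rep (c • f) g N
      have e := h₂ (max M₁ M₂) (le_max_right _ _) (c • completionRep f _) _
        (by rw [Subalgebra.coe_smul, Pi.smul_apply, ← mk_completionRep f]; rfl)
        (mk_completionRep g _)
      rw [e, Subalgebra.coe_smul, Pi.smul_apply, h₁ (max M₁ M₂) (le_max_left _ _) _ _
        (mk_completionRep f _) (mk_completionRep g _), map_smul, LinearMap.smul_apply]
      rfl)
    (fun f g h => by
      refine (hP.limBr_spec _ _).unique fun N => ?_
      obtain ⟨M₁, h₁⟩ := hP.limBr_rep f g N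
      obtain ⟨M₂, h₂⟩ := hP.limBr_rep f h N
      refine ⟨max M₁ M₂, fun m hm a b ha hb => ?_⟩
      rw [Subalgebra.coe_add, Pi.add_apply,
        h₁ m ((le_max_left _ _).trans hm) a _ ha (mk_completionRep g m),
        h₂ m ((le_max_right _ _).trans hm) a (b - completionRep g m) ha
          (by rw [map_sub, hb, mk_completionRep]; simp), ← map_add]
      simp only [map_sub, add_sub_cancel])
    (fun c f g => by
      apply Subtype.ext; funext N
      obtain ⟨M₁, h₁⟩ := hP.limBr_rep f g N
      obtain ⟨M₂, h₂⟩ := hP.limBr_rep f (c • g) N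
      have e := h₂ (max M₁ M₂) (le_max_right _ _) _ (c • completionRep g _)
        (mk_completionRep f _)
        (by rw [Subalgebra.coe_smul, Pi.smul_apply, ← mk_completionRep g]; rfl)
      rw [e, Subalgebra.coe_smul, Pi.smul_apply, h₁ (max M₁ M₂) (le_max_left _ _) _ _
        (mk_completionRep f _) (mk_completionRep g _), map_smul]
      rfl)
  skew f g := by
    apply Subtype.ext; funext N
    obtain ⟨M₁, h₁⟩ := hP.limBr_rep f g N
    obtain ⟨M₂, h₂⟩ := hP.limBr_rep g f N
    rw [LinearMap.mk₂_apply, LinearMap.mk₂_apply, Subalgebra.coe_neg, Pi.neg_apply,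
      h₁ (max M₁ M₂) (le_max_left _ _) _ _ (mk_completionRep f _) (mk_completionRep g _),
      h₂ (max M₁ M₂) (le_max_right _ _) _ _ (mk_completionRep g _) (mk_completionRep f _),
      P.skew, map_neg]
  jacobi f g h := by
    simp only [LinearMap.mk₂_apply]
    apply Subtype.ext; funext N
    obtain ⟨M₁, h₁⟩ := hP.limBr_rep f (hP.limBr g h) N
    obtain ⟨M₂, h₂⟩ := hP.limBr_rep (hP.limBr f g) h N
    obtain ⟨M₃, h₃⟩ := hP.limBr_rep g (hP.limBr f h) N
    obtain ⟨K, k₁, k₂, k₃⟩ : ∃ K, M₁ ≤ K ∧ M₂ ≤ K ∧ M₃ ≤ K :=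
      ⟨M₁ + M₂ + M₃, by omega, by omega, by omega⟩
    obtain ⟨L₁, l₁⟩ := hP.limBr_rep g h K
    obtain ⟨L₂, l₂⟩ := hP.limBr_rep f g K
    obtain ⟨L₃, l₃⟩ := hP.limBr_rep f h K
    obtain ⟨m, m₁, m₂, m₃, m₄⟩ : ∃ m, L₁ ≤ m ∧ L₂ ≤ m ∧ L₃ ≤ m ∧ K ≤ m :=
      ⟨L₁ + L₂ + L₃ + K, by omega, by omega, by omega, by omega⟩
    rw [Subalgebra.coe_add, Pi.add_apply,
      h₁ K k₁ _ _ (mk_completionRep_of_le f m₄)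
        (l₁ m m₁ _ _ (mk_completionRep g m) (mk_completionRep h m)).symm,
      h₂ K k₂ _ _ (l₂ m m₂ _ _ (mk_completionRep f m) (mk_completionRep g m)).symm
        (mk_completionRep_of_le h m₄),
      h₃ K k₃ _ _ (mk_completionRep_of_le g m₄)
        (l₃ m m₃ _ _ (mk_completionRep f m) (mk_completionRep h m)).symm,
      ← map_add, P.jacobi]
  leibniz f g h := by
    simp only [LinearMap.mk₂_apply]
    apply Subtype.ext; funext N
    obtain ⟨M₁, h₁⟩ := hP.limBr_rep (f * g) h N
    obtain ⟨M₂, h₂⟩ := hP.limBr_rep g h N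
    obtain ⟨M₃, h₃⟩ := hP.limBr_rep f h N
    obtain ⟨K, k₁, k₂, k₃, k₄⟩ : ∃ K, M₁ ≤ K ∧ M₂ ≤ K ∧ M₃ ≤ K ∧ N ≤ K :=
      ⟨M₁ + M₂ + M₃ + N, by omega, by omega, by omega, by omega⟩
    rw [Subalgebra.coe_add, Pi.add_apply, Subalgebra.coe_mul, Subalgebra.coe_mul, Pi.mul_apply,
      Pi.mul_apply,
      h₁ K k₁ (completionRep f K * completionRep g K) _
        (by rw [map_mul, mk_completionRep, mk_completionRep]; rfl) (mk_completionRep h K),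
      h₂ K k₂ _ _ (mk_completionRep g K) (mk_completionRep h K),
      h₃ K k₃ _ _ (mk_completionRep f K) (mk_completionRep h K),
      ← mk_completionRep_of_le f k₄, ← mk_completionRep_of_le g k₄, P.leibniz]
    simp only [map_add, map_mul]

/-- The two ideal products of the filtration are generated by sets `G n` and `G' n`; continuity
of the bracket follows from its behaviour on generators. -/
theorem PoissonContinuous.of_generators (P : PoissonBracket S) (G G' : ℕ → Set S)
    (hG : Antitone G) (hG' : Antitone G')
    (h₁ : ∀ n, ∀ x ∈ G n, ∀ y ∈ G n, P.br x y ∈ Ideal.span (G n))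
    (h₂ : ∀ n, ∀ x ∈ G' n, ∀ y ∈ G' n, P.br x y ∈ Ideal.span (G' n))
    (c₁ : ∀ f n, ∃ m, ∀ y ∈ G m, P.br f y ∈ Ideal.span (G n))
    (c₂ : ∀ f n, ∃ m, ∀ y ∈ G' m, P.br f y ∈ Ideal.span (G' n)) :
    PoissonContinuous P (fun n => Ideal.span (G n) ⊓ Ideal.span (G' n)) := by
  have A : ∀ (G : ℕ → Set S) n, (∀ x ∈ G n, ∀ y ∈ G n, P.br x y ∈ Ideal.span (G n)) →
      ∀ f ∈ Ideal.span (G n), ∀ g ∈ Ideal.span (G n), P.br f g ∈ Ideal.span (G n) := by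
    intro G n h f hf g hg
    induction hf using Submodule.span_induction with
    | zero => simp
    | add a b _ _ ha hb => rw [map_add, LinearMap.add_apply]; exact add_mem ha hb
    | smul a b hb hb' =>
      rw [smul_eq_mul, P.leibniz]
      exact add_mem (Ideal.mul_mem_left _ _ hb') (Ideal.mul_mem_right _ _ hb)
    | mem x hx =>
      induction hg using Submodule.span_induction with
      | zero => simp
      | add a b _ _ ha hb => rw [map_add]; exact add_mem ha hb
      | smul a b hb hb' =>
        rw [smul_eq_mul, P.leibniz_right]
        exact add_mem (Ideal.mul_mem_left _ _ hb') (Ideal.mul_mem_right _ _ hb)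
      | mem y hy => exact h x hx y hy
  have B : ∀ (G : ℕ → Set S), Antitone G → (∀ f n, ∃ m, ∀ y ∈ G m, P.br f y ∈ Ideal.span (G n)) →
      ∀ f n, ∃ m, ∀ g ∈ Ideal.span (G m), P.br f g ∈ Ideal.span (G n) := by
    intro G hG c f n
    obtain ⟨m, hm⟩ := c f n
    refine ⟨max m n, fun g hg => ?_⟩
    induction hg using Submodule.span_induction with
    | zero => simp
    | add a b _ _ ha hb => rw [map_add]; exact add_mem ha hb
    | smul a b hb hb' =>
      rw [smul_eq_mul, P.leibniz_right]
      exact add_mem (Ideal.mul_mem_left _ _ hb')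
        (Ideal.mul_mem_right _ _ (Ideal.span_mono (hG (le_max_right m n)) hb))
    | mem y hy => exact hm y (hG (le_max_left m n) hy)
  refine ⟨fun n f hf g hg => ⟨A G n (h₁ n) f hf.1 g hg.1, A G' n (h₂ n) f hf.2 g hg.2⟩,
    fun f n => ?_⟩
  obtain ⟨m, hm⟩ := B G hG c₁ f n
  obtain ⟨m', hm'⟩ := B G' hG' c₂ f n
  exact ⟨max m m', fun g hg => ⟨hm g (Ideal.span_mono (hG (le_max_left _ _)) hg.1),
    hm' g (Ideal.span_mono (hG' (le_max_right _ _)) hg.2)⟩⟩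

end Completion

/-- The descending filtration `G n · S ∩ G' n · S`. -/
def spanFil {S : Type*} [CommRing S] (G G' : ℕ → Set S) (n : ℕ) : Ideal S :=
  Ideal.span (G n) ⊓ Ideal.span (G' n)

theorem spanFil_antitone {S : Type*} [CommRing S] {G G' : ℕ → Set S} (hG : Antitone G)
    (hG' : Antitone G') : Antitone (spanFil G G') := fun _ _ h =>
  inf_le_inf (Ideal.span_mono (hG h)) (Ideal.span_mono (hG' h))

/-- A finite-dimensional complex Lie algebra with an action of the dihedral group of order `2T`
by linear and anti-linear automorphisms, and an invariant bilinear form. The form is the complex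
bilinear extension of a real form on the fixed points of `τ`, which amounts to `form_τ`. -/
structure DihedralLie (𝔤 : Type*) [LieRing 𝔤] [LieAlgebra ℂ 𝔤] (T : ℕ) where
  T_pos : 0 < T
  ω : ℂ
  ω_prim : IsPrimitiveRoot ω T
  σ : 𝔤 ≃ₗ⁅ℂ⁆ 𝔤
  σ_pow : ∀ x, σ^[T] x = x
  τ : 𝔤 →ₛₗ[starRingEnd ℂ] 𝔤
  τ_lie : ∀ x y, τ ⁅x, y⁆ = ⁅τ x, τ y⁆
  τ_τ : ∀ x, τ (τ x) = x
  τ_eigen : ∀ (j : ℕ) x, σ x = ω ^ j • x → σ (τ x) = ω ^ j • τ x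
  form : LinearMap.BilinForm ℂ 𝔤
  form_symm : form.IsSymm
  form_lie : form.lieInvariant 𝔤
  form_nondeg : form.Nondegenerate
  form_σ : ∀ x y, form (σ x) (σ y) = form x y
  form_τ : ∀ x y, form (τ x) (τ y) = starRingEnd ℂ (form x y)

variable {𝔤 : Type*} [LieRing 𝔤] [LieAlgebra ℂ 𝔤]

/-- The polynomial loop algebra `𝔤 ⊗ ℂ[t, t⁻¹]`. -/
def Loop (𝔤 : Type*) [LieRing 𝔤] [LieAlgebra ℂ 𝔤] : Type _ := loopAlgebra ℂ ℤ 𝔤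

instance : LieRing (Loop 𝔤) := inferInstanceAs (LieRing (loopAlgebra ℂ ℤ 𝔤))

instance : LieAlgebra ℂ (Loop 𝔤) := inferInstanceAs (LieAlgebra ℂ (loopAlgebra ℂ ℤ 𝔤))

/-- The coefficients of a Laurent polynomial with values in `𝔤`. -/
def loopCoeff : Loop 𝔤 ≃ₗ[ℂ] ℤ →₀ 𝔤 := LoopAlgebra.toFinsupp ℂ ℤ 𝔤

/-- The element `x ⊗ tⁿ` of the loop algebra. -/
def loopMono (n : ℤ) (x : 𝔤) : Loop 𝔤 :=
  (AddMonoidAlgebra.single n 1 ⊗ₜ x : loopAlgebra ℂ ℤ 𝔤)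

theorem loopCoeff_symm_single (n : ℤ) (x : 𝔤) :
    loopCoeff.symm (Finsupp.single n x) = loopMono n x :=
  LoopAlgebra.toFinsupp_symm_single ℂ ℤ 𝔤 n x

theorem loopCoeff_mono (n : ℤ) (x : 𝔤) : loopCoeff (loopMono n x) = Finsupp.single n x := by
  rw [← loopCoeff_symm_single, LinearEquiv.apply_symm_apply]

theorem loop_induction {P : Loop 𝔤 → Prop} (f : Loop 𝔤) (h0 : P 0)
    (hadd : ∀ f g, P f → P g → P (f + g)) (h : ∀ n x, P (loopMono n x)) : P f := by
  obtain ⟨f, rfl⟩ := loopCoeff.symm.surjective f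
  induction f using Finsupp.induction_linear with
  | zero => rwa [map_zero]
  | add f g hf hg => rw [map_add]; exact hadd _ _ hf hg
  | single n x => rw [loopCoeff_symm_single]; exact h n x

theorem loopMono_lie (m n : ℤ) (x y : 𝔤) :
    ⁅loopMono m x, loopMono n y⁆ = loopMono (m + n) ⁅x, y⁆ := by
  change ⁅(AddMonoidAlgebra.single m 1 ⊗ₜ x : loopAlgebra ℂ ℤ 𝔤),
    (AddMonoidAlgebra.single n 1 ⊗ₜ y : loopAlgebra ℂ ℤ 𝔤)⁆ = _
  rw [LieAlgebra.ExtendScalars.bracket_tmul, AddMonoidAlgebra.single_mul_single, mul_one]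
  rfl

theorem smul_loopMono (c : ℂ) (n : ℤ) (x : 𝔤) : c • loopMono n x = loopMono n (c • x) := by
  rw [← loopCoeff_symm_single, ← loopCoeff_symm_single, ← map_smul, Finsupp.smul_single]

/-- The additive map on the loop algebra with prescribed values on the elements `x ⊗ tⁿ`. -/
def loopExt {M : Type*} [AddCommGroup M] (φ : ℤ → 𝔤 →+ M) : Loop 𝔤 →+ M :=
  (Finsupp.liftAddHom φ).comp (loopCoeff (𝔤 := 𝔤)).toLinearMap.toAddMonoidHom

theorem loopExt_mono {M : Type*} [AddCommGroup M] (φ : ℤ → 𝔤 →+ M) (n : ℤ) (x : 𝔤) :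
    loopExt φ (loopMono n x) = φ n x := by
  simp [loopExt, loopCoeff_mono]

/-- `loopMono n` as an additive map. -/
def loopMonoHom (n : ℤ) : 𝔤 →+ Loop 𝔤 where
  toFun := loopMono n
  map_zero' := by rw [← loopCoeff_symm_single, Finsupp.single_zero, map_zero]
  map_add' x y := by simp only [← loopCoeff_symm_single, Finsupp.single_add, map_add]

/-- The derivation `t d/dt` of the loop algebra. -/
def loopDeg : Loop 𝔤 →ₗ[ℂ] Loop 𝔤 where
  __ := loopExt (M := Loop 𝔤) fun n => n • loopMonoHom n
  map_smul' c f := by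
    change loopExt _ (c • f) = c • loopExt _ f
    induction f using loop_induction with
    | h0 => simp
    | hadd f g hf hg => simp only [smul_add, map_add, hf, hg]
    | h n x =>
      rw [smul_loopMono, loopExt_mono, loopExt_mono]
      change n • loopMono n (c • x) = c • n • loopMono n x
      rw [← smul_loopMono, smul_comm]

theorem loopDeg_mono (n : ℤ) (x : 𝔤) : loopDeg (loopMono n x) = (n : ℂ) • loopMono n x := by
  change loopExt (fun n => n • loopMonoHom n) (loopMono n x) = _
  rw [loopExt_mono]
  exact (Int.cast_smul_eq_zsmul ℂ n (loopMono n x)).symm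

theorem loopDeg_lie (f g : Loop 𝔤) :
    loopDeg ⁅f, g⁆ = ⁅loopDeg f, g⁆ + ⁅f, loopDeg g⁆ := by
  induction f using loop_induction with
  | h0 => simp
  | hadd f g hf hg => simp only [add_lie, map_add, hf, hg]; abel
  | h m x =>
    induction g using loop_induction with
    | h0 => simp
    | hadd f g hf hg => simp only [lie_add, map_add, hf, hg]; abel
    | h n y =>
      simp only [loopMono_lie, loopDeg_mono, smul_lie, lie_smul, ← add_smul]
      push_cast; rfl

namespace DihedralLie

variable {T : ℕ} (G : DihedralLie 𝔤 T)

/-- The cocycle `(x ⊗ tᵐ, y ⊗ tⁿ) ↦ m δ_{m+n,0} ⟨x, y⟩` of the loop algebra. -/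
def cocycle : LinearMap.BilinForm ℂ (Loop 𝔤) :=
  -(LoopAlgebra.residuePairing ℂ ℤ 𝔤 G.form : LinearMap.BilinForm ℂ (loopAlgebra ℂ ℤ 𝔤))

theorem cocycle_mono (m n : ℤ) (x y : 𝔤) :
    G.cocycle (loopMono m x) (loopMono n y) = if m + n = 0 then m * G.form x y else 0 := by
  have e : G.cocycle (loopMono m x) (loopMono n y) = -((loopCoeff (loopMono n y)).sum
    fun a v => a • G.form (loopCoeff (loopMono m x) (-a)) v) := rfl
  rw [e, loopCoeff_mono, loopCoeff_mono]
  rw [Finsupp.sum_single_index (by simp), Finsupp.single_apply]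
  split_ifs with h1 h2 h2
  · have : n = -m := by omega
    simp [this]
  · omega
  · omega
  · simp

theorem cocycle_lie (f g h : Loop 𝔤) :
    G.cocycle f ⁅g, h⁆ = G.cocycle ⁅f, g⁆ h + G.cocycle g ⁅f, h⁆ := by
  induction f using loop_induction with
  | h0 => simp
  | hadd f g hf hg => simp only [add_lie, map_add, LinearMap.add_apply, hf, hg]; abel
  | h m x =>
    induction g using loop_induction with
    | h0 => simp
    | hadd f g hf hg => simp only [add_lie, lie_add, map_add, LinearMap.add_apply, hf, hg]; abel
    | h n y =>
      induction h using loop_induction with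
      | h0 => simp
      | hadd f g hf hg => simp only [lie_add, map_add, hf, hg]; abel
      | h l z =>
        simp only [loopMono_lie, cocycle_mono]
        have e1 : G.form ⁅x, y⁆ z = G.form x ⁅y, z⁆ := by
          rw [← lie_skew, map_neg, LinearMap.neg_apply, G.form_lie y x z, neg_neg]
        have e2 : G.form y ⁅x, z⁆ = -G.form x ⁅y, z⁆ := by rw [← e1, G.form_lie x y z, neg_neg]
        rw [e1, e2, show m + n + l = m + (n + l) by ring, show n + (m + l) = m + (n + l) by ring]
        split_ifs
        · push_cast; ring
        · ring

theorem cocycle_skew (f g : Loop 𝔤) : G.cocycle f g = -G.cocycle g f := by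
  induction f using loop_induction with
  | h0 => simp
  | hadd f g hf hg => simp only [map_add, LinearMap.add_apply, hf, hg]; ring
  | h m x =>
    induction g using loop_induction with
    | h0 => simp
    | hadd f g hf hg => simp only [map_add, LinearMap.add_apply, hf, hg]; ring
    | h n y =>
      rw [cocycle_mono, cocycle_mono, add_comm n m, G.form_symm.eq y x]
      split_ifs with h
      · have : n = -m := by omega
        subst this; push_cast; ring
      · ring

theorem cocycle_deg (f g : Loop 𝔤) :
    G.cocycle (loopDeg f) g = -G.cocycle f (loopDeg g) := by
  induction f using loop_induction with
  | h0 => simp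
  | hadd f g hf hg => simp only [map_add, LinearMap.add_apply, hf, hg]; ring
  | h m x =>
    induction g using loop_induction with
    | h0 => simp
    | hadd f g hf hg => simp only [map_add, hf, hg]; ring
    | h n y =>
      simp only [loopDeg_mono, map_smul, LinearMap.smul_apply, cocycle_mono, smul_eq_mul]
      split_ifs with h
      · have : n = -m := by omega
        subst this; push_cast; ring
      · ring

end DihedralLie

/-- The affine Kac-Moody algebra: triples `(f, α, x)` standing for `f + α K + x D`. -/
@[ext]
structure Affine {T : ℕ} (G : DihedralLie 𝔤 T) where
  loop : Loop 𝔤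
  k : ℂ
  d : ℂ

namespace Affine

variable {T : ℕ} {G : DihedralLie 𝔤 T}

/-- Affine elements as triples. -/
def equivProd : Affine G ≃ Loop 𝔤 × ℂ × ℂ where
  toFun X := (X.loop, X.k, X.d)
  invFun p := ⟨p.1, p.2.1, p.2.2⟩

instance : AddCommGroup (Affine G) := equivProd.addCommGroup

instance : Module ℂ (Affine G) := equivProd.module ℂ

@[simp] theorem zero_loop : (0 : Affine G).loop = 0 := rfl
@[simp] theorem zero_k : (0 : Affine G).k = 0 := rfl
@[simp] theorem zero_d : (0 : Affine G).d = 0 := rfl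
@[simp] theorem add_loop (X Y : Affine G) : (X + Y).loop = X.loop + Y.loop := rfl
@[simp] theorem add_k (X Y : Affine G) : (X + Y).k = X.k + Y.k := rfl
@[simp] theorem add_d (X Y : Affine G) : (X + Y).d = X.d + Y.d := rfl
@[simp] theorem smul_loop (c : ℂ) (X : Affine G) : (c • X).loop = c • X.loop := rfl
@[simp] theorem smul_k (c : ℂ) (X : Affine G) : (c • X).k = c * X.k := rfl
@[simp] theorem smul_d (c : ℂ) (X : Affine G) : (c • X).d = c * X.d := rfl

/-- `[f + αK + xD, g + βK + yD] = [f, g] + x ∂g - y ∂f + cocycle(f, g) K`. -/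
instance : Bracket (Affine G) (Affine G) where
  bracket X Y := ⟨⁅X.loop, Y.loop⁆ + X.d • loopDeg Y.loop - Y.d • loopDeg X.loop,
    G.cocycle X.loop Y.loop, 0⟩

theorem lie_loop (X Y : Affine G) : ⁅X, Y⁆.loop =
    ⁅X.loop, Y.loop⁆ + X.d • loopDeg Y.loop - Y.d • loopDeg X.loop := rfl
theorem lie_k (X Y : Affine G) : ⁅X, Y⁆.k = G.cocycle X.loop Y.loop := rfl
@[simp] theorem lie_d (X Y : Affine G) : ⁅X, Y⁆.d = 0 := rfl

instance : LieRing (Affine G) where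
  add_lie X Y Z := by
    ext1
    · simp only [lie_loop, add_loop, add_d, add_lie, add_smul, map_add, smul_add]; abel
    · simp only [lie_k, add_loop, add_k, map_add, LinearMap.add_apply]
    · simp
  lie_add X Y Z := by
    ext1
    · simp only [lie_loop, add_loop, add_d, lie_add, add_smul, map_add, smul_add]; abel
    · simp only [lie_k, add_loop, add_k, map_add]
    · simp
  lie_self X := by
    ext1
    · simp [lie_loop]
    · rw [lie_k, zero_k]; exact self_eq_neg.mp (G.cocycle_skew X.loop X.loop)
    · simp
  leibniz_lie X Y Z := by
    ext1
    · simp only [lie_loop, add_loop, lie_d, zero_smul, map_add, map_sub, map_smul, loopDeg_lie,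
        lie_add, lie_sub, add_lie, sub_lie, lie_smul, smul_lie, smul_add, smul_sub, sub_zero,
        add_zero, leibniz_lie X.loop Y.loop Z.loop, smul_smul]
      rw [← lie_skew (loopDeg X.loop) Y.loop, mul_comm X.d Y.d, mul_comm X.d Z.d, mul_comm Y.d Z.d]
      module
    · simp only [lie_k, lie_loop, add_k, map_add, map_sub, map_smul, LinearMap.add_apply,
        LinearMap.sub_apply, LinearMap.smul_apply, G.cocycle_deg, G.cocycle_lie X.loop,
        smul_eq_mul]
      rw [G.cocycle_skew Y.loop (loopDeg X.loop), G.cocycle_deg]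
      ring
    · simp

instance : LieAlgebra ℂ (Affine G) where
  lie_smul c X Y := by
    ext1
    · simp only [lie_loop, smul_loop, smul_d, map_smul, lie_smul]; module
    · simp [lie_k]
    · simp

/-- The element `x ⊗ tⁿ` of the affine algebra. -/
def mono (n : ℤ) (x : 𝔤) : Affine G := ⟨loopMono n x, 0, 0⟩

/-- The central element `K`. -/
def K : Affine G := ⟨0, 1, 0⟩

/-- The derivation element `D`. -/
def D : Affine G := ⟨0, 0, 1⟩

end Affine

namespace DihedralLie

variable {T : ℕ} (G : DihedralLie 𝔤 T)

/-- The extension of `σ` to the loop algebra, `x ⊗ tⁿ ↦ σ x ⊗ tⁿ`. -/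
def loopσ : Loop 𝔤 →+ Loop 𝔤 :=
  loopExt fun n => (loopMonoHom n).comp (AddMonoidHomClass.toAddMonoidHom G.σ)

/-- The extension of `τ` to the loop algebra, `x ⊗ tⁿ ↦ τ x ⊗ t⁻ⁿ`. -/
def loopτ : Loop 𝔤 →+ Loop 𝔤 :=
  loopExt fun n => (loopMonoHom (-n)).comp (AddMonoidHomClass.toAddMonoidHom G.τ)

theorem loopσ_mono (n : ℤ) (x : 𝔤) : G.loopσ (loopMono n x) = loopMono n (G.σ x) :=
  loopExt_mono _ _ _

theorem loopτ_mono (n : ℤ) (x : 𝔤) : G.loopτ (loopMono n x) = loopMono (-n) (G.τ x) :=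
  loopExt_mono _ _ _

theorem loopσ_smul (c : ℂ) (f : Loop 𝔤) : G.loopσ (c • f) = c • G.loopσ f := by
  induction f using loop_induction with
  | h0 => simp
  | hadd f g hf hg => simp only [smul_add, map_add, hf, hg]
  | h n x => rw [smul_loopMono, loopσ_mono, loopσ_mono, smul_loopMono, map_smul]

theorem loopτ_smul (c : ℂ) (f : Loop 𝔤) : G.loopτ (c • f) = starRingEnd ℂ c • G.loopτ f := by
  induction f using loop_induction with
  | h0 => simp
  | hadd f g hf hg => simp only [smul_add, map_add, hf, hg]
  | h n x => rw [smul_loopMono, loopτ_mono, loopτ_mono, smul_loopMono, map_smulₛₗ]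

theorem loopσ_lie (f g : Loop 𝔤) : G.loopσ ⁅f, g⁆ = ⁅G.loopσ f, G.loopσ g⁆ := by
  induction f using loop_induction with
  | h0 => simp
  | hadd f g hf hg => simp only [add_lie, map_add, hf, hg]
  | h m x =>
    induction g using loop_induction with
    | h0 => simp
    | hadd f g hf hg => simp only [lie_add, map_add, hf, hg]
    | h n y => simp only [loopMono_lie, loopσ_mono, LieEquiv.map_lie]

theorem loopτ_lie (f g : Loop 𝔤) : G.loopτ ⁅f, g⁆ = ⁅G.loopτ f, G.loopτ g⁆ := by
  induction f using loop_induction with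
  | h0 => simp
  | hadd f g hf hg => simp only [add_lie, map_add, hf, hg]
  | h m x =>
    induction g using loop_induction with
    | h0 => simp
    | hadd f g hf hg => simp only [lie_add, map_add, hf, hg]
    | h n y => rw [loopMono_lie, loopτ_mono, loopτ_mono, loopτ_mono, loopMono_lie, τ_lie, neg_add]

theorem loopσ_deg (f : Loop 𝔤) : G.loopσ (loopDeg f) = loopDeg (G.loopσ f) := by
  induction f using loop_induction with
  | h0 => simp
  | hadd f g hf hg => simp only [map_add, hf, hg]
  | h n x => rw [loopDeg_mono, loopσ_smul, loopσ_mono, loopDeg_mono]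

theorem loopτ_deg (f : Loop 𝔤) : G.loopτ (loopDeg f) = -loopDeg (G.loopτ f) := by
  induction f using loop_induction with
  | h0 => simp
  | hadd f g hf hg => simp only [map_add, hf, hg, neg_add]
  | h n x => rw [loopDeg_mono, loopτ_smul, loopτ_mono, loopDeg_mono]; simp

theorem cocycle_σ (f g : Loop 𝔤) : G.cocycle (G.loopσ f) (G.loopσ g) = G.cocycle f g := by
  induction f using loop_induction with
  | h0 => simp
  | hadd f g hf hg => simp only [map_add, LinearMap.add_apply, hf, hg]
  | h m x =>
    induction g using loop_induction with
    | h0 => simp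
    | hadd f g hf hg => simp only [map_add, hf, hg]
    | h n y => rw [loopσ_mono, loopσ_mono, cocycle_mono, cocycle_mono, form_σ]

theorem cocycle_τ (f g : Loop 𝔤) :
    G.cocycle (G.loopτ f) (G.loopτ g) = -starRingEnd ℂ (G.cocycle f g) := by
  induction f using loop_induction with
  | h0 => simp
  | hadd f g hf hg => simp only [map_add, LinearMap.add_apply, hf, hg, neg_add]
  | h m x =>
    induction g using loop_induction with
    | h0 => simp
    | hadd f g hf hg => simp only [map_add, hf, hg, neg_add]
    | h n y =>
      rw [loopτ_mono, loopτ_mono, cocycle_mono, cocycle_mono, form_τ]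
      by_cases h : m + n = 0
      · rw [if_pos (by omega), if_pos h]; simp
      · rw [if_neg (by omega), if_neg h]; simp

/-- The linear automorphism `σ` of the affine algebra, with `σ K = K` and `σ D = D`. -/
def affσ : Affine G →+ Affine G where
  toFun X := ⟨G.loopσ X.loop, X.k, X.d⟩
  map_zero' := by ext1 <;> simp
  map_add' X Y := by ext1 <;> simp

/-- The anti-linear automorphism `τ` of the affine algebra, with `τ K = -K` and `τ D = -D`. -/
def affτ : Affine G →+ Affine G where
  toFun X := ⟨G.loopτ X.loop, -starRingEnd ℂ X.k, -starRingEnd ℂ X.d⟩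
  map_zero' := by ext1 <;> simp
  map_add' X Y := by
    ext1
    · simp
    · simp only [Affine.add_k, map_add, neg_add]
    · simp only [Affine.add_d, map_add, neg_add]

theorem affσ_smul (c : ℂ) (X : Affine G) : G.affσ (c • X) = c • G.affσ X := by
  ext1
  · exact G.loopσ_smul c X.loop
  · rfl
  · rfl

theorem affτ_smul (c : ℂ) (X : Affine G) : G.affτ (c • X) = starRingEnd ℂ c • G.affτ X := by
  ext1
  · exact G.loopτ_smul c X.loop
  · change -starRingEnd ℂ (c * X.k) = starRingEnd ℂ c * -starRingEnd ℂ X.k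
    rw [map_mul]; ring
  · change -starRingEnd ℂ (c * X.d) = starRingEnd ℂ c * -starRingEnd ℂ X.d
    rw [map_mul]; ring

theorem affσ_lie (X Y : Affine G) : G.affσ ⁅X, Y⁆ = ⁅G.affσ X, G.affσ Y⁆ := by
  ext1
  · change G.loopσ (⁅X.loop, Y.loop⁆ + X.d • loopDeg Y.loop - Y.d • loopDeg X.loop) =
      ⁅G.loopσ X.loop, G.loopσ Y.loop⁆ + X.d • loopDeg (G.loopσ Y.loop) -
        Y.d • loopDeg (G.loopσ X.loop)
    simp only [map_add, map_sub, loopσ_smul, loopσ_lie, loopσ_deg]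
  · exact (G.cocycle_σ X.loop Y.loop).symm
  · rfl

theorem affτ_lie (X Y : Affine G) : G.affτ ⁅X, Y⁆ = ⁅G.affτ X, G.affτ Y⁆ := by
  ext1
  · change G.loopτ (⁅X.loop, Y.loop⁆ + X.d • loopDeg Y.loop - Y.d • loopDeg X.loop) =
      ⁅G.loopτ X.loop, G.loopτ Y.loop⁆ + (-starRingEnd ℂ X.d) • loopDeg (G.loopτ Y.loop) -
        (-starRingEnd ℂ Y.d) • loopDeg (G.loopτ X.loop)
    simp only [map_add, map_sub, loopτ_smul, loopτ_lie, loopτ_deg, smul_neg, neg_smul]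
  · exact (G.cocycle_τ X.loop Y.loop).symm
  · change -starRingEnd ℂ 0 = 0
    rw [map_zero, neg_zero]

/-- Complex conjugation of a scalar if `b` is true. -/
def conjIf (b : Bool) : ℂ →+* ℂ := if b then starRingEnd ℂ else RingHom.id ℂ

/-- The action of the element `sᵏ tᵇ` of the dihedral group on the affine algebra. -/
def act (k : ℕ) (b : Bool) (X : Affine G) : Affine G := G.affσ^[k] (if b then G.affτ X else X)

theorem act_add (k : ℕ) (b : Bool) (X Y : Affine G) :
    G.act k b (X + Y) = G.act k b X + G.act k b Y := by
  unfold act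
  rw [← iterate_map_add G.affσ k]
  cases b <;> simp

theorem act_zero (k : ℕ) (b : Bool) : G.act k b 0 = 0 := by
  have := G.act_add k b 0 0
  rwa [add_zero, left_eq_add] at this

theorem affσ_iterate_smul (k : ℕ) (c : ℂ) (X : Affine G) :
    G.affσ^[k] (c • X) = c • G.affσ^[k] X := by
  induction k generalizing X with
  | zero => rfl
  | succ k ih => rw [Function.iterate_succ_apply, affσ_smul, ih, Function.iterate_succ_apply]

theorem affσ_iterate_lie (k : ℕ) (X Y : Affine G) :
    G.affσ^[k] ⁅X, Y⁆ = ⁅G.affσ^[k] X, G.affσ^[k] Y⁆ := by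
  induction k generalizing X Y with
  | zero => rfl
  | succ k ih => rw [Function.iterate_succ_apply, affσ_lie, ih, Function.iterate_succ_apply,
      Function.iterate_succ_apply]

theorem act_smul (k : ℕ) (b : Bool) (c : ℂ) (X : Affine G) :
    G.act k b (c • X) = conjIf b c • G.act k b X := by
  unfold act
  rw [← affσ_iterate_smul]
  cases b
  · rfl
  · simp only [if_true, affτ_smul]; rfl

theorem act_lie (k : ℕ) (b : Bool) (X Y : Affine G) :
    G.act k b ⁅X, Y⁆ = ⁅G.act k b X, G.act k b Y⁆ := by
  unfold act
  rw [← affσ_iterate_lie]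
  cases b
  · rfl
  · simp only [if_true, affτ_lie]

/-- The action of `sᵏ tᵇ` on the Riemann sphere, `z ↦ ωᵏ z` or `z ↦ ωᵏ z̄`. -/
def mobius (k : ℕ) (b : Bool) : OnePoint ℂ → OnePoint ℂ :=
  OnePoint.map fun w => G.ω ^ k * conjIf b w

end DihedralLie

/-- A finite set of marked points of the Riemann sphere, containing `∞` and with pairwise
disjoint dihedral orbits, together with a divisor `∑ mult x · x` of positive multiplicities. -/
structure Poles {T : ℕ} (G : DihedralLie 𝔤 T) where
  pts : Finset (OnePoint ℂ)
  infty_mem : OnePoint.infty ∈ pts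
  orbits : ∀ x ∈ pts, ∀ y ∈ pts, ∀ k b, G.mobius k b x = y → x = y
  mult : OnePoint ℂ → ℕ
  mult_pos : ∀ x ∈ pts, 1 ≤ mult x

namespace Poles

variable {T : ℕ} {G : DihedralLie 𝔤 T} (P : Poles G)

/-- The direct sum over the marked points `x` of the Takiff algebras `𝔤̃ ⊗ ℂ[ε] / ε ^ mult x`;
the entry `X x p` is the coefficient of `ε ^ p`. -/
def TakiffSum : Type _ := ∀ x : P.pts, Fin (P.mult x) → Affine G

namespace TakiffSum

variable {P}

instance : AddCommGroup P.TakiffSum :=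
  inferInstanceAs (AddCommGroup (∀ x : P.pts, Fin (P.mult x) → Affine G))

instance : Module ℂ P.TakiffSum :=
  inferInstanceAs (Module ℂ (∀ x : P.pts, Fin (P.mult x) → Affine G))

theorem ext {X Y : P.TakiffSum} (h : ∀ x p, X x p = Y x p) : X = Y :=
  funext fun x => funext fun p => h x p

@[simp] theorem zero_apply (x : P.pts) (p : Fin (P.mult x)) : (0 : P.TakiffSum) x p = 0 := rfl
@[simp] theorem add_apply (X Y : P.TakiffSum) (x : P.pts) (p : Fin (P.mult x)) :
    (X + Y) x p = X x p + Y x p := rfl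
@[simp] theorem smul_apply (c : ℂ) (X : P.TakiffSum) (x : P.pts) (p : Fin (P.mult x)) :
    (c • X) x p = c • X x p := rfl

instance : Bracket P.TakiffSum P.TakiffSum where
  bracket X Y := fun x p => ∑ i : Fin (P.mult x), ∑ j : Fin (P.mult x), if (i : ℕ) + j = p then ⁅X x i, Y x j⁆ else 0

theorem lie_apply (X Y : P.TakiffSum) (x : P.pts) (p : Fin (P.mult x)) :
    ⁅X, Y⁆ x p = ∑ i : Fin (P.mult x), ∑ j : Fin (P.mult x),
      if (i : ℕ) + j = p then ⁅X x i, Y x j⁆ else 0 := rfl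

theorem lie_lie_apply (X Y Z : P.TakiffSum) (x : P.pts) (p : Fin (P.mult x)) :
    ⁅X, ⁅Y, Z⁆⁆ x p = ∑ i : Fin (P.mult x), ∑ j : Fin (P.mult x), ∑ k : Fin (P.mult x),
      if (i : ℕ) + j + k = p then ⁅X x i, ⁅Y x j, Z x k⁆⁆ else 0 := by
  rw [lie_apply]
  refine Finset.sum_congr rfl fun i _ => ?_
  have h1 : ∀ m : Fin (P.mult x), (if (i : ℕ) + m = p then ⁅X x i, ⁅Y, Z⁆ x m⁆ else 0) =
      ∑ j : Fin (P.mult x), ∑ k : Fin (P.mult x), if (i : ℕ) + m = p ∧ (j : ℕ) + k = m then ⁅X x i, ⁅Y x j, Z x k⁆⁆ else 0 := by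
    intro m
    split_ifs with h
    · rw [lie_apply, lie_sum]
      refine Finset.sum_congr rfl fun j _ => ?_
      rw [lie_sum]
      refine Finset.sum_congr rfl fun k _ => ?_
      split_ifs with h1 h2 h2
      · rfl
      · exact absurd ⟨h, h1⟩ h2
      · exact absurd h2.2 h1
      · exact lie_zero _
    · symm
      refine Finset.sum_eq_zero fun j _ => Finset.sum_eq_zero fun k _ => if_neg fun h' => h h'.1
  rw [Finset.sum_congr rfl fun m _ => h1 m, Finset.sum_comm]
  refine Finset.sum_congr rfl fun j _ => ?_
  rw [Finset.sum_comm]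
  refine Finset.sum_congr rfl fun k _ => ?_
  by_cases h : (i : ℕ) + j + k = p
  · have hp := p.2
    rw [if_pos h, Finset.sum_eq_single (⟨j + k, by omega⟩ : Fin (P.mult x))]
    · rw [if_pos ⟨by simp only; omega, rfl⟩]
    · intro m _ hm
      rw [if_neg]
      rintro ⟨_, h2⟩
      exact hm (Fin.ext h2.symm)
    · intro h; exact absurd (Finset.mem_univ _) h
  · rw [if_neg h]
    refine Finset.sum_eq_zero fun m _ => if_neg ?_
    rintro ⟨h1, h2⟩
    omega

instance : LieRing P.TakiffSum where
  add_lie X Y Z := by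
    refine TakiffSum.ext fun x p => ?_
    simp only [lie_apply, add_apply, ← Finset.sum_add_distrib]
    refine Finset.sum_congr rfl fun i _ => Finset.sum_congr rfl fun j _ => ?_
    split_ifs <;> simp [add_lie]
  lie_add X Y Z := by
    refine TakiffSum.ext fun x p => ?_
    simp only [lie_apply, add_apply, ← Finset.sum_add_distrib]
    refine Finset.sum_congr rfl fun i _ => Finset.sum_congr rfl fun j _ => ?_
    split_ifs <;> simp [lie_add]
  lie_self X := by
    refine TakiffSum.ext fun x p => ?_
    have h : ⁅X, X⁆ x p = -⁅X, X⁆ x p := by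
      conv_lhs => rw [lie_apply, Finset.sum_comm]
      rw [lie_apply, ← Finset.sum_neg_distrib]
      refine Finset.sum_congr rfl fun i _ => ?_
      rw [← Finset.sum_neg_distrib]
      refine Finset.sum_congr rfl fun j _ => ?_
      rw [add_comm (j : ℕ) i]
      split_ifs
      · rw [lie_skew]
      · rw [neg_zero]
    have h2 : (2 : ℂ) • ⁅X, X⁆ x p = 0 := by
      rw [two_smul]; nth_rewrite 1 [h]; exact neg_add_cancel _
    exact (smul_eq_zero.mp h2).resolve_left two_ne_zero
  leibniz_lie X Y Z := by
    have skew : ∀ A B : P.TakiffSum, ⁅A, B⁆ = -⁅B, A⁆ := by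
      intro A B
      refine TakiffSum.ext fun x p => ?_
      change ⁅A, B⁆ x p = -⁅B, A⁆ x p
      rw [lie_apply, lie_apply, Finset.sum_comm, ← Finset.sum_neg_distrib]
      refine Finset.sum_congr rfl fun i _ => ?_
      rw [← Finset.sum_neg_distrib]
      refine Finset.sum_congr rfl fun j _ => ?_
      rw [add_comm (j : ℕ) i]
      split_ifs
      · rw [lie_skew]
      · rw [neg_zero]
    rw [skew ⁅X, Y⁆ Z]
    refine TakiffSum.ext fun x p => ?_
    change ⁅X, ⁅Y, Z⁆⁆ x p = -⁅Z, ⁅X, Y⁆⁆ x p + ⁅Y, ⁅X, Z⁆⁆ x p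
    rw [lie_lie_apply, lie_lie_apply, lie_lie_apply]
    rw [Finset.sum_comm (γ := Fin (P.mult x)) (s := Finset.univ) (t := Finset.univ)
      (f := fun i j : Fin (P.mult x) => ∑ k : Fin (P.mult x), if (i : ℕ) + j + k = p then ⁅Y x i, ⁅X x j, Z x k⁆⁆ else 0)]
    rw [Finset.sum_comm (γ := Fin (P.mult x)) (s := Finset.univ) (t := Finset.univ)
      (f := fun i j : Fin (P.mult x) => ∑ k : Fin (P.mult x), if (i : ℕ) + j + k = p then ⁅Z x i, ⁅X x j, Y x k⁆⁆ else 0)]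
    rw [← Finset.sum_neg_distrib, ← Finset.sum_add_distrib]
    refine Finset.sum_congr rfl fun i _ => ?_
    rw [Finset.sum_comm (γ := Fin (P.mult x)) (s := Finset.univ) (t := Finset.univ)
      (f := fun j k : Fin (P.mult x) => if (j : ℕ) + i + k = p then ⁅Z x j, ⁅X x i, Y x k⁆⁆ else 0)]
    rw [← Finset.sum_neg_distrib, ← Finset.sum_add_distrib]
    refine Finset.sum_congr rfl fun j _ => ?_
    rw [← Finset.sum_neg_distrib, ← Finset.sum_add_distrib]
    refine Finset.sum_congr rfl fun k _ => ?_
    by_cases h : (i : ℕ) + j + k = p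
    · rw [if_pos h, if_pos (by omega), if_pos (by omega), leibniz_lie (X x i), lie_skew]
    · rw [if_neg h, if_neg (by omega), if_neg (by omega), neg_zero, zero_add]

theorem lie_smul_complex (c : ℂ) (X Y : P.TakiffSum) : ⁅X, c • Y⁆ = c • ⁅X, Y⁆ := by
  refine TakiffSum.ext fun x p => ?_
  simp only [lie_apply, smul_apply, Finset.smul_sum]
  refine Finset.sum_congr rfl fun i _ => Finset.sum_congr rfl fun j _ => ?_
  split_ifs <;> simp

instance : LieAlgebra ℂ P.TakiffSum where
  lie_smul := lie_smul_complex

/-- The realification. -/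
instance : LieAlgebra ℝ P.TakiffSum where
  lie_smul r X Y := by
    rw [← Complex.coe_smul, ← Complex.coe_smul, lie_smul_complex]

end TakiffSum

open Classical in
/-- The action of `sᵏ tᵇ` on the Takiff algebra at `x`: on `𝔤̃` through `act`, on the formal
variable by `ε ↦ ω⁻¹ ε` at a finite point and by `ε ↦ ω ε` at infinity. -/
def takiffAct (x : OnePoint ℂ) (k : ℕ) (b : Bool) {n : ℕ} (X : Fin n → Affine G) :
    Fin n → Affine G :=
  fun p => ((if x = OnePoint.infty then G.ω else G.ω⁻¹) ^ k) ^ (p : ℕ) • G.act k b (X p)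

/-- The real Lie algebra `𝔤̃^𝒟`: the elements whose component at each marked point `x` is
invariant under the stabiliser of `x`, without constant term in `ε` at infinity. -/
def tilde : LieSubalgebra ℝ P.TakiffSum where
  carrier := {X | ∀ x : P.pts,
    (∀ k b, G.mobius k b x = x → takiffAct x k b (X x) = X x) ∧
    ((x : OnePoint ℂ) = OnePoint.infty → ∀ p : Fin (P.mult x), (p : ℕ) = 0 → X x p = 0)}
  zero_mem' x := by
    refine ⟨fun k b _ => funext fun p => ?_, fun _ _ _ => rfl⟩
    change _ • G.act k b 0 = 0
    rw [G.act_zero, smul_zero]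
  add_mem' {X Y} hX hY x := by
    refine ⟨fun k b h => funext fun p => ?_, fun h p hp => ?_⟩
    · change _ • G.act k b (X x p + Y x p) = X x p + Y x p
      rw [G.act_add, smul_add]
      exact congrArg₂ (· + ·) (congrFun ((hX x).1 k b h) p) (congrFun ((hY x).1 k b h) p)
    · rw [TakiffSum.add_apply, (hX x).2 h p hp, (hY x).2 h p hp, add_zero]
  smul_mem' r X hX x := by
    rw [← Complex.coe_smul]
    refine ⟨fun k b h => funext fun p => ?_, fun h p hp => ?_⟩
    · change _ • G.act k b ((r : ℂ) • X x p) = (r : ℂ) • X x p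
      have hr : DihedralLie.conjIf b (r : ℂ) = r := by
        cases b
        · rfl
        · exact Complex.conj_ofReal r
      rw [G.act_smul, hr, smul_comm]
      exact congrArg ((r : ℂ) • ·) (congrFun ((hX x).1 k b h) p)
    · rw [TakiffSum.smul_apply, (hX x).2 h p hp, smul_zero]
  lie_mem' {X Y} hX hY x := by
    refine ⟨fun k b h => funext fun p => ?_, fun h p hp => ?_⟩
    · obtain ⟨w, hw⟩ : ∃ w : ℂ, ∀ (Z : Fin (P.mult x) → Affine G) i,
          takiffAct x k b Z i = w ^ (i : ℕ) • G.act k b (Z i) := ⟨_, fun _ _ => rfl⟩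
      have hX' : ∀ i : Fin (P.mult x), w ^ (i : ℕ) • G.act k b (X x i) = X x i := fun i =>
        (hw (X x) i).symm.trans (congrFun ((hX x).1 k b h) i)
      have hY' : ∀ i : Fin (P.mult x), w ^ (i : ℕ) • G.act k b (Y x i) = Y x i := fun i =>
        (hw (Y x) i).symm.trans (congrFun ((hY x).1 k b h) i)
      have hact : ∀ (s : Finset (Fin (P.mult x))) (f : Fin (P.mult x) → Affine G),
          G.act k b (∑ i ∈ s, f i) = ∑ i ∈ s, G.act k b (f i) := fun s f =>
        map_sum (⟨⟨G.act k b, G.act_zero k b⟩, G.act_add k b⟩ : Affine G →+ Affine G) f s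
      rw [hw, TakiffSum.lie_apply, hact, Finset.smul_sum]
      refine Finset.sum_congr rfl fun i _ => ?_
      rw [hact, Finset.smul_sum]
      refine Finset.sum_congr rfl fun j _ => ?_
      split_ifs with hij
      · rw [G.act_lie, ← hij, pow_add, mul_smul, ← lie_smul, ← smul_lie, hX', hY']
      · rw [G.act_zero, smul_zero]
    · rw [TakiffSum.lie_apply]
      refine Finset.sum_eq_zero fun i _ => Finset.sum_eq_zero fun j _ => ?_
      split_ifs with hij
      · rw [(hX x).2 h i (by omega), zero_lie]
      · rfl

/-- The real Lie algebra `𝔤̂^𝒟`: the subalgebra of `𝔤̃^𝒟` of the elements with coefficients in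
the span of the loop algebra and `K`. -/
def hat : LieSubalgebra ℝ P.TakiffSum where
  carrier := {X | X ∈ P.tilde ∧ ∀ x p, (X x p).d = 0}
  zero_mem' := ⟨P.tilde.zero_mem, fun _ _ => rfl⟩
  add_mem' hX hY := ⟨P.tilde.add_mem hX.1 hY.1, fun x p => by
    rw [TakiffSum.add_apply, Affine.add_d, hX.2, hY.2, add_zero]⟩
  smul_mem' r X hX := ⟨P.tilde.smul_mem r hX.1, fun x p => by
    rw [← Complex.coe_smul, TakiffSum.smul_apply, Affine.smul_d, hX.2, mul_zero]⟩
  lie_mem' {X Y} hX hY := ⟨P.tilde.lie_mem hX.1 hY.1, fun x p => by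
    have hd : ∀ Z : Affine G, Z.d = (⟨⟨fun Z => Z.d, rfl⟩, fun _ _ => rfl⟩ : Affine G →+ ℂ) Z :=
      fun _ => rfl
    rw [TakiffSum.lie_apply, hd, map_sum]
    refine Finset.sum_eq_zero fun i _ => ?_
    rw [map_sum]
    refine Finset.sum_eq_zero fun j _ => ?_
    split_ifs <;> rfl⟩

end Poles

section Filtration

variable {L : Type*} [LieRing L] [LieAlgebra ℂ L] {S : Type*} [CommRing S] [Algebra ℂ S]

/-- Continuity of a Poisson bracket for the filtration `A n · S ∩ C n · S` attached to two
filtrations `A` and `C` of a Lie algebra which generates the Poisson algebra `S`. -/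
theorem poissonContinuous_of_lie (P : PoissonBracket S) (j : L →ₗ[ℂ] S)
    (hj : ∀ X Y, P.br (j X) (j Y) = j ⁅X, Y⁆)
    (hgen : ∀ f, f ∈ Algebra.adjoin ℂ (Set.range j)) (A C : ℕ → Set L)
    (hA : Antitone A) (hC : Antitone C)
    (lA : ∀ n, ∀ X ∈ A n, ∀ Y ∈ A n, ⁅X, Y⁆ ∈ A n)
    (lC : ∀ n, ∀ X ∈ C n, ∀ Y ∈ C n, ⁅X, Y⁆ ∈ C n)
    (cA : ∀ (X : L) n, ∃ m, ∀ Y ∈ A m, ⁅X, Y⁆ ∈ A n)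
    (cC : ∀ (X : L) n, ∃ m, ∀ Y ∈ C m, ⁅X, Y⁆ ∈ C n) :
    PoissonContinuous P (spanFil (fun n => j '' A n) fun n => j '' C n) := by
  have st : ∀ A : ℕ → Set L, (∀ n, ∀ X ∈ A n, ∀ Y ∈ A n, ⁅X, Y⁆ ∈ A n) →
      ∀ n, ∀ x ∈ j '' A n, ∀ y ∈ j '' A n, P.br x y ∈ Ideal.span (j '' A n) := by
    rintro A l n _ ⟨X, hX, rfl⟩ _ ⟨Y, hY, rfl⟩
    rw [hj]
    exact Ideal.subset_span ⟨_, l n X hX Y hY, rfl⟩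
  have ct : ∀ A : ℕ → Set L, Antitone A → (∀ (X : L) n, ∃ m, ∀ Y ∈ A m, ⁅X, Y⁆ ∈ A n) →
      ∀ f n, ∃ m, ∀ y ∈ j '' A m, P.br f y ∈ Ideal.span (j '' A n) := by
    intro A hA c f n
    have hf := hgen f
    induction hf using Algebra.adjoin_induction with
    | mem f hf =>
      obtain ⟨X, rfl⟩ := hf
      obtain ⟨m, hm⟩ := c X n
      refine ⟨m, ?_⟩
      rintro _ ⟨Y, hY, rfl⟩
      rw [hj]
      exact Ideal.subset_span ⟨_, hm Y hY, rfl⟩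
    | algebraMap r =>
      refine ⟨0, fun y _ => ?_⟩
      rw [P.br_algebraMap]; exact zero_mem _
    | add f g _ _ hf hg =>
      obtain ⟨m, hm⟩ := hf
      obtain ⟨m', hm'⟩ := hg
      refine ⟨max m m', fun y hy => ?_⟩
      rw [map_add, LinearMap.add_apply]
      exact add_mem (hm y (Set.image_mono (hA (le_max_left _ _)) hy))
        (hm' y (Set.image_mono (hA (le_max_right _ _)) hy))
    | mul f g _ _ hf hg =>
      obtain ⟨m, hm⟩ := hf
      obtain ⟨m', hm'⟩ := hg
      refine ⟨max m m', fun y hy => ?_⟩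
      rw [P.leibniz]
      exact add_mem (Ideal.mul_mem_left _ _ (hm' y (Set.image_mono (hA (le_max_right _ _)) hy)))
        (Ideal.mul_mem_left _ _ (hm y (Set.image_mono (hA (le_max_left _ _)) hy)))
  exact PoissonContinuous.of_generators P _ _ (fun _ _ h => Set.image_mono (hA h))
    (fun _ _ h => Set.image_mono (hC h)) (st A lA) (st C lC) (ct A hA cA) (ct C hC cC)

theorem symmetricAlgebra_mem_adjoin (f : SymmetricAlgebra ℂ L) :
    f ∈ Algebra.adjoin ℂ (Set.range (SymmetricAlgebra.ι ℂ L)) := by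
  induction f using SymmetricAlgebra.induction with
  | algebraMap r => exact Subalgebra.algebraMap_mem _ r
  | ι x => exact Algebra.subset_adjoin ⟨x, rfl⟩
  | mul a b ha hb => exact mul_mem ha hb
  | add a b ha hb => exact add_mem ha hb

end Filtration

variable {T : ℕ} {G : DihedralLie 𝔤 T}

namespace Poles

variable {P : Poles G}

/-- The complexification `A ⊗ ℂ` of a real Lie algebra `A` of tuples of Takiff elements. -/
def Cx (A : LieSubalgebra ℝ P.TakiffSum) : Type _ := ℂ ⊗[ℝ] A

namespace Cx

variable {A : LieSubalgebra ℝ P.TakiffSum}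

instance : LieRing (Cx A) := inferInstanceAs (LieRing (ℂ ⊗[ℝ] A))

instance : LieAlgebra ℂ (Cx A) := inferInstanceAs (LieAlgebra ℂ (ℂ ⊗[ℝ] A))

/-- The pure tensor `a ⊗ u`. -/
def tmul (u : ℂ) (a : A) : Cx A := (u ⊗ₜ[ℝ] a : ℂ ⊗[ℝ] A)

theorem induction {p : Cx A → Prop} (ξ : Cx A) (h0 : p 0) (h : ∀ u a, p (tmul u a))
    (hadd : ∀ ξ η, p ξ → p η → p (ξ + η)) : p ξ :=
  TensorProduct.induction_on (motive := p) ξ h0 h hadd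

theorem tmul_lie (u v : ℂ) (a b : A) : ⁅tmul u a, tmul v b⁆ = tmul (u * v) ⁅a, b⁆ := rfl

/-- The complex conjugation `a ⊗ u ↦ a ⊗ ū`. -/
def conj : Cx A →+ Cx A :=
  (TensorProduct.map (Complex.conjAe.toLinearMap) (LinearMap.id : A →ₗ[ℝ] A) :
    ℂ ⊗[ℝ] A →ₗ[ℝ] ℂ ⊗[ℝ] A).toAddMonoidHom

theorem conj_tmul (u : ℂ) (a : A) : conj (tmul u a) = tmul (starRingEnd ℂ u) a := rfl

/-- The coordinate maps `a ⊗ u ↦ u a` (for `b = false`) and `a ⊗ u ↦ ū a` (for `b = true`) which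
together invert the isomorphism of `A ⊗ ℂ` with a direct sum of complex Takiff algebras. -/
def coord (b : Bool) : Cx A →+ P.TakiffSum :=
  (TensorProduct.lift (LinearMap.mk₂ ℝ (fun (u : ℂ) (a : A) => DihedralLie.conjIf b u • a.1)
    (fun u v a => by rw [map_add, add_smul])
    (fun r u a => by
      cases b <;> simp [DihedralLie.conjIf, mul_smul])
    (fun u a a' => by simp [smul_add])
    (fun r u a => by
      change _ • (r • a.1) = _
      rw [smul_comm])) : ℂ ⊗[ℝ] A →ₗ[ℝ] P.TakiffSum).toAddMonoidHom

theorem coord_tmul (b : Bool) (u : ℂ) (a : A) :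
    coord b (tmul u a) = DihedralLie.conjIf b u • a.1 := rfl

theorem coord_lie (b : Bool) (ξ η : Cx A) : coord b ⁅ξ, η⁆ = ⁅coord b ξ, coord b η⁆ := by
  induction ξ using induction with
  | h0 => simp
  | hadd ξ ξ' h h' => simp only [add_lie, map_add, h, h']
  | h u a =>
    induction η using induction with
    | h0 => simp
    | hadd ξ ξ' h h' => simp only [lie_add, map_add, h, h']
    | h v a' =>
      rw [tmul_lie, coord_tmul, coord_tmul, coord_tmul, map_mul, mul_smul, smul_lie, lie_smul]
      rfl

theorem coord_conj (b : Bool) (ξ : Cx A) : coord b (conj ξ) = coord (!b) ξ := by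
  induction ξ using induction with
  | h0 => simp
  | hadd ξ ξ' h h' => simp only [map_add, h, h']
  | h u a => cases b <;> simp [conj_tmul, coord_tmul, DihedralLie.conjIf]

theorem conj_conj (ξ : Cx A) : conj (conj ξ) = ξ := by
  induction ξ using induction with
  | h0 => simp
  | hadd ξ ξ' h h' => simp only [map_add, h, h']
  | h u a => simp [conj_tmul]

theorem conj_lie (ξ η : Cx A) : conj ⁅ξ, η⁆ = ⁅conj ξ, conj η⁆ := by
  induction ξ using induction with
  | h0 => simp
  | hadd ξ ξ' h h' => simp only [add_lie, map_add, h, h']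
  | h u a =>
    induction η using induction with
    | h0 => simp
    | hadd ξ ξ' h h' => simp only [lie_add, map_add, h, h']
    | h v a' => simp only [tmul_lie, conj_tmul, map_mul]

end Cx
end Poles

/-- The subspace `𝔤 ⊗ tⁿ ℂ[t]` (for `b = false`) or `𝔤 ⊗ t⁻ⁿ ℂ[t⁻¹]` (for `b = true`) of the
affine algebra. -/
def Affine.fil (G : DihedralLie 𝔤 T) (b : Bool) (n : ℕ) : AddSubgroup (Affine G) where
  carrier := {X | X.k = 0 ∧ X.d = 0 ∧ ∀ j : ℤ, (if b then -j else j) < n → loopCoeff X.loop j = 0}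
  zero_mem' := ⟨rfl, rfl, fun j _ => by simp⟩
  add_mem' := by
    rintro X Y ⟨h1, h2, h3⟩ ⟨h1', h2', h3'⟩
    refine ⟨by simp [h1, h1'], by simp [h2, h2'], fun j hj => ?_⟩
    rw [Affine.add_loop, map_add, Finsupp.add_apply, h3 j hj, h3' j hj, add_zero]
  neg_mem' := by
    rintro X ⟨h1, h2, h3⟩
    have e : -X = (-1 : ℂ) • X := by simp
    rw [e]
    refine ⟨by rw [Affine.smul_k, h1, mul_zero], by rw [Affine.smul_d, h2, mul_zero],
      fun j hj => ?_⟩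
    rw [Affine.smul_loop, map_smul, Finsupp.smul_apply, h3 j hj, smul_zero]

theorem Affine.fil_antitone (b : Bool) : Antitone (Affine.fil G b) := fun _ _ h _ hX =>
  ⟨hX.1, hX.2.1, fun j hj => hX.2.2 j (hj.trans_le (Int.ofNat_le.mpr h))⟩

theorem loop_eq_sum (f : Loop 𝔤) :
    f = ∑ j ∈ (loopCoeff f).support, loopMono j (loopCoeff f j) := by
  apply loopCoeff.injective
  rw [map_sum]
  conv_lhs => rw [← Finsupp.sum_single (loopCoeff f)]
  exact Finset.sum_congr rfl fun j _ => (loopCoeff_mono _ _).symm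

/-- The degree of `tʲ` for the filtration: `j` or `-j`. -/
def sgnDeg (b : Bool) (j : ℤ) : ℤ := if b then -j else j

theorem sgnDeg_add (b : Bool) (i j : ℤ) : sgnDeg b (i + j) = sgnDeg b i + sgnDeg b j := by
  cases b <;> simp [sgnDeg]; ring

theorem sgnDeg_zero (b : Bool) {j : ℤ} (h : sgnDeg b j = 0) : j = 0 := by
  cases b <;> simpa [sgnDeg] using h

theorem loop_lie_coeff (b : Bool) (m n N : ℤ) (f g : Loop 𝔤)
    (hf : ∀ j, sgnDeg b j < m → loopCoeff f j = 0) (hg : ∀ j, sgnDeg b j < n → loopCoeff g j = 0)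
    (hN : N ≤ m + n) (j : ℤ) (hj : sgnDeg b j < N) : loopCoeff ⁅f, g⁆ j = 0 := by
  rw [loop_eq_sum f, loop_eq_sum g]
  simp only [sum_lie, lie_sum, map_sum, loopMono_lie,
    loopCoeff_mono, Finsupp.finsetSum_apply]
  refine Finset.sum_eq_zero fun i hi => Finset.sum_eq_zero fun k hk => ?_
  rw [Finsupp.single_apply, if_neg]
  rintro rfl
  have h1 : m ≤ sgnDeg b k := not_lt.mp fun h => (Finsupp.mem_support_iff.mp hk) (hf k h)
  have h2 : n ≤ sgnDeg b i := not_lt.mp fun h => (Finsupp.mem_support_iff.mp hi) (hg i h)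
  rw [sgnDeg_add] at hj
  omega

theorem cocycle_eq_zero (b : Bool) (m n : ℤ) (f g : Loop 𝔤)
    (hf : ∀ j, sgnDeg b j < m → loopCoeff f j = 0) (hg : ∀ j, sgnDeg b j < n → loopCoeff g j = 0)
    (hmn : 0 < m + n ∨ (m = 0 ∧ n = 0)) : G.cocycle f g = 0 := by
  rw [loop_eq_sum f, loop_eq_sum g]
  simp only [map_sum, LinearMap.sum_apply, G.cocycle_mono]
  refine Finset.sum_eq_zero fun i hi => Finset.sum_eq_zero fun k hk => ?_
  split_ifs with h
  · have h1 : m ≤ sgnDeg b k := not_lt.mp fun h => (Finsupp.mem_support_iff.mp hk) (hf k h)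
    have h2 : n ≤ sgnDeg b i := not_lt.mp fun h => (Finsupp.mem_support_iff.mp hi) (hg i h)
    have h3 := sgnDeg_add b k i
    rw [h] at h3
    have h4 : sgnDeg b 0 = 0 := by cases b <;> rfl
    have h5 : k = 0 := sgnDeg_zero b (by omega)
    simp [h5]
  · rfl

theorem loopDeg_coeff (f : Loop 𝔤) (j : ℤ) (h : loopCoeff f j = 0) :
    loopCoeff (loopDeg f) j = 0 := by
  rw [loop_eq_sum f]
  simp only [map_sum, loopDeg_mono, map_smul, loopCoeff_mono, Finsupp.finsetSum_apply,
    Finsupp.smul_apply, Finsupp.single_apply]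
  refine Finset.sum_eq_zero fun i _ => ?_
  split_ifs with hi
  · rw [hi, h, smul_zero]
  · exact smul_zero _

theorem Affine.fil_lie (b : Bool) (n : ℕ) {X Y : Affine G} (hX : X ∈ Affine.fil G b n)
    (hY : Y ∈ Affine.fil G b n) : ⁅X, Y⁆ ∈ Affine.fil G b n := by
  refine ⟨?_, rfl, fun j hj => ?_⟩
  · exact cocycle_eq_zero b n n _ _ hX.2.2 hY.2.2 (by omega)
  · rw [lie_loop, hX.2.1, hY.2.1, zero_smul, zero_smul, add_zero, sub_zero]
    exact loop_lie_coeff b n n n _ _ hX.2.2 hY.2.2 (by omega) j hj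

theorem Affine.fil_ad (b : Bool) (X : Affine G) (n : ℕ) :
    ∃ m, ∀ Y ∈ Affine.fil G b m, ⁅X, Y⁆ ∈ Affine.fil G b n := by
  obtain ⟨N, hN⟩ : ∃ N : ℕ, ∀ j ∈ (loopCoeff X.loop).support, -(N : ℤ) ≤ sgnDeg b j := by
    refine ⟨∑ j ∈ (loopCoeff X.loop).support, (sgnDeg b j).natAbs, fun j hj => ?_⟩
    have := Finset.single_le_sum (f := fun j => (sgnDeg b j).natAbs) (fun _ _ => Nat.zero_le _) hj
    omega
  have hX : ∀ j, sgnDeg b j < -(N : ℤ) → loopCoeff X.loop j = 0 := fun j hj => by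
    by_contra h
    exact absurd (hN j (Finsupp.mem_support_iff.mpr h)) (by omega)
  refine ⟨n + N + 1, fun Y hY => ⟨?_, rfl, fun j hj => ?_⟩⟩
  · exact cocycle_eq_zero b (-N) (n + N + 1 : ℕ) _ _ hX hY.2.2 (by omega)
  · rw [lie_loop, hY.2.1, zero_smul, sub_zero, map_add, map_smul, Finsupp.add_apply,
      Finsupp.smul_apply,
      loop_lie_coeff b (-N) (n + N + 1 : ℕ) n _ _ hX hY.2.2 (by push_cast; omega) j hj,
      loopDeg_coeff _ _ (hY.2.2 j (by push_cast; omega)), smul_zero, add_zero]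

namespace Poles

variable {P : Poles G}

/-- The tuples of Takiff elements with coefficients in the subspaces `Affine.fil`. -/
def TakiffSum.fil (P : Poles G) (b : Bool) (n : ℕ) : Set P.TakiffSum :=
  {X | ∀ x p, X x p ∈ Affine.fil G b n}

theorem TakiffSum.fil_lie (b : Bool) (n : ℕ) {X Y : P.TakiffSum} (hX : X ∈ TakiffSum.fil P b n)
    (hY : Y ∈ TakiffSum.fil P b n) : ⁅X, Y⁆ ∈ TakiffSum.fil P b n := by
  intro x p
  rw [TakiffSum.lie_apply]
  refine sum_mem fun i _ => sum_mem fun j _ => ?_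
  split_ifs
  · exact Affine.fil_lie b n (hX x i) (hY x j)
  · exact zero_mem _

theorem TakiffSum.fil_ad (b : Bool) (X : P.TakiffSum) (n : ℕ) :
    ∃ m, ∀ Y ∈ TakiffSum.fil P b m, ⁅X, Y⁆ ∈ TakiffSum.fil P b n := by
  choose m hm using fun x p => Affine.fil_ad b (X x p) n
  refine ⟨∑ x, ∑ p, m x p, fun Y hY x p => ?_⟩
  rw [TakiffSum.lie_apply]
  refine sum_mem fun i _ => sum_mem fun j _ => ?_
  split_ifs
  · refine hm x i _ (Affine.fil_antitone b ?_ (hY x j))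
    calc m x i ≤ ∑ p, m x p := Finset.single_le_sum (f := fun p => m x p)
          (fun _ _ => Nat.zero_le _) (Finset.mem_univ i)
      _ ≤ _ := Finset.single_le_sum (f := fun x => ∑ p, m x p)
          (fun _ _ => Nat.zero_le _) (Finset.mem_univ x)
  · exact zero_mem _

namespace Cx

/-- The descending filtration of the complexified algebra: in terms of the isomorphism with a
direct sum of complex Takiff algebras `𝒯` (one for each fixed or real point) and `𝒯 ⊕ 𝒯̄` (for each
complex point), the coefficients lie in `𝔤 ⊗ tⁿ ℂ[t]` for the summands `𝒯` and in
`𝔤 ⊗ t⁻ⁿ ℂ[t⁻¹]` for the summands `𝒯̄`. At the fixed and real points, where the second coordinate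
is the image of the first under an anti-linear automorphism reversing the powers of `t`, the second
condition follows from the first. -/
def fil (A : LieSubalgebra ℝ P.TakiffSum) (n : ℕ) : Set (Cx A) :=
  {ξ | coord false ξ ∈ TakiffSum.fil P false n ∧ coord true ξ ∈ TakiffSum.fil P true n}

/-- The conjugate filtration. -/
def conjFil (A : LieSubalgebra ℝ P.TakiffSum) (n : ℕ) : Set (Cx A) := conj '' fil A n

variable {A : LieSubalgebra ℝ P.TakiffSum}

theorem fil_antitone : Antitone (fil A) := fun _ _ h _ hξ =>
  ⟨fun x p => Affine.fil_antitone _ h (hξ.1 x p), fun x p => Affine.fil_antitone _ h (hξ.2 x p)⟩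

theorem fil_lie (n : ℕ) (ξ : Cx A) (hξ : ξ ∈ fil A n) (η : Cx A) (hη : η ∈ fil A n) :
    ⁅ξ, η⁆ ∈ fil A n := by
  refine ⟨?_, ?_⟩
  · rw [coord_lie]; exact TakiffSum.fil_lie _ _ hξ.1 hη.1
  · rw [coord_lie]; exact TakiffSum.fil_lie _ _ hξ.2 hη.2

theorem fil_ad (ξ : Cx A) (n : ℕ) : ∃ m, ∀ η ∈ fil A m, ⁅ξ, η⁆ ∈ fil A n := by
  obtain ⟨m, hm⟩ := TakiffSum.fil_ad false (coord false ξ) n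
  obtain ⟨m', hm'⟩ := TakiffSum.fil_ad true (coord true ξ) n
  refine ⟨max m m', fun η hη => ⟨?_, ?_⟩⟩
  · rw [coord_lie]; exact hm _ (fil_antitone (le_max_left m m') hη).1
  · rw [coord_lie]; exact hm' _ (fil_antitone (le_max_right m m') hη).2

theorem conjFil_antitone : Antitone (conjFil A) := fun _ _ h => Set.image_mono (fil_antitone h)

theorem conjFil_lie (n : ℕ) (ξ : Cx A) (hξ : ξ ∈ conjFil A n) (η : Cx A) (hη : η ∈ conjFil A n) :
    ⁅ξ, η⁆ ∈ conjFil A n := by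
  obtain ⟨ξ, hξ, rfl⟩ := hξ
  obtain ⟨η, hη, rfl⟩ := hη
  exact ⟨_, fil_lie n ξ hξ η hη, conj_lie ξ η⟩

theorem conjFil_ad (ξ : Cx A) (n : ℕ) : ∃ m, ∀ η ∈ conjFil A m, ⁅ξ, η⁆ ∈ conjFil A n := by
  obtain ⟨m, hm⟩ := fil_ad (conj ξ) n
  refine ⟨m, ?_⟩
  rintro _ ⟨η, hη, rfl⟩
  exact ⟨_, hm η hη, by rw [conj_lie, conj_conj]⟩

end Cx
end Poles

namespace Poles

variable {P : Poles G}

open Classical in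
/-- The element `X ⊗ ε ^ p` of the Takiff algebra at the marked point `x`. -/
def single (x : P.pts) (p : ℕ) (X : Affine G) : P.TakiffSum :=
  fun y q => if y = x ∧ (q : ℕ) = p then X else 0

open Classical in
/-- The element `X ⊗ ε ^ p` at `x`, as an element of the real Lie algebra `A`. It is only used when
`X ⊗ ε ^ p` belongs to `A` (otherwise the value is `0`). -/
def ins (A : LieSubalgebra ℝ P.TakiffSum) (x : P.pts) (p : ℕ) (X : Affine G) : A :=
  if h : single x p X ∈ A then ⟨single x p X, h⟩ else 0

/-- The places at which the generators of the complexified Lie algebra sit: a complex marked point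
`x` (trivial stabiliser) or its conjugate `x̄` (for `conj = true`), a non-fixed real marked point
with stabiliser generated by `sᵏ t`, or one of the fixed points `0`, `∞` if it is marked. -/
inductive Place (P : Poles G)
  | cpx (x : P.pts) (h : ∀ k b, G.mobius k b x = x → b = false ∧ T ∣ k) (conj : Bool)
  | real (x : P.pts) (k : ℕ) (hk : k < T) (h0 : (x : OnePoint ℂ) ≠ ((0 : ℂ) : OnePoint ℂ))
      (hi : (x : OnePoint ℂ) ≠ OnePoint.infty) (h : G.mobius k true x = x)
  | fixed (x : P.pts) (h : (x : OnePoint ℂ) = ((0 : ℂ) : OnePoint ℂ) ∨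
      (x : OnePoint ℂ) = OnePoint.infty)

namespace Place

/-- The underlying marked point. -/
def base : Place P → P.pts
  | cpx x _ _ => x
  | real x _ _ _ _ _ => x
  | fixed x _ => x

/-- The point of the Riemann sphere, `x̄` for the conjugate of a complex point `x`. -/
def point : Place P → OnePoint ℂ
  | cpx x _ true => OnePoint.map (starRingEnd ℂ) x
  | s => s.base

/-- The sign `-1` for conjugates of complex points and `1` otherwise. -/
def sign : Place P → ℂ
  | cpx _ _ true => -1
  | _ => 1

/-- The multiplicity. -/
def mult (s : Place P) : ℕ := P.mult s.base

open Classical in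
/-- The exponents of the formal variable: `0, …, n - 1` at finite points and `1, …, n - 1` at
infinity. -/
def exps (s : Place P) : Finset ℕ :=
  if s.point = OnePoint.infty then Finset.Ico 1 s.mult else Finset.range s.mult

open Classical in
/-- The grade in `ℤ / T` of the elements attached to `ε ^ p` at a fixed point. -/
def grade (x : OnePoint ℂ) (p : ℕ) : ZMod T := if x = OnePoint.infty then -p else p

/-- `p` and `X` index a generator: the exponent `p` is in range and, at a fixed point, `X` is in
the eigenspace of `σ` for the grade attached to `p`. -/
def Allowed (s : Place P) (p : ℕ) (X : Affine G) : Prop :=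
  p ∈ s.exps ∧ match s with
    | fixed x _ => G.affσ X = G.ω ^ (grade (T := T) x p).val • X
    | _ => True

end Place

/-- The image of `X` under the anti-linear involution `ω^{-kp} σᵏ τ` at a real point and `τ` at a
fixed point, and zero at a complex point. -/
def twist : Place P → ℕ → Affine G → Affine G
  | .cpx _ _ _, _, _ => 0
  | .real _ k _ _ _ _, p, X => (G.ω⁻¹ ^ k) ^ p • G.act k true X
  | .fixed _ _, _, X => G.affτ X

/-- The generator `X_p^{(x)}` of the complexification of `A`. With `X' = twist s p X` it is
`(½(X + X') ε ^ p) ⊗ 1 - i (½(X - X') ε ^ p) ⊗ i`, with the opposite sign of the second term at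
the conjugate of a complex point. -/
def gen (A : LieSubalgebra ℝ P.TakiffSum) (s : Place P) (p : ℕ) (X : Affine G) : Cx A :=
  Cx.tmul 1 (ins A s.base p ((1 / 2 : ℂ) • (X + twist s p X))) -
    s.sign • Cx.tmul Complex.I (ins A s.base p (Complex.I • (1 / 2 : ℂ) • (X - twist s p X)))

end Poles

namespace DihedralLie

variable (G)

theorem ω_ne_zero : G.ω ≠ 0 := G.ω_prim.ne_zero G.T_pos.ne'

theorem σ_iter (k : ℕ) (x y : 𝔤) : G.σ^[k] (x + y) = G.σ^[k] x + G.σ^[k] y :=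
  iterate_map_add G.σ k x y

theorem σ_τ_σ (x : 𝔤) : G.σ (G.τ (G.σ x)) = G.τ x := by
  set e : ℕ → 𝔤 := fun j => ∑ m ∈ Finset.range T, (G.ω⁻¹ ^ m) ^ j • G.σ^[m] x with he
  have hω := G.ω_ne_zero
  have eig : ∀ j, G.σ (e j) = G.ω ^ j • e j := by
    intro j
    have h1 : G.ω ^ j • e j = ∑ m ∈ Finset.range T, G.ω ^ j • (G.ω⁻¹ ^ m) ^ j • G.σ^[m] x :=
      Finset.smul_sum
    rw [h1, he, map_sum]
    obtain ⟨t, ht⟩ : ∃ t, T = t + 1 := ⟨T - 1, by have := G.T_pos; omega⟩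
    have hT : G.ω ^ (t + 1) = 1 := ht ▸ G.ω_prim.pow_eq_one
    have hσ : G.σ^[t + 1] x = x := ht ▸ G.σ_pow x
    have hr : Finset.range T = Finset.range (t + 1) := by rw [ht]
    rw [hr, Finset.sum_range_succ, Finset.sum_range_succ', add_comm]
    rw [add_comm (∑ k ∈ Finset.range t, _)]
    congr 1
    · rw [map_smul, ← Function.iterate_succ_apply' G.σ, hσ, smul_smul, ← mul_pow]
      have : G.ω⁻¹ ^ t = G.ω := by
        rw [inv_pow, inv_eq_iff_eq_inv]
        exact eq_inv_of_mul_eq_one_left (by rw [← pow_succ, hT])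
      simp [this]
    · refine Finset.sum_congr rfl fun m _ => ?_
      rw [map_smul, ← Function.iterate_succ_apply' G.σ, smul_smul, ← mul_pow, pow_succ,
        mul_comm (G.ω⁻¹ ^ m), ← mul_assoc, mul_inv_cancel₀ hω, one_mul]
  have sum_e : ∑ j ∈ Finset.range T, e j = (T : ℂ) • x := by
    rw [he, Finset.sum_comm, Finset.sum_eq_single 0]
    · simp [← Nat.cast_smul_eq_nsmul ℂ]
    · intro m hm hm0
      rw [← Finset.sum_smul]
      have hne : G.ω⁻¹ ^ m ≠ 1 := by
        rw [inv_pow, Ne, inv_eq_one]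
        exact G.ω_prim.pow_ne_one_of_pos_of_lt hm0 (Finset.mem_range.mp hm)
      rw [geom_sum_eq hne, ← pow_mul, mul_comm, pow_mul, inv_pow, G.ω_prim.pow_eq_one]
      simp
    · intro h; exact absurd (Finset.mem_range.mpr G.T_pos) h
  have key : ∀ j, G.σ (G.τ (G.σ (e j))) = G.τ (e j) := by
    intro j
    have h1 : (starRingEnd ℂ G.ω) * G.ω = 1 := by
      rw [← Complex.inv_eq_conj (G.ω_prim.norm'_eq_one G.T_pos.ne'), inv_mul_cancel₀ hω]
    rw [eig, map_smulₛₗ, map_smul, G.τ_eigen j _ (eig j), smul_smul, map_pow, ← mul_pow, h1,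
      one_pow, one_smul]
  have h2 : G.σ (G.τ (G.σ ((T : ℂ) • x))) = G.τ ((T : ℂ) • x) := by
    rw [← sum_e]
    simp only [map_sum, key]
  have hT : (T : ℂ) ≠ 0 := Nat.cast_ne_zero.mpr G.T_pos.ne'
  rw [map_smul, map_smulₛₗ, map_smul, map_smulₛₗ] at h2
  exact smul_right_injective 𝔤 (by simpa using hT) h2

theorem affσ_τ_σ (X : Affine G) : G.affσ (G.affτ (G.affσ X)) = G.affτ X := by
  ext1
  · change G.loopσ (G.loopτ (G.loopσ X.loop)) = G.loopτ X.loop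
    generalize X.loop = f
    induction f using loop_induction with
    | h0 => simp
    | hadd f g hf hg => simp only [map_add, hf, hg]
    | h n x => rw [loopσ_mono, loopτ_mono, loopσ_mono, loopτ_mono, G.σ_τ_σ]
  · rfl
  · rfl

theorem affτ_τ (X : Affine G) : G.affτ (G.affτ X) = X := by
  ext1
  · change G.loopτ (G.loopτ X.loop) = X.loop
    generalize X.loop = f
    induction f using loop_induction with
    | h0 => simp
    | hadd f g hf hg => simp only [map_add, hf, hg]
    | h n x => rw [loopτ_mono, loopτ_mono, G.τ_τ, neg_neg]
  · change -starRingEnd ℂ (-starRingEnd ℂ X.k) = X.k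
    simp
  · change -starRingEnd ℂ (-starRingEnd ℂ X.d) = X.d
    simp

theorem affσ_pow (X : Affine G) : G.affσ^[T] X = X := by
  have h : ∀ k, G.affσ^[k] X = ⟨G.loopσ^[k] X.loop, X.k, X.d⟩ := by
    intro k
    induction k with
    | zero => rfl
    | succ k ih => rw [Function.iterate_succ_apply', ih, Function.iterate_succ_apply']; rfl
  rw [h]
  ext1
  · change G.loopσ^[T] X.loop = X.loop
    generalize X.loop = f
    induction f using loop_induction with
    | h0 => exact iterate_map_zero G.loopσ T
    | hadd f g hf hg => rw [iterate_map_add G.loopσ, hf, hg]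
    | h n x =>
      have : ∀ k, G.loopσ^[k] (loopMono n x) = loopMono n (G.σ^[k] x) := by
        intro k
        induction k with
        | zero => rfl
        | succ k ih => rw [Function.iterate_succ_apply', ih, Function.iterate_succ_apply', loopσ_mono]
      rw [this, G.σ_pow]
  · rfl
  · rfl

theorem affσ_iterate_mod (k : ℕ) (X : Affine G) : G.affσ^[k] X = G.affσ^[k % T] X := by
  conv_lhs => rw [← Nat.mod_add_div k T, Function.iterate_add_apply, Function.iterate_mul]
  congr 1
  exact Function.iterate_fixed (G.affσ_pow X) _

theorem affσ_iter_τ_σ (k : ℕ) (X : Affine G) :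
    G.affσ^[k] (G.affτ (G.affσ^[k] X)) = G.affτ X := by
  induction k generalizing X with
  | zero => rfl
  | succ k ih => rw [Function.iterate_succ_apply' G.affσ k X, Function.iterate_succ_apply,
      affσ_τ_σ, ih]

theorem act_act (k : ℕ) (X : Affine G) : G.act k true (G.act k true X) = X := by
  change G.affσ^[k] (G.affτ (G.affσ^[k] (G.affτ X))) = X
  rw [affσ_iter_τ_σ, affτ_τ]

end DihedralLie

namespace Poles

variable {P : Poles G}

theorem single_mem_tilde (x : P.pts) (p : ℕ) (X : Affine G)
    (h1 : (x : OnePoint ℂ) ≠ OnePoint.infty → ∀ k b, G.mobius k b x = x →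
      (G.ω⁻¹ ^ k) ^ p • G.act k b X = X)
    (h2 : (x : OnePoint ℂ) = OnePoint.infty → p ≠ 0 ∧ ∀ k b, (G.ω ^ k) ^ p • G.act k b X = X) :
    single x p X ∈ P.tilde := by
  intro y
  refine ⟨fun k b hk => funext fun q => ?_, fun hy q hq => ?_⟩
  · unfold takiffAct single
    by_cases hyx : y = x ∧ (q : ℕ) = p
    · rw [if_pos hyx, hyx.2]
      obtain ⟨rfl, -⟩ := hyx
      by_cases hy : (y : OnePoint ℂ) = OnePoint.infty
      · rw [if_pos hy]; exact (h2 hy).2 k b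
      · rw [if_neg hy]; exact h1 hy k b hk
    · rw [if_neg hyx, G.act_zero, smul_zero]
  · unfold single
    refine if_neg ?_
    rintro ⟨rfl, h⟩
    exact (h2 hy).1 (h ▸ hq)

theorem mobius_coe (k : ℕ) (b : Bool) (w : ℂ) :
    G.mobius k b (w : OnePoint ℂ) = ((G.ω ^ k * DihedralLie.conjIf b w : ℂ) : OnePoint ℂ) := rfl

theorem act_false_of_dvd (k : ℕ) (h : T ∣ k) (X : Affine G) : G.act k false X = X := by
  change G.affσ^[k] X = X
  rw [G.affσ_iterate_mod, Nat.mod_eq_zero_of_dvd h]; rfl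

theorem norm_pow_inv (G : DihedralLie 𝔤 T) (k p : ℕ) :
    (G.ω⁻¹ ^ k) ^ p * starRingEnd ℂ ((G.ω⁻¹ ^ k) ^ p) = 1 := by
  have h1 : G.ω⁻¹ * starRingEnd ℂ G.ω⁻¹ = 1 := by
    rw [map_inv₀, ← Complex.inv_eq_conj (G.ω_prim.norm'_eq_one G.T_pos.ne'), inv_inv,
      inv_mul_cancel₀ G.ω_ne_zero]
  rw [map_pow, map_pow, ← mul_pow, ← mul_pow, h1, one_pow, one_pow]

theorem affine_sub_smul (X Y : Affine G) :
    Complex.I • (1 / 2 : ℂ) • (X - Y) = (Complex.I * (1 / 2)) • X + (-(Complex.I * (1 / 2))) • Y := by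
  rw [smul_sub, smul_sub, smul_smul, smul_smul, neg_smul, sub_eq_add_neg]

theorem single_mem_tilde_fixed (x : P.pts) (hx) (p g : ℕ) (Z : Affine G)
    (hp : p ∈ (Place.fixed x hx).exps) (hg : g = (Place.grade (T := T) x p).val)
    (hZ : G.affτ Z = Z) (hZσ : G.affσ Z = G.ω ^ g • Z) : single x p Z ∈ P.tilde := by
  have : NeZero T := ⟨G.T_pos.ne'⟩
  have hgf : (x : OnePoint ℂ) ≠ OnePoint.infty → g = p % T := fun hi => by
    rw [hg]; unfold Place.grade; rw [if_neg hi, ZMod.val_natCast]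
  have hgi : (x : OnePoint ℂ) = OnePoint.infty → T ∣ p + g := fun hi => by
    rw [← ZMod.natCast_eq_zero_iff, Nat.cast_add, hg, ZMod.natCast_zmod_val]
    unfold Place.grade
    rw [if_pos hi, add_neg_cancel]
  have hact : ∀ k b, G.act k b Z = (G.ω ^ k) ^ g • Z := by
    intro k b
    have h1 : G.act k b Z = G.affσ^[k] Z := by
      cases b
      · rfl
      · change G.affσ^[k] (G.affτ Z) = _
        rw [hZ]
    rw [h1]
    clear h1
    induction k with
    | zero => simp
    | succ k ih =>
      rw [Function.iterate_succ_apply', ih, G.affσ_smul, hZσ, smul_smul, ← pow_mul, ← pow_mul,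
        ← pow_add]
      congr 2; ring
  refine single_mem_tilde x p Z (fun hi k b _ => ?_) fun hi => ⟨?_, fun k b => ?_⟩
  · have h1 : G.ω ^ p = G.ω ^ g := by
      rw [hgf hi]
      exact pow_eq_pow_mod p G.ω_prim.pow_eq_one
    rw [hact, smul_smul, ← pow_mul G.ω k g, mul_comm k g, pow_mul G.ω g, ← h1, ← pow_mul,
      mul_comm k p, pow_mul, ← mul_pow, ← mul_pow, inv_mul_cancel₀ G.ω_ne_zero, one_pow, one_pow,
      one_smul]
  · unfold Place.exps at hp
    rw [if_pos (show (Place.fixed x hx).point = OnePoint.infty from hi), Finset.mem_Ico] at hp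
    omega
  · have h1 : G.ω ^ (p + g) = 1 := (G.ω_prim.pow_eq_one_iff_dvd _).mpr (hgi hi)
    rw [hact, smul_smul, ← pow_add, ← pow_mul, mul_comm, pow_mul, h1, one_pow, one_smul]

/-- The elements used in the definition of the generators belong to the Lie algebra. -/
theorem gen_mem_tilde (s : Place P) (p : ℕ) (X : Affine G) (h : Place.Allowed s p X) :
    single s.base p ((1 / 2 : ℂ) • (X + twist s p X)) ∈ P.tilde ∧
      single s.base p (Complex.I • (1 / 2 : ℂ) • (X - twist s p X)) ∈ P.tilde := by
  match s with
  | .cpx x hx c =>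
    have hxi : (x : OnePoint ℂ) ≠ OnePoint.infty := by
      intro h
      have := (hx 0 true (by rw [h]; rfl)).1
      exact absurd this (by decide)
    have key : ∀ Z, single x p Z ∈ P.tilde := fun Z => by
      refine single_mem_tilde x p Z (fun _ k b hk => ?_) fun h => absurd h hxi
      obtain ⟨rfl, hd⟩ := hx k b hk
      rw [act_false_of_dvd k hd, inv_pow, (G.ω_prim.pow_eq_one_iff_dvd k).mpr hd, inv_one, one_pow,
        one_smul]
    exact ⟨key _, key _⟩
  | .real x k hk h0 hi hx =>
    have key : ∀ Z, (G.ω⁻¹ ^ k) ^ p • G.act k true Z = Z → single x p Z ∈ P.tilde := fun Z hZ => by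
      refine single_mem_tilde x p Z (fun _ k' b hk' => ?_) fun h => absurd h hi
      obtain ⟨w, hw⟩ : ∃ w : ℂ, (w : OnePoint ℂ) = x := OnePoint.ne_infty_iff_exists.mp hi
      have hw0 : w ≠ 0 := fun h => h0 (by rw [← hw, h])
      rw [← hw, mobius_coe, OnePoint.coe_eq_coe] at hk' hx
      cases b
      · change G.ω ^ k' * w = w at hk'
        have h1 : G.ω ^ k' = 1 := mul_right_cancel₀ hw0 (hk'.trans (one_mul w).symm)
        rw [act_false_of_dvd k' ((G.ω_prim.pow_eq_one_iff_dvd k').mp h1), inv_pow, h1, inv_one,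
          one_pow, one_smul]
      · change G.ω ^ k' * starRingEnd ℂ w = w at hk'
        change G.ω ^ k * starRingEnd ℂ w = w at hx
        have h1 : G.ω ^ k' = G.ω ^ k := mul_right_cancel₀
          ((map_ne_zero (starRingEnd ℂ)).mpr hw0) (hk'.trans hx.symm)
        have h2 : k' % T = k := by
          refine G.ω_prim.pow_inj (Nat.mod_lt _ G.T_pos) hk ?_
          rw [← h1]
          exact (pow_eq_pow_mod k' G.ω_prim.pow_eq_one).symm
        have h3 : G.act k' true Z = G.act k true Z := by
          change G.affσ^[k'] _ = G.affσ^[k] _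
          rw [G.affσ_iterate_mod k', h2]
        rw [inv_pow, h1, ← inv_pow, h3, hZ]
    have hact : (G.ω⁻¹ ^ k) ^ p • G.act k true ((G.ω⁻¹ ^ k) ^ p • G.act k true X) = X := by
      rw [G.act_smul, smul_smul, G.act_act]
      exact (congrArg (· • X) (norm_pow_inv G k p)).trans (one_smul _ _)
    refine ⟨key _ ?_, key _ ?_⟩
    · change _ • G.act k true ((1 / 2 : ℂ) • (X + _ • G.act k true X)) = _
      rw [G.act_smul, G.act_add, smul_comm, smul_add, hact]
      have : DihedralLie.conjIf true (1 / 2 : ℂ) = 1 / 2 := by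
        simp [DihedralLie.conjIf, Complex.conj_ofNat]
      rw [this, add_comm]; rfl
    · change _ • G.act k true (Complex.I • (1 / 2 : ℂ) • (X - _ • G.act k true X)) = _
      rw [affine_sub_smul, G.act_add, G.act_smul, G.act_smul, smul_add, smul_comm, smul_comm
        ((G.ω⁻¹ ^ k) ^ p), hact]
      have e1 : DihedralLie.conjIf true (Complex.I * (1 / 2)) = -(Complex.I * (1 / 2)) := by
        simp [DihedralLie.conjIf, Complex.conj_ofNat]
      have e2 : DihedralLie.conjIf true (-(Complex.I * (1 / 2))) = Complex.I * (1 / 2) := by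
        simp [DihedralLie.conjIf, Complex.conj_ofNat]
      rw [e1, e2, add_comm, ← affine_sub_smul]; rfl
  | .fixed x hx =>
    obtain ⟨hp, hX⟩ := h
    change G.affσ X = G.ω ^ (Place.grade (T := T) x p).val • X at hX
    set g := (Place.grade (T := T) (x : OnePoint ℂ) p).val with hg
    have hτ : G.affσ (G.affτ X) = G.ω ^ g • G.affτ X := by
      have h1 := G.affσ_τ_σ X
      rw [hX, G.affτ_smul, G.affσ_smul] at h1
      have : G.ω ^ g * starRingEnd ℂ (G.ω ^ g) = 1 := by
        rw [map_pow, ← mul_pow, ← Complex.inv_eq_conj (G.ω_prim.norm'_eq_one G.T_pos.ne'),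
          mul_inv_cancel₀ G.ω_ne_zero, one_pow]
      conv_rhs => rw [← h1, smul_smul, this, one_smul]
    have key : ∀ Z, G.affτ Z = Z → G.affσ Z = G.ω ^ g • Z → single x p Z ∈ P.tilde :=
      fun Z h1 h2 => single_mem_tilde_fixed x hx p g Z hp hg h1 h2
    refine ⟨key _ ?_ ?_, key _ ?_ ?_⟩
    · change G.affτ ((1 / 2 : ℂ) • (X + G.affτ X)) = (1 / 2 : ℂ) • (X + G.affτ X)
      rw [G.affτ_smul, map_add, G.affτ_τ, add_comm]; simp [Complex.conj_ofNat]
    · change G.affσ ((1 / 2 : ℂ) • (X + G.affτ X)) = _ • (1 / 2 : ℂ) • (X + G.affτ X)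
      rw [G.affσ_smul, map_add, hX, hτ, ← smul_add, smul_comm]
    · change G.affτ (Complex.I • (1 / 2 : ℂ) • (X - G.affτ X)) =
        Complex.I • (1 / 2 : ℂ) • (X - G.affτ X)
      rw [affine_sub_smul, map_add, G.affτ_smul, G.affτ_smul, G.affτ_τ, add_comm]
      simp [Complex.conj_ofNat]
    · change G.affσ (Complex.I • (1 / 2 : ℂ) • (X - G.affτ X)) =
        _ • Complex.I • (1 / 2 : ℂ) • (X - G.affτ X)
      rw [G.affσ_smul, G.affσ_smul, map_sub, hX, hτ, ← smul_sub, smul_comm (1 / 2 : ℂ),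
        smul_comm Complex.I]

theorem twist_d (s : Place P) (p : ℕ) (X : Affine G) (hX : X.d = 0) : (twist s p X).d = 0 := by
  have hσ : ∀ k (Y : Affine G), Y.d = 0 → (G.affσ^[k] Y).d = 0 := by
    intro k
    induction k with
    | zero => exact fun Y h => h
    | succ k ih => exact fun Y h => by rw [Function.iterate_succ_apply']; exact ih Y h
  have hτ : (G.affτ X).d = 0 := by
    change -starRingEnd ℂ X.d = 0
    rw [hX, map_zero, neg_zero]
  match s with
  | .cpx _ _ _ => rfl
  | .real x k _ _ _ _ =>
    change _ * (G.affσ^[k] (G.affτ X)).d = 0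
    rw [hσ k _ hτ, mul_zero]
  | .fixed _ _ => exact hτ

theorem gen_mem_hat (s : Place P) (p : ℕ) (X : Affine G) (h : Place.Allowed s p X)
    (hX : X.d = 0) : single s.base p ((1 / 2 : ℂ) • (X + twist s p X)) ∈ P.hat ∧
      single s.base p (Complex.I • (1 / 2 : ℂ) • (X - twist s p X)) ∈ P.hat := by
  have key : ∀ Z : Affine G, Z.d = 0 → single s.base p Z ∈ P.tilde → single s.base p Z ∈ P.hat :=
    fun Z hZ h => ⟨h, fun x q => by
      unfold single
      split_ifs
      · exact hZ
      · rfl⟩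
  have ht := twist_d s p X hX
  refine ⟨key _ ?_ (gen_mem_tilde s p X h).1, key _ ?_ (gen_mem_tilde s p X h).2⟩
  · simp [hX, ht]
  · rw [affine_sub_smul]
    rw [Affine.add_d, Affine.smul_d, Affine.smul_d, hX, ht, mul_zero, mul_zero, add_zero]

theorem coord_gen {A : LieSubalgebra ℝ P.TakiffSum} (s : Place P) (p : ℕ) (X : Affine G)
    (h1 : single s.base p ((1 / 2 : ℂ) • (X + twist s p X)) ∈ A)
    (h2 : single s.base p (Complex.I • (1 / 2 : ℂ) • (X - twist s p X)) ∈ A) (b : Bool) :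
    Cx.coord b (gen A s p X) = single s.base p ((1 / 2 : ℂ) • (X + twist s p X) +
      ((if b then -1 else 1) * s.sign) • (1 / 2 : ℂ) • (X - twist s p X)) := by
  have hs : starRingEnd ℂ s.sign = s.sign := by
    match s with
    | .cpx _ _ true => simp [Place.sign]
    | .cpx _ _ false => simp [Place.sign]
    | .real _ _ _ _ _ _ => simp [Place.sign]
    | .fixed _ _ => simp [Place.sign]
  have e : gen A s p X = Cx.tmul 1 ⟨_, h1⟩ - Cx.tmul (s.sign * Complex.I) ⟨_, h2⟩ := by
    unfold gen ins
    rw [dif_pos h1, dif_pos h2]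
    rfl
  rw [e, map_sub, Cx.coord_tmul, Cx.coord_tmul]
  refine TakiffSum.ext fun x q => ?_
  rw [sub_eq_add_neg, ← neg_smul, TakiffSum.add_apply, TakiffSum.smul_apply, TakiffSum.smul_apply]
  unfold single
  dsimp only
  split_ifs with hx hb
  · subst hb
    rw [map_one, one_smul, smul_smul _ Complex.I]
    congr 2
    simp only [DihedralLie.conjIf, if_true, map_mul, hs, Complex.conj_I]
    linear_combination s.sign * Complex.I_mul_I
  · simp only [Bool.not_eq_true] at hb
    subst hb
    rw [map_one, one_smul, smul_smul _ Complex.I]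
    congr 2
    change -(s.sign * Complex.I) * Complex.I = _
    linear_combination -s.sign * Complex.I_mul_I
  · simp

/-- The generators are the images of the elements `X ⊗ ε ^ p` under the isomorphism with a direct
sum of complex Takiff algebras. -/
theorem coord_false_gen (s : Place P) (p : ℕ) (X : Affine G) (h : Place.Allowed s p X)
    (hs : s.sign = 1) : Cx.coord false (gen P.tilde s p X) = single s.base p X := by
  rw [coord_gen s p X (gen_mem_tilde s p X h).1 (gen_mem_tilde s p X h).2, hs]
  congr 1
  simp only [Bool.false_eq_true, if_false, mul_one, one_smul, ← smul_add]
  rw [add_add_sub_cancel, ← two_smul ℂ X, smul_smul]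
  norm_num

end Poles

namespace Poles

variable {P : Poles G}

/-- Elements of the affine algebra proportional to `K`. -/
def IsMultK (X : Affine G) : Prop := X.loop = 0 ∧ X.d = 0

theorem Cx.lie_tmul_of_multK {A : LieSubalgebra ℝ P.TakiffSum} (u : ℂ) (a : A)
    (ha : ∀ x p, IsMultK (a.1 x p)) (ξ : Cx A) : ⁅ξ, Cx.tmul u a⁆ = 0 := by
  induction ξ using Cx.induction with
  | h0 => exact zero_lie _
  | hadd ξ η h h' => rw [add_lie, h, h', add_zero]
  | h v b =>
    have e : ⁅b, a⁆ = 0 := by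
      apply Subtype.ext
      refine TakiffSum.ext fun x p => ?_
      change ⁅b.1, a.1⁆ x p = 0
      rw [TakiffSum.lie_apply]
      refine Finset.sum_eq_zero fun i _ => Finset.sum_eq_zero fun j _ => ?_
      split_ifs
      · obtain ⟨h1, h2⟩ := ha x j
        ext1
        · rw [Affine.lie_loop, h1, h2]; simp
        · rw [Affine.lie_k, h1, map_zero]; rfl
        · rfl
      · rfl
    rw [Cx.tmul_lie, e]
    exact TensorProduct.tmul_zero A _

theorem multK_ins {A : LieSubalgebra ℝ P.TakiffSum} (x : P.pts) (p : ℕ) {X : Affine G}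
    (hX : IsMultK X) (y : P.pts) (q : Fin (P.mult y)) : IsMultK ((ins A x p X).1 y q) := by
  unfold ins
  split_ifs
  · unfold single
    dsimp only
    split_ifs
    · exact hX
    · exact ⟨rfl, rfl⟩
  · exact ⟨rfl, rfl⟩

theorem IsMultK.smul {X : Affine G} (c : ℂ) (hX : IsMultK X) : IsMultK (c • X) :=
  ⟨by rw [Affine.smul_loop, hX.1, smul_zero], by rw [Affine.smul_d, hX.2, mul_zero]⟩

theorem IsMultK.add {X Y : Affine G} (hX : IsMultK X) (hY : IsMultK Y) : IsMultK (X + Y) :=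
  ⟨by rw [Affine.add_loop, hX.1, hY.1, add_zero], by rw [Affine.add_d, hX.2, hY.2, add_zero]⟩

theorem IsMultK.sub {X Y : Affine G} (hX : IsMultK X) (hY : IsMultK Y) : IsMultK (X - Y) := by
  have : X - Y = X + (-1 : ℂ) • Y := by simp [sub_eq_add_neg]
  rw [this]; exact hX.add (hY.smul _)

theorem isMultK_K : IsMultK (Affine.K : Affine G) := ⟨rfl, rfl⟩

theorem IsMultK.affτ {X : Affine G} (hX : IsMultK X) : IsMultK (G.affτ X) :=
  ⟨by change G.loopτ X.loop = 0; rw [hX.1, map_zero],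
    by change -starRingEnd ℂ X.d = 0; rw [hX.2, map_zero, neg_zero]⟩

theorem IsMultK.act {X : Affine G} (hX : IsMultK X) (k : ℕ) : IsMultK (G.act k true X) := by
  unfold DihedralLie.act
  simp only [if_true]
  generalize hY : G.affτ X = Y
  have h : IsMultK Y := hY ▸ hX.affτ
  clear hY
  induction k generalizing Y with
  | zero => exact h
  | succ k ih =>
    rw [Function.iterate_succ_apply]
    refine ih _ ⟨?_, h.2⟩
    change G.loopσ Y.loop = 0
    rw [h.1, map_zero]

theorem isMultK_twist (s : Place P) (p : ℕ) : IsMultK (twist s p Affine.K) := by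
  match s with
  | .cpx _ _ _ => exact ⟨rfl, rfl⟩
  | .real x k _ _ _ _ => exact (isMultK_K.act k).smul _
  | .fixed x _ => exact isMultK_K.affτ

theorem lie_gen_K {A : LieSubalgebra ℝ P.TakiffSum} (s : Place P) (p : ℕ) (ξ : Cx A) :
    ⁅ξ, gen A s p Affine.K⁆ = 0 := by
  unfold gen
  rw [lie_sub, lie_smul,
    Cx.lie_tmul_of_multK _ _ fun y q => multK_ins _ p ((isMultK_K.add (isMultK_twist s p)).smul _) y q,
    Cx.lie_tmul_of_multK _ _ fun y q =>
      multK_ins _ p (((isMultK_K.sub (isMultK_twist s p)).smul _).smul _) y q, smul_zero, sub_zero]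

variable (P)

/-- The conditions on the levels `ℓ x p`: they vanish for `p ≥ n_x`, at the fixed points they
vanish unless `T ∣ p`, the last level `ℓ x (n_x - 1)` is nonzero, and they satisfy the reality
conditions. There is no level `ℓ ∞ 0`; it is set to zero by convention. In particular, there are
no levels at infinity if `n_∞ = 1`. -/
structure IsLevels (ℓ : OnePoint ℂ → ℕ → ℂ) : Prop where
  vanish : ∀ s : Place P, ∀ p, s.mult ≤ p → ℓ s.point p = 0
  infty_zero : ℓ OnePoint.infty 0 = 0
  fixed_vanish : ∀ x h p, ¬ T ∣ p → ℓ (Place.fixed (P := P) x h).point p = 0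
  nonzero : ∀ s : Place P, (s.point = OnePoint.infty → 2 ≤ s.mult) → ℓ s.point (s.mult - 1) ≠ 0
  conj_cpx : ∀ x h p, starRingEnd ℂ (ℓ (Place.cpx (P := P) x h false).point p) =
    ℓ (Place.cpx (P := P) x h true).point p
  conj_real : ∀ x k hk h0 hi h p, starRingEnd ℂ (ℓ (Place.real (P := P) x k hk h0 hi h).point p) =
    (G.ω⁻¹ ^ k) ^ p * ℓ (Place.real (P := P) x k hk h0 hi h).point p
  conj_fixed : ∀ x h p, starRingEnd ℂ (ℓ (Place.fixed (P := P) x h).point p) =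
    ℓ (Place.fixed (P := P) x h).point p

/-- The ideal of `S(𝔤̂)` generated by the elements `K_p^{(x)} ∓ i ℓ_p^x`, with the sign `-`
except at conjugates of complex points. -/
def levelIdeal (ℓ : OnePoint ℂ → ℕ → ℂ) : Ideal (SymmetricAlgebra ℂ (Cx P.hat)) :=
  Ideal.span {f | ∃ s p, Place.Allowed s p Affine.K ∧
    f = SymmetricAlgebra.ι ℂ _ (gen P.hat s p Affine.K) -
      algebraMap ℂ _ (s.sign * (Complex.I * ℓ s.point p))}

theorem levelIdeal_poisson (ℓ : OnePoint ℂ → ℕ → ℂ) : ∀ f, ∀ g ∈ P.levelIdeal ℓ,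
    (symPoisson (Cx P.hat)).br f g ∈ P.levelIdeal ℓ := by
  intro f g hg
  induction hg using Submodule.span_induction with
  | zero => rw [map_zero]; exact zero_mem _
  | add a b _ _ ha hb => rw [map_add]; exact add_mem ha hb
  | smul a b hb hb' =>
    rw [smul_eq_mul, PoissonBracket.leibniz_right]
    exact add_mem (Ideal.mul_mem_left _ _ hb') (Ideal.mul_mem_right _ _ hb)
  | mem x hx =>
    obtain ⟨s, p, _, rfl⟩ := hx
    have key : (symPoisson (Cx P.hat)).br f (SymmetricAlgebra.ι ℂ _ (gen P.hat s p Affine.K)) = 0 := by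
      induction f using SymmetricAlgebra.induction with
      | algebraMap r => exact PoissonBracket.br_algebraMap _ _ _
      | ι ξ => exact (symBr_ι_ι _ _).trans (by rw [lie_gen_K, map_zero])
      | mul a b ha hb => rw [PoissonBracket.leibniz, ha, hb, mul_zero, mul_zero, add_zero]
      | add a b ha hb => rw [map_add, LinearMap.add_apply, ha, hb, add_zero]
    rw [map_sub, key, PoissonBracket.skew, PoissonBracket.br_algebraMap, neg_zero, sub_zero]
    exact zero_mem _

/-- The filtration `F_n(𝔤̃) S(𝔤̃) ∩ c(F_n(𝔤̃)) S(𝔤̃)` of `S(𝔤̃)`. -/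
def filTilde : ℕ → Ideal (SymmetricAlgebra ℂ (Cx P.tilde)) :=
  spanFil (fun n => SymmetricAlgebra.ι ℂ (Cx P.tilde) '' Cx.fil P.tilde n)
    fun n => SymmetricAlgebra.ι ℂ (Cx P.tilde) '' Cx.conjFil P.tilde n

theorem filTilde_antitone : Antitone P.filTilde :=
  spanFil_antitone (fun _ _ h => Set.image_mono (Cx.fil_antitone h))
    fun _ _ h => Set.image_mono (Cx.conjFil_antitone h)

theorem filTilde_continuous : PoissonContinuous (symPoisson (Cx P.tilde)) P.filTilde :=
  poissonContinuous_of_lie _ (SymmetricAlgebra.ι ℂ (Cx P.tilde)) symBr_ι_ι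
    symmetricAlgebra_mem_adjoin _ _ Cx.fil_antitone Cx.conjFil_antitone Cx.fil_lie Cx.conjFil_lie
    Cx.fil_ad Cx.conjFil_ad

/-- The complexified algebra of formal observables: the completion of `S(𝔤̃)`. -/
abbrev FormalObs : Type _ := completion P.filTilde P.filTilde_antitone

/-- The Poisson bracket of the complexified algebra of formal observables. -/
def formalPoisson : PoissonBracket P.FormalObs :=
  P.filTilde_continuous.completion P.filTilde_antitone

variable (ℓ : OnePoint ℂ → ℕ → ℂ)

/-- The quotient of `S(𝔤̂)` which fixes the levels. -/
def LevelSym : Type _ := SymmetricAlgebra ℂ (Cx P.hat) ⧸ P.levelIdeal ℓ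

instance : CommRing (P.LevelSym ℓ) :=
  inferInstanceAs (CommRing (SymmetricAlgebra ℂ (Cx P.hat) ⧸ P.levelIdeal ℓ))

instance : Algebra ℂ (P.LevelSym ℓ) :=
  inferInstanceAs (Algebra ℂ (SymmetricAlgebra ℂ (Cx P.hat) ⧸ P.levelIdeal ℓ))

/-- The map from `𝔤̂` to the quotient of `S(𝔤̂)`. -/
def levelι : Cx P.hat →ₗ[ℂ] P.LevelSym ℓ :=
  (Ideal.Quotient.mkₐ ℂ (P.levelIdeal ℓ)).toLinearMap ∘ₗ SymmetricAlgebra.ι ℂ (Cx P.hat)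

/-- The Poisson bracket on the quotient of `S(𝔤̂)`. -/
def levelPoisson : PoissonBracket (P.LevelSym ℓ) :=
  (symPoisson (Cx P.hat)).quotient (P.levelIdeal ℓ) (P.levelIdeal_poisson ℓ)

/-- The filtration of the quotient of `S(𝔤̂)` by the ideals generated by the images of the
filtration of `𝔤̂` and of its conjugate. -/
def filHat : ℕ → Ideal (P.LevelSym ℓ) :=
  spanFil (fun n => P.levelι ℓ '' Cx.fil P.hat n) fun n => P.levelι ℓ '' Cx.conjFil P.hat n

theorem filHat_antitone : Antitone (P.filHat ℓ) :=
  spanFil_antitone (fun _ _ h => Set.image_mono (Cx.fil_antitone h))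
    fun _ _ h => Set.image_mono (Cx.conjFil_antitone h)

theorem filHat_continuous : PoissonContinuous (P.levelPoisson ℓ) (P.filHat ℓ) :=
  poissonContinuous_of_lie _ (P.levelι ℓ)
    (fun X Y => (PoissonBracket.quotient_mk _ _ _ _ _).trans
      (congrArg (Ideal.Quotient.mk (P.levelIdeal ℓ)) (symBr_ι_ι X Y)))
    (fun f => by
      obtain ⟨f, rfl⟩ := Ideal.Quotient.mk_surjective f
      have h := Subalgebra.mem_map.mpr
        ⟨f, symmetricAlgebra_mem_adjoin f, (rfl : Ideal.Quotient.mkₐ ℂ (P.levelIdeal ℓ) f = _)⟩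
      rw [AlgHom.map_adjoin, ← Set.range_comp] at h
      exact h)
    _ _ Cx.fil_antitone Cx.conjFil_antitone Cx.fil_lie Cx.conjFil_lie Cx.fil_ad Cx.conjFil_ad

/-- The complexified algebra of local observables at the levels `ℓ`: the completion of the
quotient of `S(𝔤̂)`. -/
abbrev LocalObs : Type _ := completion (P.filHat ℓ) (P.filHat_antitone ℓ)

/-- The Poisson bracket of the complexified algebra of local observables. -/
def localPoisson : PoissonBracket (P.LocalObs ℓ) :=
  (P.filHat_continuous ℓ).completion (P.filHat_antitone ℓ)

end Poles

/-- The number `κ_p(ℓ_0, …, ℓ_{n-1})`: the sum over the compositions `c` of `p - n + 1` of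
`(-1)^{|c|} ∏_j ℓ_{n-1-c_j} / ℓ_{n-1}^{|c|+1}`. -/
def kappa (n : ℕ) (ℓ : ℕ → ℂ) (p : ℕ) : ℂ :=
  if p + 1 < n then 0
  else ∑ c : Composition (p + 1 - n),
    (-1) ^ c.length * (c.blocks.map fun j => ℓ (n - 1 - j)).prod / ℓ (n - 1) ^ (c.length + 1)

/-- The number `κ_{p+q-r}`, which is zero if `p + q < r`. -/
def kappaShift (n : ℕ) (ℓ : ℕ → ℂ) (p q r : ℕ) : ℂ :=
  if p + q < r then 0 else kappa n ℓ (p + q - r)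

/-- Pairs of dual bases: `I`, `I'` of `𝔤`, and `E j`, `E' j` of the eigenspaces of `σ` for the
grades `j` and `-j`. -/
structure DualBases (G : DihedralLie 𝔤 T) where
  d : ℕ
  I : Module.Basis (Fin d) ℂ 𝔤
  I' : Fin d → 𝔤
  dual : ∀ a b, G.form (I a) (I' b) = if a = b then 1 else 0
  m : ZMod T → ℕ
  E : ∀ j, Module.Basis (Fin (m j)) ℂ
    (Module.End.eigenspace (G.σ.toLinearEquiv : 𝔤 →ₗ[ℂ] 𝔤) (G.ω ^ j.val))
  E' : ∀ j, Fin (m j) → Module.End.eigenspace (G.σ.toLinearEquiv : 𝔤 →ₗ[ℂ] 𝔤) (G.ω ^ (-j).val)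
  dualE : ∀ j α β, G.form (E j α) (E' j β) = if α = β then 1 else 0

namespace Poles

variable (P : Poles G) (B : DualBases G) (ℓ : OnePoint ℂ → ℕ → ℂ)

/-- The element `∑_a I_{a,-n,p} I^a_{n,q}` of the quotient of `S(𝔤̂)`, where at a fixed point the
sum is over dual bases of the eigenspaces of `σ` attached to `p` and `q`. -/
def quad : Place P → ℕ → ℕ → ℤ → P.LevelSym ℓ
  | .fixed x h, p, q, n =>
    if T ∣ p + q then
      ∑ α, P.levelι ℓ (gen P.hat (.fixed x h) p (Affine.mono (-n) (B.E' (Place.grade x q) α))) *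
        P.levelι ℓ (gen P.hat (.fixed x h) q (Affine.mono n (B.E (Place.grade x q) α)))
    else 0
  | s, p, q, n =>
    ∑ a, P.levelι ℓ (gen P.hat s p (Affine.mono (-n) (B.I' a))) *
      P.levelι ℓ (gen P.hat s q (Affine.mono n (B.I a)))

/-- The partial sum over `|n| < k` of the generalised Segal-Sugawara element
`± (i/2) ∑_{p,q} ∑_n κ_{p+q-r} I_{a,-n,p} I^a_{n,q}`, with the sign `-` at conjugates of complex
points. -/
def sugawara (s : Place P) (r k : ℕ) : P.LevelSym ℓ :=
  (s.sign * (Complex.I / 2)) • ∑ p ∈ s.exps, ∑ q ∈ s.exps,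
    kappaShift s.mult (ℓ s.point) p q r • ∑ n ∈ Finset.Ioo (-(k : ℤ)) k, P.quad B ℓ s p q n

/-- The defining formulas of the level-fixing map. The last one says that the generator
`D_r^{(x)}` is sent to the sum over all integers `n` of the generalised Segal-Sugawara terms. -/
structure IsLevelFixing (π : Cx P.tilde →ₗ[ℂ] P.LocalObs ℓ) : Prop where
  map_loop : ∀ s p m x, Place.Allowed s p (Affine.mono m x : Affine G) →
    π (gen P.tilde s p (Affine.mono m x)) =
      toCompletion (P.filHat ℓ) (P.filHat_antitone ℓ) (P.levelι ℓ (gen P.hat s p (Affine.mono m x)))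
  map_K : ∀ s p, Place.Allowed s p (Affine.K : Affine G) →
    π (gen P.tilde s p Affine.K) = algebraMap ℂ _ (s.sign * (Complex.I * ℓ s.point p))
  map_D : ∀ s r, Place.Allowed s r (Affine.D : Affine G) → ∀ k,
    (π (gen P.tilde s r Affine.D)).1 k =
      Ideal.Quotient.mk (P.filHat ℓ k) (P.sugawara B ℓ s r k)

end Poles
end AffineGaudin

end

open AffineGaudin

/-! Part 1 is a statement about inverting a power series. With `n` the multiplicity, the sum over
compositions which defines `kappa` is the coefficient of `X ^ (p - n + 1)` in the inverse of `∑
ℓ_{n-1-j} X ^ j`. Since `ℓ` vanishes from `n` on, the Hankel matrix `(ℓ_{p+s})` is anti-triangular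
with `ℓ_{n-1} ≠ 0` on the antidiagonal, and the product with the Hankel matrix `(κ_{p+q})` is the
Cauchy product of the series with its inverse (`kappa_system`). A left inverse of a square matrix is
unique (`kappa_unique`).

The heart of parts 2 and 3 is the classical Segal-Sugawara computation with Takiff exponents, done
once for abstract currents `cur p m x` (`IsCurrents`). Bracketing the quadratic element for `D_r`
with `y_m` at exponent `u` gives two kinds of terms by the Leibniz rule. The quadratic ones contain
`[I_a, y]` in one factor. Invariance of the Casimir element moves the bracket to the other factor,
and since the weight depends on `p + q - r` only, the exponent shift `u` can be moved as well
(`sum_kappaShift_swap`). The result is a difference `w n - w (n + m)`, whose sum over `n` is zero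
modulo the filtration. The linear terms come from the cocycle, at `n = m` and `n = -m`. There `κ` is
contracted with the levels, which leaves the single exponent `r + u`, and the constants combine to
`m`. This is `IsCurrents.segal_br`: the element acts as `D_r`. It also implies that the
Segal-Sugawara elements commute with each other: a derivation acting on currents as `D_r` multiplies
the two factors of a quadratic term by `-n` and `n` and shifts one exponent by `r`, and moving the
shift cancels the two contributions (`derivation_segal`).

All kinds of points are brought to this one situation. At the conjugate of a complex point the
currents are antilinear in `x`, whence the ring homomorphism `φ`, and carry the sign `ε` with `ε * ε
= 1`. At the fixed points the argument is first projected to the eigenspace of `σ` prescribed by the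
exponent. Then the sum over dual bases of eigenspaces equals the sum over dual bases of `𝔤`, and the
terms with `T ∤ p + q` drop out by themselves (`quad_eq`). At infinity the exponents begin at `1`,
which does no harm because the omitted weights are zero.

Identities in the complexified algebra are checked in its two coordinates, which are jointly
injective (`Cx.ext_coord`). Linear statements are checked on generators (`gen_induction`), which
yields uniqueness of `π` and reduces the homomorphism property to a few pairs of generators
(`levelFix_lie`).

For part 4, the universal property extends `π` to the symmetric algebra. Elements of the filtration
have no `D`-component, so there `π` is the obvious map and respects the filtrations (`levelFix_fil`,
`spanFil_hom`). The map therefore passes to completions, brackets follow by continuity, and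
uniqueness follows from density (`completionLift_br`, `completionLift_unique`). -/

noncomputable section
open scoped TensorProduct
namespace AffineGaudin

/-! ### Inverse power series, compositions and Hankel matrices. -/

section Kappa

/-- The recursion for sums over compositions, by the size of the first block. -/
theorem sum_composition_succ {M : Type*} [AddCommMonoid M] (m : ℕ) (F : List ℕ → M) :
    ∑ c : Composition (m + 1), F c.blocks =
      ∑ j : Fin (m + 1), ∑ c : Composition (m - j), F ((j + 1) :: c.blocks) := by
  rw [← Fintype.sum_sigma' (fun (j : Fin (m + 1)) (c : Composition (m - j)) =>
    F (((j : ℕ) + 1) :: c.blocks))]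
  symm
  refine Fintype.sum_bijective (fun x : (j : Fin (m + 1)) × Composition (m - j) =>
    (⟨((x.1 : ℕ) + 1) :: x.2.blocks, ?_, ?_⟩ : Composition (m + 1))) ⟨?_, ?_⟩ _ _ fun x => rfl
  · intro i hi
    rcases List.mem_cons.mp hi with rfl | hi
    · omega
    · exact x.2.blocks_pos hi
  · have := x.1.2
    rw [List.sum_cons, x.2.blocks_sum]; omega
  · rintro ⟨j, c⟩ ⟨j', c'⟩ h
    have h := congrArg Composition.blocks h
    simp only [List.cons.injEq, add_left_inj] at h
    obtain ⟨h1, h2⟩ := h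
    obtain rfl := Fin.ext h1
    rw [Composition.ext h2]
  · rintro ⟨bl, hpos, hsum⟩
    match bl with
    | [] => simp at hsum
    | i :: l =>
      have hi : 0 < i := hpos (List.mem_cons_self)
      rw [List.sum_cons] at hsum
      refine ⟨⟨⟨i - 1, by omega⟩, ⟨l, fun h => hpos (List.mem_cons_of_mem _ h), ?_⟩⟩, ?_⟩
      · simp only; omega
      · apply Composition.ext
        simp only [List.cons.injEq, and_true]
        omega

/-- The coefficients of the inverse of the power series `∑ a_j X ^ j`, as sums over
compositions. -/
def invCoeff (a : ℕ → ℂ) (m : ℕ) : ℂ :=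
  ∑ c : Composition m, (-1) ^ c.length * (c.blocks.map a).prod / a 0 ^ (c.length + 1)

theorem invCoeff_zero (a : ℕ → ℂ) : invCoeff a 0 = (a 0)⁻¹ := by
  unfold invCoeff
  rw [Fintype.sum_eq_single (⟨[], by simp, rfl⟩ : Composition 0)]
  · simp [Composition.length]
  · intro c hc
    have := Fintype.card_le_one_iff_subsingleton.mp (composition_card 0).le
    exact absurd (Subsingleton.elim _ _) hc

/-- Removing the first block `j + 1` of a composition removes a factor `-a (j + 1) / a 0` from its
term, which turns the sum over compositions into the recursion for an inverse power series. -/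
theorem invCoeff_succ (a : ℕ → ℂ) (h : a 0 ≠ 0) (m : ℕ) :
    a 0 * invCoeff a (m + 1) = -∑ j ∈ Finset.range (m + 1), a (j + 1) * invCoeff a (m - j) := by
  have e := sum_composition_succ m fun l : List ℕ =>
    (-1 : ℂ) ^ l.length * (l.map a).prod / a 0 ^ (l.length + 1)
  have e' : invCoeff a (m + 1) = ∑ c : Composition (m + 1), (-1 : ℂ) ^ c.blocks.length *
    (c.blocks.map a).prod / a 0 ^ (c.blocks.length + 1) := rfl
  rw [e', e, Finset.mul_sum, ← Finset.sum_neg_distrib, Finset.sum_range fun j => _]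
  refine Finset.sum_congr rfl fun j _ => ?_
  unfold invCoeff Composition.length
  rw [Finset.mul_sum, Finset.mul_sum, ← Finset.sum_neg_distrib]
  refine Finset.sum_congr rfl fun c _ => ?_
  simp only [List.length_cons, List.map_cons, List.prod_cons]
  field_simp
  ring

/-- This is the Cauchy product: it justifies the name of `invCoeff`. -/
theorem sum_mul_invCoeff (a : ℕ → ℂ) (h : a 0 ≠ 0) (m : ℕ) :
    ∑ j ∈ Finset.range (m + 1), a j * invCoeff a (m - j) = if m = 0 then 1 else 0 := by
  cases m with
  | zero => simp [invCoeff_zero, h]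
  | succ m =>
    rw [Finset.sum_range_succ', Nat.sub_zero, invCoeff_succ a h]
    simp

/-- The series to be inverted has the levels in reversed order, starting with the top one, and `κ`
is the inverse shifted by `n - 1`. -/
theorem kappa_eq_invCoeff (n : ℕ) (ℓ : ℕ → ℂ) (m : ℕ) (hn : 1 ≤ n) :
    kappa n ℓ (n - 1 + m) = invCoeff (fun j => ℓ (n - 1 - j)) m := by
  unfold kappa
  rw [if_neg (by omega)]
  have : n - 1 + m + 1 - n = m := by omega
  unfold invCoeff
  rw [this]
  rfl

theorem kappa_eq_zero (n : ℕ) (ℓ : ℕ → ℂ) (p : ℕ) (h : p + 1 < n) : kappa n ℓ p = 0 := if_pos h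

/-- The numbers `κ` invert the Hankel matrix of the levels. -/
theorem kappa_system (n : ℕ) (ℓ : ℕ → ℂ) (hv : ∀ p, n ≤ p → ℓ p = 0) (h0 : ℓ (n - 1) ≠ 0)
    (q s : ℕ) (hq : q < n) (hs : s < n) :
    ∑ p ∈ Finset.range n, kappa n ℓ (p + q) * ℓ (p + s) = if q = s then 1 else 0 := by
  -- If `q < s`, every term vanishes: `p + q < n - 1` kills `κ`, and otherwise `p + s ≥ n` kills the
  -- level.
  rcases lt_or_ge q s with hqs | hqs
  · rw [if_neg hqs.ne]
    refine Finset.sum_eq_zero fun p _ => ?_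
    rcases lt_or_ge (p + q + 1) n with h | h
    · rw [kappa_eq_zero n ℓ _ h, zero_mul]
    · rw [hv _ (by omega), mul_zero]
  · obtain ⟨d, rfl⟩ := Nat.exists_eq_add_of_le hqs
    have e : (if s + d = s then (1 : ℂ) else 0) = if d = 0 then 1 else 0 := by
      congr 1; simp
    rw [e, ← sum_mul_invCoeff (fun j => ℓ (n - 1 - j)) (by simpa using h0)]
    -- With `q = s + d`, only `n - 1 - q ≤ p < n - s` contributes. These are `d + 1` terms, and in
    -- reversed order they form the coefficient of degree `d` of the Cauchy product.
    have hsub : (Finset.Ico (n - 1 - (s + d)) (n - s)) ⊆ Finset.range n := by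
      intro p hp
      rw [Finset.mem_Ico] at hp
      exact Finset.mem_range.mpr (by omega)
    rw [← Finset.sum_subset hsub, Finset.sum_Ico_eq_sum_range]
    · have e2 : n - s - (n - 1 - (s + d)) = d + 1 := by omega
      rw [e2, ← Finset.sum_range_reflect]
      refine Finset.sum_congr rfl fun i hi => ?_
      have hi := Finset.mem_range.mp hi
      rw [mul_comm, ← kappa_eq_invCoeff n ℓ _ (by omega)]
      congr 2 <;> omega
    · intro p hp hp'
      rw [Finset.mem_Ico] at hp'
      have hp := Finset.mem_range.mp hp
      rcases lt_or_ge (p + (s + d) + 1) n with h | h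
      · rw [kappa_eq_zero n ℓ _ h, zero_mul]
      · rw [hv _ (by omega), mul_zero]

/-- The numbers `κ` are the only solution of the system which says that they invert the Hankel
matrix of the levels. -/
theorem kappa_unique (n : ℕ) (hn : 1 ≤ n) (ℓ : ℕ → ℂ) (hv : ∀ p, n ≤ p → ℓ p = 0)
    (h0 : ℓ (n - 1) ≠ 0) (κ : ℕ → ℂ) :
    (∀ q < n, ∀ r < n, ∑ p ∈ Finset.range n, κ (p + q) * ℓ (p + r) = if q = r then 1 else 0) ↔
      ∀ p ≤ 2 * n - 2, κ p = kappa n ℓ p := by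
  constructor
  · intro h
    -- Both solutions give left inverses of the same Hankel matrix, hence the same matrix.
    let L : Matrix (Fin n) (Fin n) ℂ := Matrix.of fun p r => ℓ (p + r)
    have key : ∀ κ : ℕ → ℂ, (∀ q < n, ∀ r < n, ∑ p ∈ Finset.range n, κ (p + q) * ℓ (p + r) =
        if q = r then 1 else 0) → (Matrix.of fun q p : Fin n => κ (p + q)) * L = 1 := by
      intro κ h
      ext q r
      rw [Matrix.mul_apply, Matrix.one_apply]
      have := h q q.2 r r.2
      rw [Finset.sum_range] at this
      simp only [Matrix.of_apply, L, this, Fin.ext_iff]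
    have h1 := key κ h
    have h2 := key _ (fun q hq r hr => kappa_system n ℓ hv h0 q r hq hr)
    have h3 := (Matrix.inv_eq_left_inv h1).symm.trans (Matrix.inv_eq_left_inv h2)
    intro p hp
    -- Each `p ≤ 2 * n - 2` is the sum of `min p (n - 1)` and the truncated difference `p - (n -
    -- 1)`, both less than `n`, so `κ p` occurs as a matrix entry.
    have := congrFun (congrFun h3 ⟨p - (n - 1), by omega⟩) ⟨min p (n - 1), by omega⟩
    simp only [Matrix.of_apply] at this
    have e : min p (n - 1) + (p - (n - 1)) = p := by omega
    rwa [e] at this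
  · intro h q hq r hr
    rw [← kappa_system n ℓ hv h0 q r hq hr]
    refine Finset.sum_congr rfl fun p hp => ?_
    have hp := Finset.mem_range.mp hp
    rw [h _ (by omega)]

/-- The numbers `κ` with an integer index, zero for negative indices. -/
def kappaInt (n : ℕ) (ℓ : ℕ → ℂ) (t : ℤ) : ℂ := if t < 0 then 0 else kappa n ℓ t.toNat

theorem kappaShift_eq (n : ℕ) (ℓ : ℕ → ℂ) (p q r : ℕ) :
    kappaShift n ℓ p q r = kappaInt n ℓ (p + q - r) := by
  unfold kappaShift kappaInt
  by_cases h : p + q < r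
  · rw [if_pos h, if_pos (by omega)]
  · rw [if_neg h, if_neg (by omega)]
    congr 1; omega

theorem kappaInt_eq_zero (n : ℕ) (ℓ : ℕ → ℂ) (t : ℤ) (h : t + 1 < n) : kappaInt n ℓ t = 0 := by
  unfold kappaInt
  split_ifs with h'
  · rfl
  · exact kappa_eq_zero n ℓ _ (by omega)

/-- Contraction of `κ` with the levels. -/
theorem sum_kappaShift_mul (n lo : ℕ) (ℓ : ℕ → ℂ) (hv : ∀ p, n ≤ p → ℓ p = 0)
    (h0 : ℓ (n - 1) ≠ 0) (p r s : ℕ) (hp : p < n) (hr : lo ≤ r) :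
    ∑ q ∈ Finset.Ico lo n, kappaShift n ℓ p q r * ℓ (q + s) = if p = r + s then 1 else 0 := by
  have hsub : Finset.Ico lo n ⊆ Finset.range n := fun q hq =>
    Finset.mem_range.mpr (Finset.mem_Ico.mp hq).2
  -- Exponents below `lo` may be included: for `q < lo ≤ r` and `p ≤ n - 1` one has `p + q - r < n -
  -- 1`, where `κ` is zero.
  rw [Finset.sum_subset hsub]
  · by_cases hpr : p < r
    · rw [if_neg (by omega)]
      refine Finset.sum_eq_zero fun q hq => ?_
      have := Finset.mem_range.mp hq
      rw [kappaShift_eq, kappaInt_eq_zero _ _ _ (by omega), zero_mul]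
    · by_cases hs : s < n
      · have := kappa_system n ℓ hv h0 (p - r) s (by omega) hs
        have e : (if p = r + s then (1 : ℂ) else 0) = if p - r = s then 1 else 0 := by
          congr 1; apply propext; omega
        rw [e, ← this]
        refine Finset.sum_congr rfl fun q _ => ?_
        unfold kappaShift
        rw [if_neg (by omega)]
        congr 2; omega
      · rw [if_neg (by omega)]
        exact Finset.sum_eq_zero fun q _ => by rw [hv _ (by omega), mul_zero]
  · intro q hq hq'
    have := Finset.mem_range.mp hq
    rw [Finset.mem_Ico] at hq'
    rw [kappaShift_eq, kappaInt_eq_zero _ _ _ (by omega), zero_mul]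

theorem kappaShift_comm (n : ℕ) (ℓ : ℕ → ℂ) (p q r : ℕ) :
    kappaShift n ℓ p q r = kappaShift n ℓ q p r := by
  rw [kappaShift_eq, kappaShift_eq, add_comm (p : ℤ)]

variable {M : Type*} [AddCommGroup M] [Module ℂ M]

/-- The substitution `p + s ↦ p` moves the shift into the weight. Extending both sums to `0, …, n -
1` is free because new terms have weight zero, and terms beyond `n` are killed by `g`. The
right-hand weight is symmetric in the two exponents, which is what makes it irrelevant which of them
was shifted. -/
theorem sum_kappaShift_left (n lo : ℕ) (ℓ : ℕ → ℂ) (r s : ℕ) (hr : lo ≤ r) (g : ℕ → ℕ → M)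
    (hg : ∀ p q, n ≤ p → g p q = 0) :
    ∑ p ∈ Finset.Ico lo n, ∑ q ∈ Finset.Ico lo n, kappaShift n ℓ p q r • g (p + s) q =
      ∑ p ∈ Finset.range n, ∑ q ∈ Finset.range n, kappaInt n ℓ (p + q - r - s) • g p q := by
  have e : ∀ q < n, ∑ p ∈ Finset.Ico lo n, kappaShift n ℓ p q r • g (p + s) q =
      ∑ p ∈ Finset.range n, kappaInt n ℓ (p + q - r - s) • g p q := by
    intro q hq
    have e1 : ∀ p ∈ Finset.Ico lo n, kappaShift n ℓ p q r • g (p + s) q =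
        (fun p' : ℕ => kappaInt n ℓ (p' + q - r - s) • g p' q) (p + s) := by
      intro p _
      rw [kappaShift_eq]
      congr 2; push_cast; ring
    rw [Finset.sum_congr rfl e1,
      Finset.sum_Ico_add' (fun p' : ℕ => kappaInt n ℓ (p' + q - r - s) • g p' q) lo n s]
    rw [Finset.sum_subset (s₂ := Finset.range (n + s))
      (fun p hp => Finset.mem_range.mpr (Finset.mem_Ico.mp hp).2)]
    · symm
      refine Finset.sum_subset (Finset.range_mono (Nat.le_add_right n s)) fun p _ hp => ?_
      rw [hg p q (by simpa using hp), smul_zero]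
    · intro p hp hp'
      have hp := Finset.mem_range.mp hp
      rw [Finset.mem_Ico] at hp'
      rw [kappaInt_eq_zero _ _ _ (by omega), zero_smul]
  rw [Finset.sum_comm, Finset.sum_congr rfl fun q hq => e q (Finset.mem_Ico.mp hq).2,
    Finset.sum_comm (s := Finset.range n)]
  refine Finset.sum_subset (fun q hq => Finset.mem_range.mpr (Finset.mem_Ico.mp hq).2) ?_
  intro q hq hq'
  have hq := Finset.mem_range.mp hq
  rw [Finset.mem_Ico] at hq'
  refine Finset.sum_eq_zero fun p hp => ?_
  have hp := Finset.mem_range.mp hp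
  rw [kappaInt_eq_zero _ _ _ (by omega), zero_smul]

/-- In sums weighted by `κ_{p+q-r}`, a shift may be moved from the first argument to the
second. -/
theorem sum_kappaShift_swap (n lo : ℕ) (ℓ : ℕ → ℂ) (r s : ℕ) (hr : lo ≤ r) (g : ℕ → ℕ → M)
    (hg : ∀ p q, n ≤ p → g p q = 0) (hg' : ∀ p q, n ≤ q → g p q = 0) :
    ∑ p ∈ Finset.Ico lo n, ∑ q ∈ Finset.Ico lo n, kappaShift n ℓ p q r • g (p + s) q =
      ∑ p ∈ Finset.Ico lo n, ∑ q ∈ Finset.Ico lo n, kappaShift n ℓ p q r • g p (q + s) := by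
  rw [sum_kappaShift_left n lo ℓ r s hr g hg]
  have h := sum_kappaShift_left n lo ℓ r s hr (fun q p => g p q) fun q p h => hg' p q h
  rw [Finset.sum_comm, Finset.sum_comm (s := Finset.range n)] at h
  refine Eq.trans ?_ (h.symm.trans ?_)
  · refine Finset.sum_congr rfl fun p _ => Finset.sum_congr rfl fun q _ => ?_
    rw [add_comm (p : ℤ)]
  · refine Finset.sum_congr rfl fun p _ => Finset.sum_congr rfl fun q _ => ?_
    rw [kappaShift_comm]

end Kappa
end AffineGaudin
end

noncomputable section
open scoped TensorProduct
namespace AffineGaudin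

/-! ### Continuity of the completed bracket, and homomorphisms between completions. -/

section CompletionMaps

variable {S : Type*} [CommRing S] [Algebra ℂ S] {F : ℕ → Ideal S} {hF : Antitone F}

theorem completion_ext {f g : completion F hF} (h : ∀ n, f.1 n = g.1 n) : f = g :=
  Subtype.ext (funext h)

variable {P : PoissonBracket S}

/-- The level `M` depends on `f`, `g` and `N` only. The level provided by `limBr_rep` varies with
the arguments, and here it is removed by comparing with fixed representatives of `f` and `g`. -/
theorem limBr_uniform (hP : PoissonContinuous P F) (f g : completion F hF)
    (N : ℕ) : ∃ M, ∀ f' g' : completion F hF, f'.1 M = f.1 M → g'.1 M = g.1 M →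
      (hP.limBr f' g').1 N =
        Ideal.Quotient.mk (F N) (P.br (completionRep f M) (completionRep g M)) := by
  obtain ⟨M, hNM, hM⟩ := hP.eventually hF (completionRep f N) (completionRep g N) N
  refine ⟨M, fun f' g' hf hg => ?_⟩
  obtain ⟨M', hM'⟩ := hP.limBr_rep f' g' N
  rw [hM' (max M M') (le_max_right _ _) _ _ (mk_completionRep f' _) (mk_completionRep g' _),
    Ideal.Quotient.eq]
  refine hM _ _ ?_ ?_ _ _ ?_ ?_
  · rw [← Ideal.Quotient.eq, mk_completionRep_of_le f hNM, mk_completionRep]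
  · rw [← Ideal.Quotient.eq, mk_completionRep_of_le g hNM, mk_completionRep]
  · rw [← Ideal.Quotient.eq, mk_completionRep, ← hf, mk_completionRep_of_le f' (le_max_left _ _)]
  · rw [← Ideal.Quotient.eq, mk_completionRep, ← hg, mk_completionRep_of_le g' (le_max_left _ _)]

/-- The bracket of the completion is continuous. -/
theorem completionBr_congr (hP : PoissonContinuous P F)
    (f g : completion F hF) (N : ℕ) : ∃ M, ∀ f' g' : completion F hF, f'.1 M = f.1 M →
      g'.1 M = g.1 M → ((hP.completion hF).br f' g').1 N = ((hP.completion hF).br f g).1 N := by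
  obtain ⟨M, hM⟩ := limBr_uniform hP f g N
  exact ⟨M, fun f' g' hf hg => (hM f' g' hf hg).trans (hM f g rfl rfl).symm⟩

theorem completionBr_toCompletion (hP : PoissonContinuous P F) (a b : S) :
    (hP.completion hF).br (toCompletion F hF a) (toCompletion F hF b) =
      toCompletion F hF (P.br a b) := by
  refine completion_ext fun N => ?_
  obtain ⟨M, hM⟩ := hP.limBr_rep (toCompletion F hF a) (toCompletion F hF b) N
  exact hM M le_rfl a b rfl rfl

variable {S' : Type*} [CommRing S'] [Algebra ℂ S'] {F' : ℕ → Ideal S'} {hF' : Antitone F'}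

/-- The extension to the completion of a homomorphism compatible with the filtrations. -/
def completionLift (ψ : S →ₐ[ℂ] completion F' hF') (hψ : ∀ n, ∀ f ∈ F n, (ψ f).1 n = 0) :
    completion F hF →ₐ[ℂ] completion F' hF' where
  toFun f := ⟨fun n => (ψ (completionRep f n)).1 n, fun m n h => by
    have h1 := hψ m (completionRep f n - completionRep f m) (by
      rw [← Ideal.Quotient.eq, mk_completionRep, mk_completionRep_of_le f h])
    rw [map_sub] at h1
    exact ((ψ (completionRep f n)).2 m n h).trans (sub_eq_zero.mp h1)⟩
  map_one' := completion_ext fun n => by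
    have h1 := hψ n (completionRep (1 : completion F hF) n - 1) (by
      rw [← Ideal.Quotient.eq, mk_completionRep]; rfl)
    rw [map_sub, map_one] at h1
    exact sub_eq_zero.mp h1
  map_mul' f g := completion_ext fun n => by
    have h1 := hψ n (completionRep (f * g) n - completionRep f n * completionRep g n) (by
      rw [← Ideal.Quotient.eq, map_mul, mk_completionRep, mk_completionRep, mk_completionRep]; rfl)
    rw [map_sub, map_mul] at h1
    exact sub_eq_zero.mp h1
  map_zero' := completion_ext fun n => hψ n (completionRep (0 : completion F hF) n) (by
      rw [← Ideal.Quotient.eq_zero_iff_mem, mk_completionRep]; rfl)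
  map_add' f g := completion_ext fun n => by
    have h1 := hψ n (completionRep (f + g) n - (completionRep f n + completionRep g n)) (by
      rw [← Ideal.Quotient.eq, map_add, mk_completionRep, mk_completionRep, mk_completionRep]; rfl)
    rw [map_sub, map_add] at h1
    exact sub_eq_zero.mp h1
  commutes' c := completion_ext fun n => by
    have h1 := hψ n (completionRep (algebraMap ℂ (completion F hF) c) n - algebraMap ℂ S c) (by
      rw [← Ideal.Quotient.eq, mk_completionRep]; rfl)
    rw [map_sub, AlgHom.commutes] at h1
    exact sub_eq_zero.mp h1

variable {ψ : S →ₐ[ℂ] completion F' hF'} {hψ : ∀ n, ∀ f ∈ F n, (ψ f).1 n = 0}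

/-- The lift is defined through chosen representatives; compatibility with the filtrations makes the
choice immaterial. -/
theorem completionLift_val (f : completion F hF) (n : ℕ) (a : S)
    (ha : Ideal.Quotient.mk (F n) a = f.1 n) : (completionLift ψ hψ f).1 n = (ψ a).1 n := by
  have h1 := hψ n (completionRep f n - a) (by
    rw [← Ideal.Quotient.eq, mk_completionRep, ha])
  rw [map_sub] at h1
  exact sub_eq_zero.mp h1

theorem completionLift_toCompletion (a : S) :
    completionLift ψ hψ (toCompletion F hF a) = ψ a :=
  completion_ext fun n => completionLift_val _ n a rfl

theorem completionLift_val_zero (n : ℕ) (f : completion F hF) (hf : f.1 n = 0) :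
    (completionLift ψ hψ f).1 n = 0 := by
  rw [completionLift_val f n 0 (by rw [hf, map_zero]), map_zero]; rfl

/-- Modulo the `N`-th ideal, both brackets depend on the arguments at some finite level only, and
there elements of `S` represent them, so `hbr` applies. -/
theorem completionLift_br {P' : PoissonBracket S'} (hP : PoissonContinuous P F)
    (hP' : PoissonContinuous P' F')
    (hbr : ∀ a b, ψ (P.br a b) = (hP'.completion hF').br (ψ a) (ψ b)) (f g : completion F hF) :
    completionLift ψ hψ ((hP.completion hF).br f g) =
      (hP'.completion hF').br (completionLift ψ hψ f) (completionLift ψ hψ g) := by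
  refine completion_ext fun N => ?_
  obtain ⟨M₁, h₁⟩ := hP.limBr_rep f g N
  obtain ⟨M₂, h₂⟩ := completionBr_congr hP' (completionLift ψ hψ f) (completionLift ψ hψ g) N
  have h := h₁ (max M₁ M₂) (le_max_left _ _) _ _ (mk_completionRep f _) (mk_completionRep g _)
  refine (completionLift_val _ N _ h.symm).trans ?_
  rw [hbr]
  refine h₂ _ _ ?_ ?_
  · exact (completionLift_val f _ _ (mk_completionRep_of_le f (le_max_right _ _))).symm
  · exact (completionLift_val g _ _ (mk_completionRep_of_le g (le_max_right _ _))).symm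

/-- The image of `S` is dense: `f` differs from the image of a representative by an element with
vanishing `m`-th component. The level `max m n` serves both the continuity of `Φ` and the evaluation
of the lift. -/
theorem completionLift_unique (Φ : completion F hF →ₐ[ℂ] completion F' hF')
    (hΦ : ∀ a, Φ (toCompletion F hF a) = ψ a) (hc : ∀ n, ∃ m, ∀ f, f.1 m = 0 → (Φ f).1 n = 0) :
    Φ = completionLift ψ hψ := by
  refine AlgHom.ext fun f => completion_ext fun n => ?_
  obtain ⟨m, hm⟩ := hc n
  have h := hm (f - toCompletion F hF (completionRep f (max m n))) (by
    change f.1 m - Ideal.Quotient.mk (F m) _ = 0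
    rw [mk_completionRep_of_le f (le_max_left _ _), sub_self])
  rw [map_sub, hΦ] at h
  rw [completionLift_val f n _ (mk_completionRep_of_le f (le_max_right m n))]
  exact sub_eq_zero.mp h

end CompletionMaps

/-! ### Homomorphisms out of a symmetric algebra: brackets and filtrations. -/

section SymmetricMaps

variable {L : Type*} [LieRing L] [LieAlgebra ℂ L] {S : Type*} [CommRing S] [Algebra ℂ S]

/-- An algebra homomorphism from the symmetric algebra which is compatible with the brackets on
generators is a Poisson homomorphism. -/
theorem symPoisson_hom (P : PoissonBracket S) (ψ : SymmetricAlgebra ℂ L →ₐ[ℂ] S)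
    (h : ∀ X Y, ψ (SymmetricAlgebra.ι ℂ L ⁅X, Y⁆) =
      P.br (ψ (SymmetricAlgebra.ι ℂ L X)) (ψ (SymmetricAlgebra.ι ℂ L Y)))
    (f g : SymmetricAlgebra ℂ L) : ψ ((symPoisson L).br f g) = P.br (ψ f) (ψ g) := by
  induction f using SymmetricAlgebra.induction with
  | algebraMap r => rw [PoissonBracket.br_algebraMap, AlgHom.commutes, P.br_algebraMap, map_zero]
  | mul a b ha hb =>
    rw [PoissonBracket.leibniz, map_mul ψ a b, P.leibniz, map_add, map_mul, map_mul, ha, hb]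
  | add a b ha hb => simp only [map_add, LinearMap.add_apply, ha, hb]
  | ι X =>
    induction g using SymmetricAlgebra.induction with
    | algebraMap r =>
      rw [PoissonBracket.skew, PoissonBracket.br_algebraMap, AlgHom.commutes, P.skew,
        P.br_algebraMap, neg_zero, neg_zero, map_zero]
    | mul a b ha hb =>
      rw [PoissonBracket.leibniz_right, map_mul ψ a b, P.leibniz_right, map_add, map_mul, map_mul,
        ha, hb]
    | add a b ha hb => simp only [map_add, ha, hb]
    | ι Y => exact (congrArg ψ (symBr_ι_ι X Y)).trans (h X Y)

/-- Compatibility with filtrations of an algebra homomorphism to a completion follows from its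
values on generators. -/
theorem spanFil_hom {G G' : ℕ → Set S} {hF : Antitone (spanFil G G')} {S₀ : Type*} [CommRing S₀]
    [Algebra ℂ S₀] (ψ : S₀ →ₐ[ℂ] completion (spanFil G G') hF) (A A' : ℕ → Set S₀) (n : ℕ)
    (h : ∀ x ∈ A n, ∃ y ∈ G n, ψ x = toCompletion _ hF y)
    (h' : ∀ x ∈ A' n, ∃ y ∈ G' n, ψ x = toCompletion _ hF y)
    (f : S₀) (hf : f ∈ spanFil A A' n) : (ψ f).1 n = 0 := by
  -- The target is a completion, so ideal membership is expressed in the quotient at level `n`.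
  -- Since the filtration ideal lies in each of the two generated ideals, it pulls back to
  -- membership in `S`, where the intersection can be taken.
  have key : ∀ (B : Set S₀) (H : Set S), (∀ x ∈ B, ∃ y ∈ H, ψ x = toCompletion _ hF y) →
      ∀ f ∈ Ideal.span B, (ψ f).1 n ∈
        (Ideal.span H).map (Ideal.Quotient.mk (spanFil G G' n)) := by
    intro B H hB f hf
    induction hf using Submodule.span_induction with
    | mem x hx =>
      obtain ⟨y, hy, e⟩ := hB x hx
      rw [e]
      exact Ideal.mem_map_of_mem _ (Ideal.subset_span hy)
    | zero => rw [map_zero]; exact zero_mem _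
    | add a b _ _ ha hb => rw [map_add]; exact add_mem ha hb
    | smul a b _ hb => rw [smul_eq_mul, map_mul]; exact Ideal.mul_mem_left _ _ hb
  obtain ⟨y, hy⟩ := Ideal.Quotient.mk_surjective ((ψ f).1 n)
  have h1 := key _ _ h f hf.1
  have h2 := key _ _ h' f hf.2
  rw [← hy] at h1 h2
  replace h1 := (Ideal.mem_quotient_iff_mem (I := spanFil G G' n) inf_le_left).mp h1
  replace h2 := (Ideal.mem_quotient_iff_mem (I := spanFil G G' n) inf_le_right).mp h2
  rw [← hy, Ideal.Quotient.eq_zero_iff_mem]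
  exact ⟨h1, h2⟩

end SymmetricMaps
end AffineGaudin
end

noncomputable section
open scoped TensorProduct
namespace AffineGaudin

variable {𝔤 : Type*} [LieRing 𝔤] [LieAlgebra ℂ 𝔤] {T : ℕ} {G : DihedralLie 𝔤 T}

namespace DihedralLie

@[simp] theorem conjIf_false (c : ℂ) : conjIf false c = c := rfl

@[simp] theorem conjIf_true (c : ℂ) : conjIf true c = starRingEnd ℂ c := rfl

@[simp] theorem conjIf_conjIf (b : Bool) (c : ℂ) : conjIf b (conjIf b c) = c := by
  cases b <;> simp

end DihedralLie

open DihedralLie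

/-! ### Brackets and decomposition of elements of the affine algebra. -/

namespace Affine

@[simp] theorem mono_loop (m : ℤ) (x : 𝔤) : (mono m x : Affine G).loop = loopMono m x := rfl
@[simp] theorem mono_k (m : ℤ) (x : 𝔤) : (mono m x : Affine G).k = 0 := rfl
@[simp] theorem mono_d (m : ℤ) (x : 𝔤) : (mono m x : Affine G).d = 0 := rfl
@[simp] theorem K_loop : (K : Affine G).loop = 0 := rfl
@[simp] theorem K_k : (K : Affine G).k = 1 := rfl
@[simp] theorem K_d : (K : Affine G).d = 0 := rfl
@[simp] theorem D_loop : (D : Affine G).loop = 0 := rfl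
@[simp] theorem D_k : (D : Affine G).k = 0 := rfl
@[simp] theorem D_d : (D : Affine G).d = 1 := rfl

theorem loopMono_add (m : ℤ) (x y : 𝔤) : loopMono m (x + y) = loopMono m x + loopMono m y :=
  map_add (loopMonoHom m) x y

theorem mono_add (m : ℤ) (x y : 𝔤) : (mono m (x + y) : Affine G) = mono m x + mono m y := by
  ext1
  · exact loopMono_add m x y
  · simp
  · simp

theorem smul_mono (c : ℂ) (m : ℤ) (x : 𝔤) : c • (mono m x : Affine G) = mono m (c • x) := by
  ext1
  · exact smul_loopMono c m x
  · simp
  · simp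

theorem mono_lie (m n : ℤ) (x y : 𝔤) : ⁅(mono m x : Affine G), (mono n y : Affine G)⁆ =
    mono (m + n) ⁅x, y⁆ + (if m + n = 0 then (m : ℂ) * G.form x y else 0) • K := by
  ext1
  · simp only [lie_loop, add_loop, smul_loop, mono_loop, mono_d, K_loop, loopMono_lie, smul_zero,
      zero_smul, add_zero, sub_zero]
  · simp only [lie_k, add_k, smul_k, mono_loop, mono_k, K_k, cocycle_mono, mul_one, zero_add]
  · simp only [lie_d, add_d, smul_d, mono_d, K_d, mul_zero, add_zero]

theorem D_lie_mono (n : ℤ) (y : 𝔤) :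
    ⁅(D : Affine G), (mono n y : Affine G)⁆ = (n : ℂ) • mono n y := by
  ext1
  · simp [lie_loop, loopDeg_mono]
  · simp [lie_k]
  · simp

/-- Every element of the affine algebra is a combination of the elements `x ⊗ tⁿ`, `K`, `D`. -/
theorem eq_sum (X : Affine G) : X = ∑ m ∈ (loopCoeff X.loop).support, mono m (loopCoeff X.loop m)
    + X.k • K + X.d • D := by
  have hl : ∀ (s : Finset ℤ) (f : ℤ → Affine G), (∑ m ∈ s, f m).loop = ∑ m ∈ s, (f m).loop :=
    fun s f => map_sum (⟨⟨Affine.loop, rfl⟩, fun _ _ => rfl⟩ : Affine G →+ Loop 𝔤) f s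
  have hk : ∀ (s : Finset ℤ) (f : ℤ → Affine G), (∑ m ∈ s, f m).k = ∑ m ∈ s, (f m).k :=
    fun s f => map_sum (⟨⟨Affine.k, rfl⟩, fun _ _ => rfl⟩ : Affine G →+ ℂ) f s
  have hd : ∀ (s : Finset ℤ) (f : ℤ → Affine G), (∑ m ∈ s, f m).d = ∑ m ∈ s, (f m).d :=
    fun s f => map_sum (⟨⟨Affine.d, rfl⟩, fun _ _ => rfl⟩ : Affine G →+ ℂ) f s
  ext1
  · rw [add_loop, add_loop, hl]
    simp only [mono_loop, smul_loop, K_loop, D_loop, smul_zero, add_zero]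
    exact loop_eq_sum X.loop
  · simp [hk]
  · simp [hd]

end Affine

/-! ### Coordinates on the complexified algebra and its generators. -/

namespace Poles

variable {P : Poles G} {A : LieSubalgebra ℝ P.TakiffSum}

theorem single_eq_zero (x : P.pts) (p : ℕ) (X : Affine G) (h : P.mult x ≤ p) :
    single x p X = (0 : P.TakiffSum) := by
  refine TakiffSum.ext fun y q => if_neg ?_
  rintro ⟨rfl, hq⟩
  have := q.2
  omega

theorem single_zero (x : P.pts) (p : ℕ) : single x p 0 = (0 : P.TakiffSum) :=
  TakiffSum.ext fun _ _ => ite_self _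

theorem single_add (x : P.pts) (p : ℕ) (X Y : Affine G) :
    (single x p (X + Y) : P.TakiffSum) = single x p X + single x p Y := by
  refine TakiffSum.ext fun y q => ?_
  rw [TakiffSum.add_apply]
  unfold single
  split_ifs <;> simp

theorem single_smul (x : P.pts) (p : ℕ) (c : ℂ) (X : Affine G) :
    (single x p (c • X) : P.TakiffSum) = c • single x p X := by
  refine TakiffSum.ext fun y q => ?_
  rw [TakiffSum.smul_apply]
  unfold single
  split_ifs <;> simp

theorem single_lie_single (x : P.pts) (p q : ℕ) (X Y : Affine G) :
    ⁅(single x p X : P.TakiffSum), (single x q Y : P.TakiffSum)⁆ = single x (p + q) ⁅X, Y⁆ := by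
  refine TakiffSum.ext fun y r => ?_
  rw [TakiffSum.lie_apply]
  unfold single
  by_cases h : y = x ∧ (r : ℕ) = p + q
  · obtain ⟨rfl, hr⟩ := h
    have hr2 := r.2
    rw [if_pos ⟨rfl, hr⟩, Finset.sum_eq_single (⟨p, by omega⟩ : Fin (P.mult y)),
      Finset.sum_eq_single (⟨q, by omega⟩ : Fin (P.mult y))]
    · rw [if_pos hr.symm, if_pos ⟨rfl, rfl⟩, if_pos ⟨rfl, rfl⟩]
    · intro j _ hj
      rw [if_neg (c := y = y ∧ (j : ℕ) = q) fun h => hj (Fin.ext h.2), lie_zero, ite_self]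
    · exact fun h => absurd (Finset.mem_univ _) h
    · intro i _ hi
      refine Finset.sum_eq_zero fun j _ => ?_
      rw [if_neg (c := y = y ∧ (i : ℕ) = p) fun h => hi (Fin.ext h.2), zero_lie, ite_self]
    · exact fun h => absurd (Finset.mem_univ _) h
  · rw [if_neg h]
    refine Finset.sum_eq_zero fun i _ => Finset.sum_eq_zero fun j _ => ?_
    by_cases h1 : y = x ∧ (i : ℕ) = p
    · by_cases h2 : y = x ∧ (j : ℕ) = q
      · rw [if_neg]
        intro h3
        exact h ⟨h1.1, by omega⟩
      · rw [if_neg h2, lie_zero, ite_self]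
    · rw [if_neg h1, zero_lie, ite_self]

theorem single_lie_single_of_ne {x y : P.pts} (hxy : x ≠ y) (p q : ℕ) (X Y : Affine G) :
    ⁅(single x p X : P.TakiffSum), (single y q Y : P.TakiffSum)⁆ = 0 := by
  refine TakiffSum.ext fun z r => ?_
  rw [TakiffSum.lie_apply]
  refine Finset.sum_eq_zero fun i _ => Finset.sum_eq_zero fun j _ => ?_
  unfold single
  by_cases h1 : z = x ∧ (i : ℕ) = p
  · rw [if_neg (c := z = y ∧ (j : ℕ) = q) fun h => hxy (h1.1.symm.trans h.1), lie_zero, ite_self]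
  · rw [if_neg h1, zero_lie, ite_self]

theorem Cx.tmul_add (u : ℂ) (a b : A) : Cx.tmul u (a + b) = Cx.tmul u a + Cx.tmul u b :=
  TensorProduct.tmul_add u a b

theorem Cx.add_tmul (u v : ℂ) (a : A) : Cx.tmul (u + v) a = Cx.tmul u a + Cx.tmul v a :=
  TensorProduct.add_tmul u v a

theorem Cx.tmul_zero (u : ℂ) : Cx.tmul u (0 : A) = 0 := TensorProduct.tmul_zero A u

theorem Cx.smul_tmul' (c u : ℂ) (a : A) : c • Cx.tmul u a = Cx.tmul (c * u) a := rfl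

theorem Cx.tmul_smul_real (u : ℂ) (r : ℝ) (a : A) : Cx.tmul u (r • a) = Cx.tmul (r * u) a := by
  refine (TensorProduct.smul_tmul r u a).symm.trans ?_
  rw [Complex.real_smul]
  rfl

theorem Cx.eq_add (ξ : Cx A) : ∃ a a' : A, ξ = Cx.tmul 1 a + Cx.tmul Complex.I a' := by
  induction ξ using Cx.induction with
  | h0 => exact ⟨0, 0, by rw [Cx.tmul_zero, Cx.tmul_zero, add_zero]⟩
  | h u a =>
    refine ⟨u.re • a, u.im • a, ?_⟩
    rw [Cx.tmul_smul_real, Cx.tmul_smul_real, ← Cx.add_tmul, mul_one, Complex.re_add_im]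
  | hadd ξ η hξ hη =>
    obtain ⟨a, a', rfl⟩ := hξ
    obtain ⟨b, b', rfl⟩ := hη
    exact ⟨a + b, a' + b', by rw [Cx.tmul_add, Cx.tmul_add]; abel⟩

/-- An element `1 ⊗ a + i ⊗ a'` has the coordinates `a + i a'` and `a - i a'`, which determine `a`
and `a'`. Identities between generators thereby become identities in the Takiff algebras, with no
real forms involved. -/
theorem Cx.ext_coord {ξ η : Cx A} (h : ∀ b, Cx.coord b ξ = Cx.coord b η) : ξ = η := by
  rw [← sub_eq_zero]
  have h' : ∀ b, Cx.coord b (ξ - η) = 0 := fun b => by rw [map_sub, h, sub_self]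
  obtain ⟨a, a', e⟩ := Cx.eq_add (ξ - η)
  rw [e] at h' ⊢
  have h1 := h' false
  have h2 := h' true
  simp only [map_add, Cx.coord_tmul, conjIf_false, conjIf_true, one_smul, map_one,
    Complex.conj_I, neg_smul] at h1 h2
  have e1 : (2 : ℂ) • a.1 = 0 := by
    have : (2 : ℂ) • a.1 = (a.1 + Complex.I • a'.1) + (a.1 + -(Complex.I • a'.1)) := by module
    rw [this, h1, h2, add_zero]
  have ha : a = 0 := Subtype.ext ((smul_eq_zero.mp e1).resolve_left two_ne_zero)
  rw [ha] at h1
  have h1 : Complex.I • a'.1 = 0 := by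
    refine Eq.trans ?_ h1
    exact (zero_add _).symm
  have ha' : a' = 0 := Subtype.ext ((smul_eq_zero.mp h1).resolve_left Complex.I_ne_zero)
  rw [ha, ha', Cx.tmul_zero, Cx.tmul_zero, add_zero]

theorem Cx.coord_smul (b : Bool) (c : ℂ) (ξ : Cx A) :
    Cx.coord b (c • ξ) = conjIf b c • Cx.coord b ξ := by
  induction ξ using Cx.induction with
  | h0 => simp
  | h u a =>
    rw [Cx.smul_tmul', Cx.coord_tmul, Cx.coord_tmul, map_mul, mul_smul]
  | hadd ξ η h h' => simp only [smul_add, map_add, h, h']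

/-- Whether the place is the conjugate of a complex point. -/
def Place.flag : Place P → Bool
  | .cpx _ _ c => c
  | _ => false

/-- The coordinates of the generator `X_p^{(x)}`. -/
def comp : Place P → Bool → ℕ → Affine G → Affine G
  | .cpx _ _ c, b, _, X => if b = c then X else 0
  | .real _ _ _ _ _ _, false, _, X => X
  | .real x k hk h0 hi h, true, p, X => twist (.real x k hk h0 hi h) p X
  | .fixed _ _, false, _, X => X
  | .fixed x h, true, p, X => twist (.fixed x h) p X

theorem comp_flag (s : Place P) (p : ℕ) (X : Affine G) : comp s s.flag p X = X := by
  match s with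
  | .cpx _ _ c => exact if_pos rfl
  | .real .. => rfl
  | .fixed .. => rfl

theorem comp_add (s : Place P) (b : Bool) (p : ℕ) (X Y : Affine G) :
    comp s b p (X + Y) = comp s b p X + comp s b p Y := by
  match s, b with
  | .cpx _ _ c, b => simp only [comp]; split_ifs <;> simp
  | .real .., false => rfl
  | .real .., true => simp only [comp, twist, G.act_add, smul_add]
  | .fixed .., false => rfl
  | .fixed .., true => exact map_add _ _ _

/-- The conjugation on the left reflects that generators at the conjugate of a complex point depend
antilinearly on `X`. The one on the right reflects that the coordinate `true` is antilinear. -/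
theorem comp_smul (s : Place P) (b : Bool) (p : ℕ) (c : ℂ) (X : Affine G) :
    comp s b p (conjIf s.flag c • X) = conjIf b c • comp s b p X := by
  match s, b with
  | .cpx _ _ c', b =>
    simp only [comp, Place.flag]
    split_ifs with h
    · rw [h]
    · simp
  | .real .., false => rfl
  | .real x k hk h0 hi h, true => 
    simp only [comp, twist, Place.flag, G.act_smul, conjIf_false]
    rw [smul_comm]
  | .fixed .., false => rfl
  | .fixed .., true => exact G.affτ_smul _ _

theorem comp_zero (s : Place P) (b : Bool) (p : ℕ) : comp s b p (0 : Affine G) = 0 := by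
  have := comp_add s b p (0 : Affine G) 0
  rwa [add_zero, left_eq_add] at this

theorem comp_lie (s : Place P) (b : Bool) (p q : ℕ) (X Y : Affine G) :
    comp s b (p + q) ⁅X, Y⁆ = ⁅comp s b p X, comp s b q Y⁆ := by
  match s, b with
  | .cpx _ _ c, b => simp only [comp]; split_ifs <;> simp
  | .real .., false => rfl
  | .real .., true =>
    simp only [comp, twist, G.act_lie, pow_add, mul_smul, smul_lie, lie_smul]
    rw [smul_comm]
  | .fixed .., false => rfl
  | .fixed .., true => exact G.affτ_lie _ _

theorem comp_d (s : Place P) (b : Bool) (p : ℕ) (X : Affine G) (h : X.d = 0) :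
    (comp s b p X).d = 0 := by
  match s, b with
  | .cpx _ _ c, b =>
    simp only [comp]
    split_ifs
    · exact h
    · rfl
  | .real .., false => exact h
  | .real .., true => exact twist_d _ p X h
  | .fixed .., false => exact h
  | .fixed x hx, true => exact twist_d (.fixed x hx) p X h

/-- The elements used in the definition of the generator belong to `A`. -/
def GenMem (A : LieSubalgebra ℝ P.TakiffSum) (s : Place P) (p : ℕ) (X : Affine G) : Prop :=
  single s.base p ((1 / 2 : ℂ) • (X + twist s p X)) ∈ A ∧
    single s.base p (Complex.I • (1 / 2 : ℂ) • (X - twist s p X)) ∈ A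

/-- This normal form replaces the definition of the generators in most later computations: in each
coordinate the generator is a single monomial in `ε`, so sums, scalars and brackets of generators
are computed monomial by monomial. -/
theorem coord_gen_comp (s : Place P) (p : ℕ) (X : Affine G) (h : GenMem A s p X) (b : Bool) :
    Cx.coord b (gen A s p X) = single s.base p (comp s b p X) := by
  rw [coord_gen s p X h.1 h.2]
  congr 1
  match s, b with
  | .cpx _ _ true, true => simp [comp, twist, Place.sign, ← add_smul]; norm_num
  | .cpx _ _ true, false => simp [comp, twist, Place.sign]
  | .cpx _ _ false, true => simp [comp, twist, Place.sign]
  | .cpx _ _ false, false => simp [comp, twist, Place.sign, ← add_smul]; norm_num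
  | .real .., false => simp only [comp, Place.sign, Bool.false_eq_true, if_false]; module
  | .real .., true => simp only [comp, Place.sign, if_true]; module
  | .fixed .., false => simp only [comp, Place.sign, Bool.false_eq_true, if_false]; module
  | .fixed .., true => simp only [comp, Place.sign, if_true]; module

theorem genMem_of_le (s : Place P) (p : ℕ) (X : Affine G) (h : s.mult ≤ p) : GenMem A s p X := by
  have h : P.mult s.base ≤ p := h
  unfold GenMem
  rw [single_eq_zero _ _ _ h, single_eq_zero _ _ _ h]
  exact ⟨zero_mem _, zero_mem _⟩

theorem gen_eq_zero (s : Place P) (p : ℕ) (X : Affine G) (h : s.mult ≤ p) : gen A s p X = 0 :=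
  Cx.ext_coord fun b => by
    rw [coord_gen_comp s p X (genMem_of_le s p X h), single_eq_zero _ _ _ h, map_zero]

theorem gen_add (s : Place P) (p : ℕ) {X Y : Affine G} (hX : GenMem A s p X)
    (hY : GenMem A s p Y) (hXY : GenMem A s p (X + Y)) :
    gen A s p (X + Y) = gen A s p X + gen A s p Y :=
  Cx.ext_coord fun b => by
    rw [map_add, coord_gen_comp _ _ _ hX, coord_gen_comp _ _ _ hY, coord_gen_comp _ _ _ hXY,
      comp_add, single_add]

theorem gen_smul (s : Place P) (p : ℕ) {X : Affine G} (c : ℂ) (hX : GenMem A s p X)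
    (hcX : GenMem A s p (c • X)) :
    gen A s p (c • X) = conjIf s.flag c • gen A s p X :=
  Cx.ext_coord fun b => by
    have := comp_smul s b p (conjIf s.flag c) X
    rw [conjIf_conjIf] at this
    rw [Cx.coord_smul, coord_gen_comp _ _ _ hX, coord_gen_comp _ _ _ hcX, this, single_smul]

theorem gen_zero (s : Place P) (p : ℕ) : gen A s p (0 : Affine G) = 0 := by
  have h : GenMem A s p (0 : Affine G) := by
    have h0 : twist s p (0 : Affine G) = 0 := by
      match s with
      | .cpx .. => rfl
      | .real .. => simp only [twist, G.act_zero, smul_zero]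
      | .fixed .. => exact map_zero _
    unfold GenMem
    rw [h0, add_zero, sub_zero, smul_zero, smul_zero, single_zero]
    exact ⟨zero_mem _, zero_mem _⟩
  exact Cx.ext_coord fun b => by
    rw [coord_gen_comp s p _ h, comp_zero, single_zero, map_zero]

/-- The classification of the places over a marked point. -/
theorem place_eq_of_base_eq {s t : Place P} (h : s.base = t.base) :
    s = t ∨ ∃ x hx c, s = .cpx x hx c ∧ t = .cpx x hx (!c) := by
  have real_cpx : ∀ (x : P.pts) (k : ℕ), G.mobius k true x = x →
      ¬∀ k b, G.mobius k b x = x → b = false ∧ T ∣ k := fun x k h h' =>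
    absurd (h' k true h).1 (by decide)
  have fixed_cpx : ∀ (x : P.pts), ((x : OnePoint ℂ) = ((0 : ℂ) : OnePoint ℂ) ∨
      (x : OnePoint ℂ) = OnePoint.infty) → ¬∀ k b, G.mobius k b x = x → b = false ∧ T ∣ k := by
    intro x hx
    refine real_cpx x 0 ?_
    rcases hx with hx | hx
    · rw [hx, mobius_coe]; simp
    · rw [hx]; rfl
  match s, t with
  | .cpx x hx c, .cpx y hy c' =>
    obtain rfl : x = y := h
    by_cases hc : c = c'
    · exact Or.inl (by rw [hc])
    · refine Or.inr ⟨x, hx, c, rfl, ?_⟩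
      congr 1
      revert hc; cases c <;> cases c' <;> simp
  | .cpx x hx c, .real y k _ _ _ hy =>
    obtain rfl : x = y := h
    exact absurd hx (real_cpx x k hy)
  | .cpx x hx c, .fixed y hy =>
    obtain rfl : x = y := h
    exact absurd hx (fixed_cpx x hy)
  | .real y k _ _ _ hy, .cpx x hx c =>
    obtain rfl : y = x := h
    exact absurd hx (real_cpx y k hy)
  | .fixed y hy, .cpx x hx c =>
    obtain rfl : y = x := h
    exact absurd hx (fixed_cpx y hy)
  | .real x k hk h0 hi hx, .real y k' hk' _ _ hy =>
    obtain rfl : x = y := h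
    obtain ⟨w, hw⟩ : ∃ w : ℂ, (w : OnePoint ℂ) = x := OnePoint.ne_infty_iff_exists.mp hi
    have hw0 : w ≠ 0 := fun h => h0 (by rw [← hw, h])
    have hx' := hx
    rw [← hw, mobius_coe, OnePoint.coe_eq_coe] at hx' hy
    -- At a finite nonzero point, the reflection in the stabiliser is unique: `ωᵏ w̄ = w` determines
    -- `ωᵏ`, and `k < T` determines `k`.
    have h1 : G.ω ^ k = G.ω ^ k' := mul_right_cancel₀
      ((map_ne_zero (starRingEnd ℂ)).mpr hw0) (hx'.trans hy.symm)
    obtain rfl := G.ω_prim.pow_inj hk hk' h1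
    exact Or.inl rfl
  | .real x k hk h0 hi hx, .fixed y hy =>
    obtain rfl : x = y := h
    exact absurd hy (not_or.mpr ⟨h0, hi⟩)
  | .fixed y hy, .real x k hk h0 hi hx =>
    obtain rfl : y = x := h
    exact absurd hy (not_or.mpr ⟨h0, hi⟩)
  | .fixed x hx, .fixed y hy =>
    obtain rfl : x = y := h
    exact Or.inl rfl

instance : Finite (Place P) := by
  refine Finite.of_injective (fun s : Place P => (s.base, s.flag)) fun s t h => ?_
  obtain ⟨h1, h2⟩ := Prod.mk.inj h
  rcases place_eq_of_base_eq h1 with h | ⟨x, hx, c, rfl, rfl⟩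
  · exact h
  · revert h2; cases c <;> simp [Place.flag]

theorem lie_gen (s : Place P) (p q : ℕ) {X Y : Affine G} (hX : GenMem A s p X)
    (hY : GenMem A s q Y) (hXY : GenMem A s (p + q) ⁅X, Y⁆) :
    ⁅gen A s p X, gen A s q Y⁆ = gen A s (p + q) ⁅X, Y⁆ :=
  Cx.ext_coord fun b => by
    rw [Cx.coord_lie, coord_gen_comp _ _ _ hX, coord_gen_comp _ _ _ hY, coord_gen_comp _ _ _ hXY,
      single_lie_single, comp_lie]

theorem comp_cpx_not (x : P.pts) (hx) (c : Bool) (p : ℕ) (X : Affine G) :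
    comp (.cpx x hx (!c)) c p X = 0 := if_neg (by cases c <;> simp)

theorem comp_cpx_not' (x : P.pts) (hx) (c : Bool) (p : ℕ) (X : Affine G) :
    comp (.cpx x hx c) (!c) p X = 0 := if_neg (by cases c <;> simp)

/-- Over different marked points the supports are disjoint. Over the same marked point the two
places are `x` and `x̄`, and in each coordinate one of the two generators vanishes. -/
theorem lie_gen_of_ne {s t : Place P} (hst : s ≠ t) (p q : ℕ) {X Y : Affine G}
    (hX : GenMem A s p X) (hY : GenMem A t q Y) : ⁅gen A s p X, gen A t q Y⁆ = 0 :=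
  Cx.ext_coord fun b => by
    rw [Cx.coord_lie, coord_gen_comp _ _ _ hX, coord_gen_comp _ _ _ hY, map_zero]
    by_cases h : s.base = t.base
    · rcases place_eq_of_base_eq h with h | ⟨x, hx, c, rfl, rfl⟩
      · exact absurd h hst
      · by_cases hb : b = c
        · rw [hb, comp_cpx_not, single_zero, lie_zero]
        · obtain rfl : b = !c := by revert hb; cases b <;> cases c <;> simp
          rw [comp_cpx_not', single_zero, zero_lie]
    · exact single_lie_single_of_ne h _ _ _ _

/-- The coordinate of an element at a place. -/
def coeff (s : Place P) (p : ℕ) (ξ : Cx A) : Affine G :=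
  if h : p < s.mult then Cx.coord s.flag ξ s.base ⟨p, h⟩ else 0

theorem coeff_add (s : Place P) (p : ℕ) (ξ η : Cx A) :
    coeff s p (ξ + η) = coeff s p ξ + coeff s p η := by
  unfold coeff
  split_ifs
  · rw [map_add]; rfl
  · rw [add_zero]

theorem coeff_smul (s : Place P) (p : ℕ) (c : ℂ) (ξ : Cx A) :
    coeff s p (c • ξ) = conjIf s.flag c • coeff s p ξ := by
  unfold coeff
  split_ifs
  · rw [Cx.coord_smul]; rfl
  · rw [smul_zero]

-- The functions `coeff s p` are dual to the generators. They serve to read off the `D`-components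
-- on which the level-fixing map acts nontrivially.
open Classical in
theorem coeff_gen (s t : Place P) (p q : ℕ) (hp : p < s.mult) {X : Affine G}
    (hX : GenMem A t q X) : coeff s p (gen A t q X) = if s = t ∧ p = q then X else 0 := by
  unfold coeff
  rw [dif_pos hp, coord_gen_comp _ _ _ hX]
  unfold single
  by_cases h : s.base = t.base
  · rcases place_eq_of_base_eq h with rfl | ⟨x, hx, c, rfl, rfl⟩
    · rw [comp_flag]
      simp
    · have : comp (.cpx x hx (!c)) (Place.flag (.cpx x hx c)) q X = 0 := comp_cpx_not x hx c q X
      rw [this, ite_self, if_neg]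
      rintro ⟨h, -⟩
      revert h; cases c <;> simp
  · rw [if_neg fun h' => h h'.1, if_neg]
    rintro ⟨rfl, -⟩
    exact h rfl

end Poles
end AffineGaudin
end

noncomputable section
open scoped TensorProduct
namespace AffineGaudin

variable {𝔤 : Type*} [LieRing 𝔤] [LieAlgebra ℂ 𝔤] {T : ℕ} {G : DihedralLie 𝔤 T}

/-! ### Projections onto the eigenspaces of `σ`. -/

namespace DihedralLie

variable (G)

/-- `σ` as an endomorphism of the vector space `𝔤`. -/
def σEnd : Module.End ℂ 𝔤 := (G.σ.toLinearEquiv : 𝔤 →ₗ[ℂ] 𝔤)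

theorem σEnd_apply (x : 𝔤) : G.σEnd x = G.σ x := rfl

theorem σEnd_pow_apply (k : ℕ) (x : 𝔤) : (G.σEnd ^ k) x = G.σ^[k] x := by
  rw [Module.End.pow_apply]; rfl

/-- The projection onto an eigenspace of `σ`. -/
def eigProj (z : ℂ) : 𝔤 →ₗ[ℂ] 𝔤 := (T : ℂ)⁻¹ • ∑ k ∈ Finset.range T, z⁻¹ ^ k • G.σEnd ^ k

theorem eigProj_apply (z : ℂ) (x : 𝔤) :
    G.eigProj z x = (T : ℂ)⁻¹ • ∑ k ∈ Finset.range T, z⁻¹ ^ k • (G.σEnd ^ k) x := by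
  simp [eigProj]

theorem T_ne_zero (G : DihedralLie 𝔤 T) : (T : ℂ) ≠ 0 := Nat.cast_ne_zero.mpr G.T_pos.ne'

/-- Applying `σ` shifts the average over its powers cyclically, and `z ^ T = 1` together with `σ ^ T
= 1` closes the cycle. -/
theorem σ_eigProj {z : ℂ} (hz : z ^ T = 1) (x : 𝔤) :
    G.σ (G.eigProj z x) = z • G.eigProj z x := by
  have hz0 : z ≠ 0 := by
    rintro rfl
    rw [zero_pow G.T_pos.ne'] at hz
    exact zero_ne_one hz
  rw [eigProj_apply, map_smul, smul_comm z]
  congr 1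
  rw [map_sum, Finset.smul_sum]
  obtain ⟨t, ht⟩ : ∃ t, T = t + 1 := ⟨T - 1, by have := G.T_pos; omega⟩
  have hσ : (G.σEnd ^ (t + 1)) x = x := by rw [σEnd_pow_apply, ← ht, G.σ_pow]
  have hzt : z ^ (t + 1) = 1 := ht ▸ hz
  have hr : Finset.range T = Finset.range (t + 1) := by rw [ht]
  rw [hr, Finset.sum_range_succ, Finset.sum_range_succ', add_comm]
  rw [add_comm (∑ k ∈ Finset.range t, _)]
  have hs : ∀ k, G.σ ((G.σEnd ^ k) x) = (G.σEnd ^ (k + 1)) x := fun k => by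
    rw [pow_succ']; rfl
  congr 1
  · rw [map_smul, hs, hσ, pow_zero, one_smul, pow_zero, Module.End.one_apply]
    congr 1
    rw [inv_pow, inv_eq_iff_eq_inv]
    exact eq_inv_of_mul_eq_one_left (by rw [← pow_succ, hzt])
  · refine Finset.sum_congr rfl fun k _ => ?_
    rw [map_smul, hs, smul_smul]
    congr 1
    rw [pow_succ', ← mul_assoc, mul_inv_cancel₀ hz0, one_mul]

theorem σEnd_pow_eig {w : ℂ} {y : 𝔤} (hy : G.σ y = w • y) (k : ℕ) :
    (G.σEnd ^ k) y = w ^ k • y := by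
  induction k with
  | zero => simp
  | succ k ih =>
    rw [pow_succ', Module.End.mul_apply, ih, σEnd_apply, map_smul, hy, smul_smul, pow_succ]

theorem eigProj_of_eig {z : ℂ} (hz0 : z ≠ 0) {y : 𝔤} (hy : G.σ y = z • y) :
    G.eigProj z y = y := by
  rw [eigProj_apply]
  have : ∀ k ∈ Finset.range T, z⁻¹ ^ k • (G.σEnd ^ k) y = y := fun k _ => by
    rw [σEnd_pow_eig G hy, smul_smul, ← mul_pow, inv_mul_cancel₀ hz0, one_pow, one_smul]
  rw [Finset.sum_congr rfl this, Finset.sum_const, Finset.card_range, ← Nat.cast_smul_eq_nsmul ℂ,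
    smul_smul, inv_mul_cancel₀ G.T_ne_zero, one_smul]

theorem σEnd_pow_lie (k : ℕ) (x y : 𝔤) :
    (G.σEnd ^ k) ⁅x, y⁆ = ⁅(G.σEnd ^ k) x, (G.σEnd ^ k) y⁆ := by
  induction k with
  | zero => rfl
  | succ k ih =>
    rw [pow_succ', Module.End.mul_apply, ih, σEnd_apply, LieEquiv.map_lie]; rfl

/-- Termwise, `σᵏ[x, y] = wᵏ [σᵏ x, y]`, and the factor `wᵏ` is absorbed in the weight of the
average. Only `y` has to be an eigenvector. -/
theorem eigProj_lie {z w : ℂ} (hw : w ≠ 0) (x : 𝔤) {y : 𝔤} (hy : G.σ y = w • y) :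
    ⁅G.eigProj z x, y⁆ = G.eigProj (z * w) ⁅x, y⁆ := by
  rw [eigProj_apply, eigProj_apply, smul_lie, sum_lie]
  congr 1
  refine Finset.sum_congr rfl fun k _ => ?_
  rw [σEnd_pow_lie, σEnd_pow_eig G hy, lie_smul, smul_smul, smul_lie, ← mul_pow, mul_inv, mul_assoc,
    inv_mul_cancel₀ hw, mul_one]

/-- Invariance gives `⟨σᵏ x, y⟩ = w⁻ᵏ ⟨x, y⟩`, so the average becomes a geometric sum in `(z w)⁻¹`,
a `T`-th root of unity. -/
theorem form_eigProj {z w : ℂ} (hz : z ^ T = 1) (hw : w ^ T = 1) (x : 𝔤) {y : 𝔤}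
    (hy : G.σ y = w • y) : G.form (G.eigProj z x) y = if z * w = 1 then G.form x y else 0 := by
  have hw0 : w ≠ 0 := by
    rintro rfl
    rw [zero_pow G.T_pos.ne'] at hw
    exact zero_ne_one hw
  have h1 : ∀ k, G.form ((G.σEnd ^ k) x) ((G.σEnd ^ k) y) = G.form x y := by
    intro k
    induction k with
    | zero => rfl
    | succ k ih => rw [pow_succ', Module.End.mul_apply, Module.End.mul_apply, σEnd_apply,
        σEnd_apply, form_σ, ih]
  have h2 : ∀ k, G.form ((G.σEnd ^ k) x) y = w⁻¹ ^ k * G.form x y := by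
    intro k
    have := h1 k
    rw [σEnd_pow_eig G hy, map_smul, smul_eq_mul] at this
    rw [← this, ← mul_assoc, ← mul_pow, inv_mul_cancel₀ hw0, one_pow, one_mul]
  rw [eigProj_apply, map_smul, map_sum, LinearMap.smul_apply, LinearMap.sum_apply]
  have h3 : ∀ k ∈ Finset.range T, G.form (z⁻¹ ^ k • (G.σEnd ^ k) x) y =
      (z * w)⁻¹ ^ k * G.form x y := fun k _ => by
    rw [map_smul, LinearMap.smul_apply, h2, smul_eq_mul, ← mul_assoc, ← mul_pow, mul_inv]
  rw [Finset.sum_congr rfl h3, ← Finset.sum_mul]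
  split_ifs with h
  · rw [h]
    simp [G.T_ne_zero]
  · rw [geom_sum_eq (by rwa [Ne, inv_eq_one]), inv_pow, mul_pow, hz, hw]
    simp

end DihedralLie

open DihedralLie

namespace Affine

theorem mono_injective (m : ℤ) {x y : 𝔤} (h : (mono m x : Affine G) = mono m y) : x = y := by
  have := congrArg (fun X : Affine G => loopCoeff X.loop m) h
  simpa [loopCoeff_mono] using this

theorem mono_zero (m : ℤ) : (mono m 0 : Affine G) = 0 := by
  have := smul_mono (G := G) 0 m (0 : 𝔤)
  rwa [zero_smul, zero_smul, eq_comm] at this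

theorem affσ_mono (m : ℤ) (x : 𝔤) : G.affσ (mono m x) = mono m (G.σ x) := by
  ext1
  · exact G.loopσ_mono m x
  · rfl
  · rfl

theorem affσ_K : G.affσ K = K := by
  ext1
  · exact map_zero _
  · rfl
  · rfl

theorem affσ_D : G.affσ D = D := by
  ext1
  · exact map_zero _
  · rfl
  · rfl

theorem loopCoeff_loopσ (f : Loop 𝔤) (m : ℤ) :
    loopCoeff (G.loopσ f) m = G.σ (loopCoeff f m) := by
  induction f using loop_induction with
  | h0 => simp
  | hadd f g hf hg => simp only [map_add, Finsupp.add_apply, hf, hg]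
  | h n x =>
    rw [loopσ_mono, loopCoeff_mono, loopCoeff_mono, Finsupp.single_apply, Finsupp.single_apply]
    split_ifs <;> simp

/-- The projection of the affine algebra which removes the component of `D`. -/
def drop (X : Affine G) : Affine G := ⟨X.loop, X.k, 0⟩

theorem drop_of_d (X : Affine G) (h : X.d = 0) : X.drop = X := by
  ext1
  · rfl
  · rfl
  · exact h.symm

theorem drop_zero : drop (0 : Affine G) = 0 := rfl

theorem drop_add (X Y : Affine G) : drop (X + Y) = drop X + drop Y := by
  ext1
  · rfl
  · rfl
  · exact (add_zero 0).symm

theorem drop_smul (c : ℂ) (X : Affine G) : drop (c • X) = c • drop X := by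
  ext1
  · rfl
  · rfl
  · exact (mul_zero c).symm

theorem drop_act (k : ℕ) (b : Bool) (X : Affine G) : drop (G.act k b X) = G.act k b (drop X) := by
  have h : ∀ Y : Affine G, drop (G.affσ^[k] Y) = G.affσ^[k] (drop Y) := by
    intro Y
    induction k generalizing Y with
    | zero => rfl
    | succ k ih => rw [Function.iterate_succ_apply, ih, Function.iterate_succ_apply]; rfl
  unfold act
  rw [h]
  cases b
  · rfl
  · congr 1
    ext1
    · rfl
    · rfl
    · change 0 = -starRingEnd ℂ 0
      simp

end Affine

namespace Poles

variable {P : Poles G}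

/-! ### Exponents, grades and homogeneity at the different kinds of places. -/

namespace Place

open Classical in
/-- The least exponent at a place. -/
def lo (s : Place P) : ℕ := if s.point = OnePoint.infty then 1 else 0

theorem exps_eq (s : Place P) : s.exps = Finset.Ico s.lo s.mult := by
  unfold exps lo
  split_ifs
  · rfl
  · rw [Finset.range_eq_Ico]

theorem mem_exps {s : Place P} {p : ℕ} : p ∈ s.exps ↔ s.lo ≤ p ∧ p < s.mult := by
  rw [exps_eq, Finset.mem_Ico]

theorem add_mem_exps {s : Place P} {p q : ℕ} (hp : p ∈ s.exps) (h : p + q < s.mult) :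
    p + q ∈ s.exps := by
  rw [mem_exps] at hp ⊢
  omega

variable (G) in
/-- The eigenvalue of `σ` attached to `ε ^ p` at a fixed point. -/
def root (x : OnePoint ℂ) (p : ℕ) : ℂ := G.ω ^ (grade (T := T) x p).val

variable (G) in
theorem root_pow (x : OnePoint ℂ) (p : ℕ) : root G x p ^ T = 1 := by
  unfold root
  rw [← pow_mul, mul_comm, pow_mul, G.ω_prim.pow_eq_one, one_pow]

variable (G) in
theorem root_ne_zero (x : OnePoint ℂ) (p : ℕ) : root G x p ≠ 0 := pow_ne_zero _ G.ω_ne_zero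

variable (G) in
theorem root_add (x : OnePoint ℂ) (p q : ℕ) : root G x (p + q) = root G x p * root G x q := by
  have : NeZero T := ⟨G.T_pos.ne'⟩
  have e : grade (T := T) x (p + q) = grade (T := T) x p + grade (T := T) x q := by
    unfold grade
    split_ifs <;> push_cast <;> ring
  unfold root
  rw [e, ZMod.val_add, ← pow_eq_pow_mod _ G.ω_prim.pow_eq_one, pow_add]

variable (G) in
theorem root_eq_one_iff (x : OnePoint ℂ) (p : ℕ) : root G x p = 1 ↔ T ∣ p := by
  have : NeZero T := ⟨G.T_pos.ne'⟩
  unfold root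
  rw [G.ω_prim.pow_eq_one_iff_dvd]
  have h : T ∣ (grade (T := T) x p).val ↔ grade (T := T) x p = 0 := by
    rw [← ZMod.val_eq_zero]
    exact ⟨fun h => Nat.eq_zero_of_dvd_of_lt h (ZMod.val_lt _), fun h => h ▸ dvd_zero _⟩
  rw [h]
  unfold grade
  split_ifs
  · rw [neg_eq_zero, ZMod.natCast_eq_zero_iff]
  · rw [ZMod.natCast_eq_zero_iff]

/-- At a fixed point, `x` belongs to the eigenspace of `σ` attached to `ε ^ p`. -/
def IsHomog : Place P → ℕ → 𝔤 → Prop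
  | .fixed y _, p, x => G.σ x = root G y p • x
  | _, _, _ => True

/-- At a fixed point, `p` is a multiple of `T`. -/
def Div : Place P → ℕ → Prop
  | .fixed _ _, p => T ∣ p
  | _, _ => True

/-- At a fixed point, the projection onto the eigenspace of `σ` attached to `ε ^ p`. -/
def proj : Place P → ℕ → 𝔤 →ₗ[ℂ] 𝔤
  | .fixed y _, p => G.eigProj (root G y p)
  | _, _ => LinearMap.id

theorem isHomog_proj (s : Place P) (p : ℕ) (x : 𝔤) : s.IsHomog p (s.proj p x) := by
  match s with
  | .fixed y _ => exact G.σ_eigProj (root_pow G y p) x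
  | .cpx .. => trivial
  | .real .. => trivial

theorem IsHomog.proj_eq {s : Place P} {p : ℕ} {x : 𝔤} (h : s.IsHomog p x) : s.proj p x = x := by
  match s with
  | .fixed y _ => exact G.eigProj_of_eig (root_ne_zero G y p) h
  | .cpx .. => rfl
  | .real .. => rfl

/-- Together with `form_proj`, this allows brackets of a projected element with a homogeneous one to
be computed without a decomposition of `x`. -/
theorem proj_lie (s : Place P) (p q : ℕ) (x : 𝔤) {y : 𝔤} (h : s.IsHomog q y) :
    ⁅s.proj p x, y⁆ = s.proj (p + q) ⁅x, y⁆ := by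
  match s with
  | .fixed z _ =>
    change _ = G.eigProj (root G z (p + q)) _
    rw [root_add]
    exact G.eigProj_lie (root_ne_zero G z q) x h
  | .cpx .. => rfl
  | .real .. => rfl

open Classical in
theorem form_proj (s : Place P) (p q : ℕ) (x : 𝔤) {y : 𝔤} (h : s.IsHomog q y) :
    G.form (s.proj p x) y = if s.Div (p + q) then G.form x y else 0 := by
  match s with
  | .fixed z hz =>
    have := G.form_eigProj (root_pow G z p) (root_pow G z q) x h
    rw [← root_add] at this
    refine this.trans ?_
    simp only [root_eq_one_iff]
    congr
  | .cpx .. => exact (if_pos trivial).symm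
  | .real .. => exact (if_pos trivial).symm

theorem proj_add_of_div {s : Place P} {r : ℕ} (h : s.Div r) (p : ℕ) :
    s.proj (r + p) = s.proj p := by
  match s with
  | .fixed z hz =>
    change G.eigProj (root G z (r + p)) = G.eigProj (root G z p)
    rw [root_add, (root_eq_one_iff G z r).mpr h, one_mul]
  | .cpx .. => rfl
  | .real .. => rfl

theorem allowed_mono {s : Place P} {p : ℕ} {m : ℤ} {x : 𝔤} :
    s.Allowed p (Affine.mono m x : Affine G) ↔ p ∈ s.exps ∧ s.IsHomog p x := by
  match s with
  | .fixed y hy =>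
    refine and_congr_right fun _ => ?_
    change G.affσ (Affine.mono m x) = root G y p • Affine.mono m x ↔ G.σ x = root G y p • x
    rw [Affine.affσ_mono, Affine.smul_mono]
    exact ⟨fun h => Affine.mono_injective m h, fun h => by rw [h]⟩
  | .cpx .. => exact Iff.rfl
  | .real .. => exact Iff.rfl

theorem allowed_of_fixed {s : Place P} {p : ℕ} {X : Affine G} (hX : G.affσ X = X)
    (h1 : p ∈ s.exps) (h2 : s.Div p) : s.Allowed p X := by
  refine ⟨h1, ?_⟩
  match s with
  | .fixed y hy =>
    change G.affσ X = root G y p • X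
    rw [hX, (root_eq_one_iff G y p).mpr h2, one_smul]
  | .cpx .. => trivial
  | .real .. => trivial

/-- `σ` fixes `K` and `D`, so a nonzero component along either forces the eigenvalue attached to `ε
^ p` to be `1`, that is, `T ∣ p`. -/
theorem div_of_allowed {s : Place P} {p : ℕ} {X : Affine G}
    (h : s.Allowed p X) (h0 : X.k ≠ 0 ∨ X.d ≠ 0) : s.Div p := by
  match s with
  | .fixed y hy =>
    have h : G.affσ X = root G y p • X := h.2
    refine (root_eq_one_iff G y p).mp ?_
    rcases h0 with h0 | h0
    · have : X.k = root G y p * X.k := congrArg Affine.k h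
      exact mul_right_cancel₀ h0 (by rw [← this, one_mul])
    · have : X.d = root G y p * X.d := congrArg Affine.d h
      exact mul_right_cancel₀ h0 (by rw [← this, one_mul])
  | .cpx .. => trivial
  | .real .. => trivial

theorem allowed_K {s : Place P} {p : ℕ} :
    s.Allowed p (Affine.K : Affine G) ↔ p ∈ s.exps ∧ s.Div p :=
  ⟨fun h => ⟨h.1, div_of_allowed h (Or.inl one_ne_zero)⟩,
    fun h => allowed_of_fixed Affine.affσ_K h.1 h.2⟩

theorem allowed_D {s : Place P} {p : ℕ} :
    s.Allowed p (Affine.D : Affine G) ↔ p ∈ s.exps ∧ s.Div p :=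
  ⟨fun h => ⟨h.1, div_of_allowed h (Or.inr one_ne_zero)⟩,
    fun h => allowed_of_fixed Affine.affσ_D h.1 h.2⟩

theorem Allowed.add {s : Place P} {p : ℕ} {X Y : Affine G} (hX : s.Allowed p X)
    (hY : s.Allowed p Y) : s.Allowed p (X + Y) := by
  refine ⟨hX.1, ?_⟩
  match s with
  | .fixed y hy =>
    have h1 : G.affσ X = root G y p • X := hX.2
    have h2 : G.affσ Y = root G y p • Y := hY.2
    change G.affσ (X + Y) = root G y p • (X + Y)
    rw [map_add, h1, h2, smul_add]
  | .cpx .. => trivial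
  | .real .. => trivial

theorem Allowed.smul {s : Place P} {p : ℕ} {X : Affine G} (c : ℂ) (hX : s.Allowed p X) :
    s.Allowed p (c • X) := by
  refine ⟨hX.1, ?_⟩
  match s with
  | .fixed y hy =>
    have h1 : G.affσ X = root G y p • X := hX.2
    change G.affσ (c • X) = root G y p • (c • X)
    rw [G.affσ_smul, h1, smul_comm]
  | .cpx .. => trivial
  | .real .. => trivial

theorem Allowed.loop {s : Place P} {p : ℕ} {X : Affine G} (hX : s.Allowed p X) (m : ℤ) :
    s.Allowed p (Affine.mono m (loopCoeff X.loop m) : Affine G) := by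
  rw [allowed_mono]
  refine ⟨hX.1, ?_⟩
  match s with
  | .fixed y hy =>
    have h1 : G.affσ X = root G y p • X := hX.2
    change G.σ _ = root G y p • _
    have h2 : G.loopσ X.loop = root G y p • X.loop := congrArg Affine.loop h1
    rw [← Affine.loopCoeff_loopσ, h2, map_smul, Finsupp.smul_apply]
  | .cpx .. => trivial
  | .real .. => trivial

theorem Allowed.lie {s : Place P} {p q : ℕ} {X Y : Affine G} (hX : s.Allowed p X)
    (hY : s.Allowed q Y) (h : p + q < s.mult) : s.Allowed (p + q) ⁅X, Y⁆ := by
  refine ⟨add_mem_exps hX.1 h, ?_⟩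
  match s with
  | .fixed y hy =>
    have h1 : G.affσ X = root G y p • X := hX.2
    have h2 : G.affσ Y = root G y q • Y := hY.2
    change G.affσ ⁅X, Y⁆ = root G y (p + q) • ⁅X, Y⁆
    rw [G.affσ_lie, h1, h2, root_add, smul_lie, lie_smul, smul_smul]
  | .cpx .. => trivial
  | .real .. => trivial

theorem Allowed.zero {s : Place P} {p : ℕ} (hp : p ∈ s.exps) : s.Allowed p (0 : Affine G) := by
  refine ⟨hp, ?_⟩
  match s with
  | .fixed y hy =>
    change G.affσ 0 = _ • 0
    rw [map_zero, smul_zero]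
  | .cpx .. => trivial
  | .real .. => trivial

theorem Allowed.mem_tilde {s : Place P} {p : ℕ} {X : Affine G} (hX : s.Allowed p X) :
    GenMem P.tilde s p X := gen_mem_tilde s p X hX

theorem Allowed.mem_hat {s : Place P} {p : ℕ} {X : Affine G} (hX : s.Allowed p X)
    (h : X.d = 0) : GenMem P.hat s p X := gen_mem_hat s p X hX h

end Place

open Place

/-! ### The generators span the complexified algebra. -/

open Classical in
/-- The elements `X ⊗ ε ^ p` of the real Lie algebra are generators or sums of two generators. -/
theorem tmul_single_mem {C : Cx P.tilde → Prop} (h0 : C 0)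
    (hadd : ∀ ξ η, C ξ → C η → C (ξ + η))
    (hgen : ∀ (s : Place P) p X, s.Allowed p X → C (gen P.tilde s p X))
    (a : P.tilde) (x : P.pts) (p : Fin (P.mult x))
    (h : single x p (a.1 x p) ∈ P.tilde) : C (Cx.tmul 1 ⟨single x p (a.1 x p), h⟩) := by
  have ha : ∀ k b, G.mobius k b x = x → takiffAct x k b (a.1 x) p = a.1 x p := fun k b hk =>
    congrFun ((a.2 x).1 k b hk) p
  have hcoord : ∀ b, Cx.coord b (Cx.tmul 1 ⟨single x p (a.1 x p), h⟩ : Cx P.tilde) =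
      single x p (a.1 x p) := fun b => by rw [Cx.coord_tmul, map_one, one_smul]
  by_cases hf : (x : OnePoint ℂ) = ((0 : ℂ) : OnePoint ℂ) ∨ (x : OnePoint ℂ) = OnePoint.infty
  · have hmob : ∀ k b, G.mobius k b x = x := by
      intro k b
      rcases hf with hf | hf
      · rw [hf, mobius_coe]; simp
      · rw [hf]; rfl
    by_cases hp : (x : OnePoint ℂ) = OnePoint.infty ∧ (p : ℕ) = 0
    · have h1 : a.1 x p = 0 := (a.2 x).2 hp.1 p hp.2
      have e : (Cx.tmul 1 ⟨single x p (a.1 x p), h⟩ : Cx P.tilde) = 0 :=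
        Cx.ext_coord fun b => by rw [hcoord, h1, single_zero, map_zero]
      rw [e]; exact h0
    · have hpe : (p : ℕ) ∈ (Place.fixed x hf).exps := by
        rw [mem_exps]
        refine ⟨?_, p.2⟩
        unfold lo
        split_ifs with h
        · have h : (x : OnePoint ℂ) = OnePoint.infty := h
          exact Nat.one_le_iff_ne_zero.mpr fun h' => hp ⟨h, h'⟩
        · exact Nat.zero_le _
      have hall : (Place.fixed x hf).Allowed p (a.1 x p) := by
        refine ⟨hpe, ?_⟩
        change G.affσ (a.1 x p) = root G x p • a.1 x p
        -- Invariance under the rotation says that `σ` acts on the coefficient by the inverse of its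
        -- action on `ε ^ p`, which is the grade condition.
        have h1 := ha 1 false (hmob 1 false)
        unfold takiffAct at h1
        have h2 : G.act 1 false (a.1 x p) = G.affσ (a.1 x p) := rfl
        rw [h2, pow_one] at h1
        conv_rhs => rw [← h1, smul_smul]
        suffices hroot : root G x p *
            (if (x : OnePoint ℂ) = OnePoint.infty then G.ω else G.ω⁻¹) ^ (p : ℕ) = 1 by
          rw [hroot, one_smul]
        have : NeZero T := ⟨G.T_pos.ne'⟩
        unfold root Place.grade
        split_ifs with hi
        · rw [← pow_add, G.ω_prim.pow_eq_one_iff_dvd, ← ZMod.natCast_eq_zero_iff, Nat.cast_add,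
            ZMod.natCast_zmod_val, neg_add_cancel]
        · rw [ZMod.val_natCast, ← pow_eq_pow_mod _ G.ω_prim.pow_eq_one, ← mul_pow,
            mul_inv_cancel₀ G.ω_ne_zero, one_pow]
      -- The coefficient is fixed by `τ`, so both coordinates of the generator equal the coefficient
      -- itself.
      have e : (Cx.tmul 1 ⟨single x p (a.1 x p), h⟩ : Cx P.tilde) =
          gen P.tilde (.fixed x hf) p (a.1 x p) := Cx.ext_coord fun b => by
        rw [hcoord, coord_gen_comp _ _ _ hall.mem_tilde]
        cases b
        · rfl
        · have h1 := ha 0 true (hmob 0 true)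
          unfold takiffAct at h1
          rw [pow_zero, one_pow, one_smul] at h1
          exact congrArg (single x p) h1.symm
      rw [e]; exact hgen _ _ _ hall
  · obtain ⟨hx0, hxi⟩ := not_or.mp hf
    have hlo : ∀ s : Place P, s.base = x → s.flag = false → (p : ℕ) ∈ s.exps := by
      intro s hs hs'
      have hpt : s.point = x := by
        match s with
        | .cpx y _ true => exact absurd (show true = false from hs') (by decide)
        | .cpx y _ false => rw [← hs]; rfl
        | .real .. => rw [← hs]; rfl
        | .fixed .. => rw [← hs]; rfl
      rw [mem_exps]
      unfold lo
      rw [hpt, if_neg hxi]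
      refine ⟨Nat.zero_le _, ?_⟩
      have : s.mult = P.mult x := by rw [← hs]; rfl
      rw [this]; exact p.2
    have hpt' : ∀ y hy, y = x → (p : ℕ) ∈ (Place.cpx (P := P) y hy true).exps := by
      rintro y hy rfl
      rw [mem_exps]
      unfold lo
      rw [if_neg]
      · exact ⟨Nat.zero_le _, p.2⟩
      · intro h
        obtain ⟨w, hw⟩ : ∃ w : ℂ, (w : OnePoint ℂ) = y := OnePoint.ne_infty_iff_exists.mp hxi
        change OnePoint.map (starRingEnd ℂ) (y : OnePoint ℂ) = _ at h
        rw [← hw] at h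
        exact OnePoint.coe_ne_infty _ h
    by_cases hr : ∃ k, G.mobius k true x = x
    · obtain ⟨k, hk⟩ := hr
      have hk' : G.mobius (k % T) true x = x := by
        rw [← show G.mobius k true = G.mobius (k % T) true by
          unfold mobius
          rw [← pow_eq_pow_mod _ G.ω_prim.pow_eq_one]]
        exact hk
      set s : Place P := .real x (k % T) (Nat.mod_lt _ G.T_pos) hx0 hxi hk' with hs
      have hall : s.Allowed p (a.1 x p) := ⟨hlo s rfl rfl, trivial⟩
      have e : (Cx.tmul 1 ⟨single x p (a.1 x p), h⟩ : Cx P.tilde) =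
          gen P.tilde s p (a.1 x p) := Cx.ext_coord fun b => by
        rw [hcoord, coord_gen_comp _ _ _ hall.mem_tilde]
        cases b
        · rfl
        · have h1 := ha (k % T) true hk'
          unfold takiffAct at h1
          rw [if_neg hxi] at h1
          exact congrArg (single x p) h1.symm
      rw [e]; exact hgen _ _ _ hall
    · have hc : ∀ k b, G.mobius k b x = x → b = false ∧ T ∣ k := by
        intro k b hk
        cases b
        · refine ⟨rfl, ?_⟩
          obtain ⟨w, hw⟩ : ∃ w : ℂ, (w : OnePoint ℂ) = x := OnePoint.ne_infty_iff_exists.mp hxi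
          have hw0 : w ≠ 0 := fun h => hx0 (by rw [← hw, h])
          rw [← hw, mobius_coe, OnePoint.coe_eq_coe] at hk
          rw [← G.ω_prim.pow_eq_one_iff_dvd]
          exact mul_right_cancel₀ hw0 (hk.trans (one_mul w).symm)
        · exact absurd ⟨k, hk⟩ hr
      have hall : ∀ c, (Place.cpx (P := P) x hc c).Allowed p (a.1 x p) := by
        intro c
        refine ⟨?_, trivial⟩
        cases c
        · exact hlo _ rfl rfl
        · exact hpt' x hc rfl
      -- At a complex point the real element has the same entry in both coordinates; the generators
      -- at `x` and `x̄` supply one each.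
      have e : (Cx.tmul 1 ⟨single x p (a.1 x p), h⟩ : Cx P.tilde) =
          gen P.tilde (.cpx x hc false) p (a.1 x p) + gen P.tilde (.cpx x hc true) p (a.1 x p) :=
        Cx.ext_coord fun b => by
          rw [hcoord, map_add, coord_gen_comp _ _ _ (hall false).mem_tilde,
            coord_gen_comp _ _ _ (hall true).mem_tilde]
          change single x p (a.1 x p) = single x p (comp (.cpx x hc false) b p (a.1 x p)) +
            single x p (comp (.cpx x hc true) b p (a.1 x p))
          cases b <;> simp [comp, single_zero]
      rw [e]; exact hadd _ _ (hgen _ _ _ (hall false)) (hgen _ _ _ (hall true))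

theorem single_coord_mem (a : P.tilde) (x : P.pts) (p : Fin (P.mult x)) :
    single x p (a.1 x p) ∈ P.tilde := by
  by_cases h0 : a.1 x p = 0
  · rw [h0, single_zero]; exact zero_mem _
  refine single_mem_tilde x p _ (fun hi k b hk => ?_) fun hi => ⟨fun hp => h0 ((a.2 x).2 hi p hp),
    fun k b => ?_⟩
  · have := congrFun ((a.2 x).1 k b hk) p
    unfold takiffAct at this
    rwa [if_neg hi] at this
  · have := congrFun ((a.2 x).1 k b (by rw [hi]; rfl)) p
    unfold takiffAct at this
    rwa [if_pos hi] at this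

/-- The elements `X ⊗ ε ^ p` span the real Lie algebra. -/
theorem tilde_eq_sum (a : P.tilde) :
    a = ∑ x : P.pts, ∑ p : Fin (P.mult x), ⟨_, single_coord_mem a x p⟩ := by
  apply Subtype.ext
  refine TakiffSum.ext fun y q => ?_
  have hs : ∀ (ι : Type _) (s : Finset ι) (f : ι → P.tilde),
      (∑ i ∈ s, f i : P.tilde).1 y q = ∑ i ∈ s, (f i).1 y q := fun ι s f =>
    map_sum (⟨⟨fun a => a.1 y q, rfl⟩, fun _ _ => rfl⟩ : P.tilde →+ Affine G) f s
  rw [hs, Finset.sum_eq_single y, hs, Finset.sum_eq_single q]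
  · exact (if_pos ⟨rfl, rfl⟩).symm
  · intro p _ hp
    exact if_neg fun h => hp (Fin.ext h.2.symm)
  · exact fun h => absurd (Finset.mem_univ _) h
  · intro x _ hx
    rw [hs]
    exact Finset.sum_eq_zero fun p _ => if_neg fun h => hx h.1.symm
  · exact fun h => absurd (Finset.mem_univ _) h

/-- The span property in the form in which it is used: a property stable under linear combinations
need only be checked on the three families of generators. -/
theorem gen_induction {C : Cx P.tilde → Prop} (h0 : C 0)
    (hadd : ∀ ξ η, C ξ → C η → C (ξ + η)) (hsmul : ∀ (c : ℂ) ξ, C ξ → C (c • ξ))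
    (hloop : ∀ (s : Place P) p m x, s.Allowed p (Affine.mono m x : Affine G) →
      C (gen P.tilde s p (Affine.mono m x)))
    (hK : ∀ (s : Place P) p, s.Allowed p (Affine.K : Affine G) → C (gen P.tilde s p Affine.K))
    (hD : ∀ (s : Place P) p, s.Allowed p (Affine.D : Affine G) → C (gen P.tilde s p Affine.D))
    (ξ : Cx P.tilde) : C ξ := by
  have hgen : ∀ (s : Place P) p X, s.Allowed p X → C (gen P.tilde s p X) := by
    intro s p X hX
    -- Admissibility is needed for `c ≠ 0` only. For an exponent with `T ∤ p` at a fixed point, `K`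
    -- and `D` are not admissible, but then their coefficients in `X` are zero.
    have smul_case : ∀ (c : ℂ) (Y : Affine G), (c ≠ 0 → s.Allowed p Y ∧ C (gen P.tilde s p Y)) →
        s.Allowed p (c • Y) ∧ C (gen P.tilde s p (c • Y)) := by
      intro c Y hY
      by_cases hc : c = 0
      · rw [hc, zero_smul, gen_zero]
        exact ⟨Allowed.zero hX.1, h0⟩
      · obtain ⟨h1, h2⟩ := hY hc
        refine ⟨h1.smul c, ?_⟩
        rw [gen_smul s p c h1.mem_tilde (h1.smul c).mem_tilde]
        exact hsmul _ _ h2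
    have add_case : ∀ Y Z : Affine G, s.Allowed p Y ∧ C (gen P.tilde s p Y) →
        s.Allowed p Z ∧ C (gen P.tilde s p Z) →
        s.Allowed p (Y + Z) ∧ C (gen P.tilde s p (Y + Z)) := by
      rintro Y Z ⟨h1, h2⟩ ⟨h3, h4⟩
      refine ⟨h1.add h3, ?_⟩
      rw [gen_add s p h1.mem_tilde h3.mem_tilde (h1.add h3).mem_tilde]
      exact hadd _ _ h2 h4
    rw [X.eq_sum]
    refine (add_case _ _ (add_case _ _ ?_ (smul_case _ _ fun hk => ?_))
      (smul_case _ _ fun hd => ?_)).2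
    · induction (loopCoeff X.loop).support using Finset.induction_on with
      | empty =>
        rw [Finset.sum_empty, gen_zero]
        exact ⟨Allowed.zero hX.1, h0⟩
      | insert m t hm ih =>
        rw [Finset.sum_insert hm]
        exact add_case _ _ ⟨hX.loop m, hloop s p m _ (hX.loop m)⟩ ih
    · have := allowed_K.mpr ⟨hX.1, div_of_allowed hX (Or.inl hk)⟩
      exact ⟨this, hK s p this⟩
    · have := allowed_D.mpr ⟨hX.1, div_of_allowed hX (Or.inr hd)⟩
      exact ⟨this, hD s p this⟩
  induction ξ using Cx.induction with
  | h0 => exact h0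
  | hadd ξ η h h' => exact hadd _ _ h h'
  | h u a =>
    have e : Cx.tmul u a = u • Cx.tmul 1 a := by rw [Cx.smul_tmul', mul_one]
    rw [e]
    refine hsmul _ _ ?_
    have hs : ∀ (ι : Type _) (s : Finset ι) (f : ι → P.tilde),
        (∀ i ∈ s, C (Cx.tmul 1 (f i))) → C (Cx.tmul 1 (∑ i ∈ s, f i)) := by
      intro ι s f h
      classical
      induction s using Finset.induction_on with
      | empty => rw [Finset.sum_empty, Cx.tmul_zero]; exact h0
      | insert i s hi ih =>
        rw [Finset.sum_insert hi, Cx.tmul_add]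
        exact hadd _ _ (h i (Finset.mem_insert_self i s))
          (ih fun j hj => h j (Finset.mem_insert_of_mem hj))
    rw [tilde_eq_sum a]
    exact hs _ _ _ fun x _ => hs _ _ _ fun p _ => tmul_single_mem h0 hadd hgen a x p _

/-! ### Removing the components along `D`. -/

/-- The projection from `𝔤̃^𝒟` to `𝔤̂^𝒟` which removes the components of `D`. -/
def dropReal : P.tilde →ₗ[ℝ] P.hat where
  toFun a := ⟨fun x p => (a.1 x p).drop, fun x => ⟨fun k b hk => funext fun p => by
      have := congrFun ((a.2 x).1 k b hk) p
      unfold takiffAct at this ⊢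
      rw [← Affine.drop_act, ← Affine.drop_smul, this],
    fun hx p hp => congrArg Affine.drop ((a.2 x).2 hx p hp)⟩, fun _ _ => rfl⟩
  map_add' a b := Subtype.ext (TakiffSum.ext fun x p => Affine.drop_add _ _)
  map_smul' r a := Subtype.ext (TakiffSum.ext fun x p => by
    change Affine.drop (r • a.1 x p) = r • Affine.drop (a.1 x p)
    rw [← Complex.coe_smul, ← Complex.coe_smul, Affine.drop_smul])

/-- The complexification of `dropReal`. -/
def dropCx : Cx P.tilde →ₗ[ℂ] Cx P.hat := LinearMap.baseChange ℂ (dropReal (P := P))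

theorem dropCx_tmul (u : ℂ) (a : P.tilde) : dropCx (Cx.tmul u a) = Cx.tmul u (dropReal a) := rfl

theorem coord_dropCx (b : Bool) (ξ : Cx P.tilde) (x : P.pts) (p : Fin (P.mult x)) :
    Cx.coord b (dropCx ξ) x p = (Cx.coord b ξ x p).drop := by
  induction ξ using Cx.induction with
  | h0 => simp only [map_zero, TakiffSum.zero_apply, Affine.drop_zero]
  | hadd ξ η h h' => simp only [map_add, TakiffSum.add_apply, h, h', Affine.drop_add]
  | h u a =>
    rw [dropCx_tmul, Cx.coord_tmul, Cx.coord_tmul, TakiffSum.smul_apply, TakiffSum.smul_apply,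
      Affine.drop_smul]
    rfl

theorem dropCx_gen {s : Place P} {p : ℕ} {X : Affine G} (h : s.Allowed p X) (hd : X.d = 0) :
    dropCx (gen P.tilde s p X) = gen P.hat s p X :=
  Cx.ext_coord fun b => TakiffSum.ext fun x q => by
    rw [coord_dropCx, coord_gen_comp _ _ _ h.mem_tilde, coord_gen_comp _ _ _ (h.mem_hat hd)]
    unfold single
    split_ifs
    · exact Affine.drop_of_d _ (comp_d s b p X hd)
    · rfl

theorem dropCx_gen_D {s : Place P} {p : ℕ} (h : s.Allowed p (Affine.D : Affine G)) :
    dropCx (gen P.tilde s p Affine.D) = 0 := by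
  have hσ : ∀ k, G.affσ^[k] (Affine.D : Affine G) = Affine.D := fun k =>
    Function.iterate_fixed Affine.affσ_D k
  have hτ : G.affτ (Affine.D : Affine G) = (-1 : ℂ) • Affine.D := by
    ext1
    · change G.loopτ 0 = (-1 : ℂ) • 0
      simp
    · change -starRingEnd ℂ 0 = -1 * 0
      simp
    · change -starRingEnd ℂ 1 = -1 * 1
      simp
  have hD : (Affine.D : Affine G).drop = 0 := rfl
  have hD' : ∀ b, (comp s b p (Affine.D : Affine G)).drop = 0 := by
    intro b
    match s, b with
    | .cpx _ _ c, b =>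
      simp only [comp]
      split_ifs <;> rfl
    | .real .., false => rfl
    | .real x k hk h0 hi h, true =>
      simp only [comp, twist]
      rw [Affine.drop_smul, Affine.drop_act, hD, G.act_zero, smul_zero]
    | .fixed .., false => rfl
    | .fixed .., true =>
      simp only [comp, twist]
      rw [hτ, Affine.drop_smul, hD, smul_zero]
  refine Cx.ext_coord fun b => TakiffSum.ext fun x q => ?_
  rw [coord_dropCx, coord_gen_comp _ _ _ h.mem_tilde, map_zero]
  unfold single
  split_ifs
  · exact hD' b
  · rfl

end Poles
end AffineGaudin
end

noncomputable section
open scoped TensorProduct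
namespace AffineGaudin

variable {𝔤 : Type*} [LieRing 𝔤] [LieAlgebra ℂ 𝔤] {T : ℕ} {G : DihedralLie 𝔤 T}

/-! ### Dual bases and invariance of the Casimir element. -/

namespace DualBases

variable (B : DualBases G)

theorem form_comm (G : DihedralLie 𝔤 T) (x y : 𝔤) : G.form x y = G.form y x := G.form_symm.eq x y

theorem eq_sum_I (x : 𝔤) : x = ∑ a, G.form x (B.I' a) • B.I a := by
  conv_lhs => rw [← B.I.sum_repr x]
  refine Finset.sum_congr rfl fun a _ => ?_
  have h : G.form (∑ b, B.I.repr x b • B.I b) (B.I' a) = B.I.repr x a := by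
    rw [map_sum, LinearMap.sum_apply]
    simp only [map_smul, LinearMap.smul_apply, B.dual]
    simp
  rw [← h, B.I.sum_repr]

/-- The family `I'` is not assumed to be a basis. The difference of the two sides pairs to zero with
every element, and the form is nondegenerate. -/
theorem eq_sum_I' (x : 𝔤) : x = ∑ a, G.form (B.I a) x • B.I' a := by
  rw [← sub_eq_zero]
  refine G.form_nondeg.2 _ fun z => ?_
  rw [B.eq_sum_I z]
  simp [B.dual]

variable {φ : ℂ →+* ℂ} {S : Type*} [CommRing S] [Algebra ℂ S]

/-- Invariance of the Casimir element. -/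
theorem sum_lie (f g : 𝔤 →ₛₗ[φ] S) (y : 𝔤) :
    ∑ a, f ⁅B.I' a, y⁆ * g (B.I a) = -∑ a, f (B.I' a) * g ⁅B.I a, y⁆ := by
  -- Both sides are expanded in the products `f (I'_b) g (I_a)`. Invariance of the form shows that
  -- the coefficient matrices are opposite.
  have h1 : ∀ a, f ⁅B.I' a, y⁆ * g (B.I a) =
      ∑ b, φ (G.form (B.I b) ⁅B.I' a, y⁆) • (f (B.I' b) * g (B.I a)) := fun a => by
    conv_lhs => rw [B.eq_sum_I' ⁅B.I' a, y⁆]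
    simp only [map_sum, map_smulₛₗ, Finset.sum_mul, smul_mul_assoc]
  have h2 : ∀ b, f (B.I' b) * g ⁅B.I b, y⁆ =
      ∑ a, φ (G.form ⁅B.I b, y⁆ (B.I' a)) • (f (B.I' b) * g (B.I a)) := fun b => by
    conv_lhs => rw [B.eq_sum_I ⁅B.I b, y⁆]
    simp only [map_sum, map_smulₛₗ, Finset.mul_sum, mul_smul_comm]
  simp only [h1, h2]
  rw [Finset.sum_comm, ← Finset.sum_neg_distrib]
  refine Finset.sum_congr rfl fun b _ => ?_
  rw [← Finset.sum_neg_distrib]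
  refine Finset.sum_congr rfl fun a _ => ?_
  rw [← neg_smul, ← map_neg]
  congr 2
  rw [← lie_skew (B.I b) y, map_neg, LinearMap.neg_apply, G.form_lie y, neg_neg,
    ← lie_skew (B.I' a) y, map_neg]

theorem sum_form_smul_I' (f : 𝔤 →ₛₗ[φ] S) (y : 𝔤) :
    ∑ a, φ (G.form (B.I a) y) • f (B.I' a) = f y := by
  conv_rhs => rw [B.eq_sum_I' y]
  simp only [map_sum, map_smulₛₗ]

theorem sum_form_smul_I (f : 𝔤 →ₛₗ[φ] S) (y : 𝔤) :
    ∑ a, φ (G.form (B.I' a) y) • f (B.I a) = f y := by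
  conv_rhs => rw [B.eq_sum_I y]
  simp only [map_sum, map_smulₛₗ, form_comm G y]

end DualBases

/-! ### Shifted sums over large intervals. -/

section Telescope

/-- A finite sum of a function with bounded support does not change under a shift of the
argument. -/
theorem sum_Ioo_shift {M : Type*} [AddCommMonoid M] (w : ℤ → M) (K k : ℕ) (m : ℤ)
    (hw : ∀ n : ℤ, K ≤ n.natAbs → w n = 0) (hk : K + m.natAbs ≤ k) :
    ∑ n ∈ Finset.Ioo (-(k : ℤ)) k, w (n + m) = ∑ n ∈ Finset.Ioo (-(k : ℤ)) k, w n := by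
  have e : ∑ n ∈ Finset.Ioo (-(k : ℤ)) k, w (n + m) =
      ∑ n ∈ (Finset.Ioo (-(k : ℤ)) k).map (addRightEmbedding m), w n := by
    rw [Finset.sum_map]; rfl
  rw [e]
  -- Both the interval and its translate contain the window `|n| < K` outside which `w` vanishes.
  have h1 : Finset.Ioo (-(K : ℤ)) K ⊆ (Finset.Ioo (-(k : ℤ)) k).map (addRightEmbedding m) := by
    intro n hn
    rw [Finset.mem_Ioo] at hn
    refine Finset.mem_map.mpr ⟨n - m, ?_, ?_⟩
    · rw [Finset.mem_Ioo]; omega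
    · simp
  have h2 : Finset.Ioo (-(K : ℤ)) K ⊆ Finset.Ioo (-(k : ℤ)) k := by
    intro n hn
    rw [Finset.mem_Ioo] at hn ⊢
    omega
  have h3 : ∀ n, n ∉ Finset.Ioo (-(K : ℤ)) K → w n = 0 := fun n hn => by
    rw [Finset.mem_Ioo] at hn
    exact hw n (by omega)
  rw [← Finset.sum_subset h1 fun n _ => h3 n, ← Finset.sum_subset h2 fun n _ => h3 n]

end Telescope

/-! ### The Segal-Sugawara computation for abstract currents. -/

section Currents

variable {S : Type*} [CommRing S] [Algebra ℂ S] (B : DualBases G) (br : PoissonBracket S)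
  {φ : ℂ →+* ℂ} (cur : ℕ → ℤ → 𝔤 →ₛₗ[φ] S)

/-- The quadratic expression `∑_a I_{a,-n,p} I^a_{n,q}` in the currents. -/
def casimir (p q : ℕ) (n : ℤ) : S := ∑ a, cur p (-n) (B.I' a) * cur q n (B.I a)

/-- The expression `∑_a [I_a, y]_{i,p} I^a_{j,q}` in the currents. -/
def casimirLie (y : 𝔤) (p q : ℕ) (i j : ℤ) : S := ∑ a, cur p i ⁅B.I' a, y⁆ * cur q j (B.I a)

/-- The bracket relations of currents `x_{m,p}` with exponents at least `lo`, with the central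
elements `K_p` replaced by the numbers `lev p`. The relations are only required if the second
current is homogeneous. -/
structure IsCurrents (lo N : ℕ) (lev : ℕ → ℂ) (homog : ℕ → 𝔤 → Prop) : Prop where
  vanish : ∀ p m x, N ≤ p → cur p m x = 0
  br_cur : ∀ p q m n x y, lo ≤ p → lo ≤ q → homog q y → br.br (cur p m x) (cur q n y) =
    cur (p + q) (m + n) ⁅x, y⁆ +
      algebraMap ℂ S (if m + n = 0 then m * φ (G.form x y) * lev (p + q) else 0)

variable {br cur} {lo N : ℕ} {lev : ℕ → ℂ} {homog : ℕ → 𝔤 → Prop}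

/-- The Leibniz rule produces `[I_a, y]` once in each factor; Casimir invariance puts both in the
first factor, with opposite signs and with the shifts of exponent and degree left where they were.
In the central terms the dual bases contract to `y`. -/
theorem IsCurrents.casimir_br (h : IsCurrents (G := G) br cur lo N lev homog) (p q u : ℕ) (hp : lo ≤ p)
    (hq : lo ≤ q) (hu : lo ≤ u) (n m : ℤ) (y : 𝔤) (hy : homog u y) :
    br.br (casimir B cur p q n) (cur u m y) =
      casimirLie B cur y (p + u) q (-n + m) n - casimirLie B cur y p (q + u) (-n) (n + m) +
        ((if n + m = 0 then n * lev (q + u) else 0) • cur p (-n) y +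
        (if -n + m = 0 then -n * lev (p + u) else 0) • cur q n y) := by
  have e1 : ∀ a, br.br (cur p (-n) (B.I' a) * cur q n (B.I a)) (cur u m y) =
      cur p (-n) (B.I' a) * cur (q + u) (n + m) ⁅B.I a, y⁆ +
      cur (p + u) (-n + m) ⁅B.I' a, y⁆ * cur q n (B.I a) +
      ((if n + m = 0 then n * lev (q + u) else 0) • φ (G.form (B.I a) y) • cur p (-n) (B.I' a) +
        (if -n + m = 0 then -n * lev (p + u) else 0) • φ (G.form (B.I' a) y) • cur q n (B.I a)) := by
    intro a
    rw [br.leibniz, h.br_cur _ _ _ _ _ _ hq hu hy, h.br_cur _ _ _ _ _ _ hp hu hy, mul_add, mul_add,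
      mul_comm _ (algebraMap ℂ S _), ← Algebra.smul_def, mul_comm (cur q n (B.I a)) (algebraMap ℂ S _),
      ← Algebra.smul_def, smul_smul, smul_smul]
    have e : ∀ (P : Prop) [Decidable P] (a b c : ℂ),
        (if P then a * b * c else 0) = (if P then a * c else 0) * b := by
      intro P _ a b c
      split_ifs <;> ring
    rw [e, e]
    push_cast
    ring
  unfold casimir
  rw [map_sum, LinearMap.sum_apply]
  simp only [e1, Finset.sum_add_distrib, ← Finset.smul_sum, B.sum_form_smul_I',
    B.sum_form_smul_I]
  unfold casimirLie
  rw [B.sum_lie (cur p (-n))]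
  ring

/-- The partial sum over `|n| < k` of the Segal-Sugawara element. -/
def segal (lo N : ℕ) (ℓ : ℕ → ℂ) (ε : ℂ) (r k : ℕ) : S :=
  (ε * (Complex.I / 2)) • ∑ p ∈ Finset.Ico lo N, ∑ q ∈ Finset.Ico lo N,
    kappaShift N ℓ p q r • ∑ n ∈ Finset.Ioo (-(k : ℤ)) k, casimir B cur p q n

theorem segal_eq (ℓ : ℕ → ℂ) (ε : ℂ) (r k : ℕ) : segal (cur := cur) B lo N ℓ ε r k =
    (ε * (Complex.I / 2)) • ∑ n ∈ Finset.Ioo (-(k : ℤ)) k, ∑ p ∈ Finset.Ico lo N,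
      ∑ q ∈ Finset.Ico lo N, kappaShift N ℓ p q r • casimir B cur p q n := by
  unfold segal
  congr 1
  simp only [Finset.smul_sum]
  rw [Finset.sum_comm (s := Finset.Ioo (-(k : ℤ)) k)]
  refine Finset.sum_congr rfl fun p _ => ?_
  rw [Finset.sum_comm]

variable (F : ℕ → Ideal S) {ℓ : ℕ → ℂ} {ε : ℂ}

/-- The partial sums act on currents as `D_r` modulo `F M`, once `k` is large. The quadratic part is
a telescoping sum and the linear part is evaluated by the inverse property of `κ`. The hypothesis
`hF` says that products of a current of degree at most `-k` with one of degree at least `k` are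
small; it controls both ends of the telescope. -/
theorem IsCurrents.segal_br (h : IsCurrents (G := G) br cur lo N lev homog)
    (hlev : ∀ p, lev p = ε * (Complex.I * ℓ p)) (hε : ε * ε = 1)
    (hℓ : ∀ p, N ≤ p → ℓ p = 0) (h0 : lo < N → ℓ (N - 1) ≠ 0)
    (hF : ∀ (k : ℕ) p q (i j : ℤ) x y, i ≤ -(k : ℤ) → k ≤ j → cur p i x * cur q j y ∈ F k)
    (M r u : ℕ) (hr : lo ≤ r) (hrN : r < N) (hu : lo ≤ u) (m : ℤ) (y : 𝔤) (hy : homog u y) (k : ℕ)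
    (hk : M + 2 * m.natAbs + 1 ≤ k) :
    br.br (segal (cur := cur) B lo N ℓ ε r k) (cur u m y) - (m : ℂ) • cur (r + u) m y ∈ F M := by
  have h0 : ℓ (N - 1) ≠ 0 := h0 (by omega)
  set w : ℤ → S := fun n => ∑ p ∈ Finset.Ico lo N, ∑ q ∈ Finset.Ico lo N,
    kappaShift N ℓ p q r • casimirLie B cur y (p + u) q (-n + m) n with hw
  -- Moving the shift `u` to the first exponent turns the second family of quadratic terms into the
  -- first one, evaluated at `n + m`.
  have hshift : ∀ n, ∑ p ∈ Finset.Ico lo N, ∑ q ∈ Finset.Ico lo N,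
      kappaShift N ℓ p q r • casimirLie B cur y p (q + u) (-n) (n + m) = w (n + m) := by
    intro n
    rw [← sum_kappaShift_swap N lo ℓ r u hr (fun p q => casimirLie B cur y p q (-n) (n + m)),
      hw]
    · simp only [neg_add_rev, neg_add_cancel_comm]
    · intro p q hp
      exact Finset.sum_eq_zero fun a _ => by rw [h.vanish p _ _ hp, zero_mul]
    · intro p q hq
      exact Finset.sum_eq_zero fun a _ => by rw [h.vanish q _ _ hq, mul_zero]
  have key : ∀ n, ∑ p ∈ Finset.Ico lo N, ∑ q ∈ Finset.Ico lo N,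
      kappaShift N ℓ p q r • br.br (casimir B cur p q n) (cur u m y) =
      w n - w (n + m) + ((if n + m = 0 then (n : ℂ) else 0) • (ε * Complex.I) • cur (r + u) (-n) y +
        (if -n + m = 0 then -(n : ℂ) else 0) • (ε * Complex.I) • cur (r + u) n y) := by
    intro n
    -- Contracting `κ` with the levels gives a Kronecker delta and leaves only `p = r + u`. If that
    -- exponent is not in range, it is at least `N` and the current vanishes.
    have hκ : ∀ j, ∑ p ∈ Finset.Ico lo N, ∑ q ∈ Finset.Ico lo N,
        kappaShift N ℓ p q r • lev (q + u) • cur p j y = (ε * Complex.I) • cur (r + u) j y := by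
      intro j
      have e1 : ∀ p ∈ Finset.Ico lo N, ∑ q ∈ Finset.Ico lo N,
          kappaShift N ℓ p q r • lev (q + u) • cur p j y =
          if p = r + u then (ε * Complex.I) • cur (r + u) j y else 0 := by
        intro p hp
        rw [Finset.mem_Ico] at hp
        have e2 : ∑ q ∈ Finset.Ico lo N, kappaShift N ℓ p q r • lev (q + u) • cur p j y =
            (ε * Complex.I * ∑ q ∈ Finset.Ico lo N, kappaShift N ℓ p q r * ℓ (q + u)) •
              cur p j y := by
          rw [Finset.mul_sum, Finset.sum_smul]
          refine Finset.sum_congr rfl fun q _ => ?_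
          rw [smul_smul, hlev]
          congr 1; ring
        rw [e2, sum_kappaShift_mul N lo ℓ hℓ h0 p r u hp.2 hr]
        split_ifs with hpr
        · rw [hpr, mul_one]
        · rw [mul_zero, zero_smul]
      rw [Finset.sum_congr rfl e1, Finset.sum_ite_eq']
      split_ifs with hmem
      · rfl
      · rw [h.vanish _ _ _ (by rw [Finset.mem_Ico] at hmem; omega), smul_zero]
    have hκ' : ∀ j, ∑ p ∈ Finset.Ico lo N, ∑ q ∈ Finset.Ico lo N,
        kappaShift N ℓ p q r • lev (p + u) • cur q j y = (ε * Complex.I) • cur (r + u) j y := by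
      intro j
      rw [← hκ j, Finset.sum_comm]
      refine Finset.sum_congr rfl fun p _ => Finset.sum_congr rfl fun q _ => ?_
      rw [kappaShift_comm]
    rw [← hshift, ← hκ, ← hκ', hw, Finset.smul_sum, Finset.smul_sum]
    simp only [Finset.smul_sum, ← Finset.sum_add_distrib, ← Finset.sum_sub_distrib]
    refine Finset.sum_congr rfl fun p hp => Finset.sum_congr rfl fun q hq => ?_
    rw [h.casimir_br B p q u (Finset.mem_Ico.mp hp).1 (Finset.mem_Ico.mp hq).1 hu n m y hy]
    split_ifs <;> module
  have hsum : br.br (segal (cur := cur) B lo N ℓ ε r k) (cur u m y) =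
      (ε * (Complex.I / 2)) • (∑ n ∈ Finset.Ioo (-(k : ℤ)) k, w n -
        ∑ n ∈ Finset.Ioo (-(k : ℤ)) k, w (n + m)) + (m : ℂ) • cur (r + u) m y := by
    rw [segal_eq]
    simp only [map_smul, map_sum, LinearMap.smul_apply, LinearMap.sum_apply, key,
      Finset.sum_add_distrib, Finset.sum_sub_distrib]
    have e1 : ∀ n : ℤ, (if n + m = 0 then (n : ℂ) else 0) • (ε * Complex.I) • cur (r + u) (-n) y =
        if n = -m then (-(m : ℂ)) • (ε * Complex.I) • cur (r + u) m y else 0 := by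
      intro n
      by_cases hn : n = -m
      · subst hn
        simp
      · rw [if_neg hn, if_neg (by omega), zero_smul]
    have e2 : ∀ n : ℤ, (if -n + m = 0 then -(n : ℂ) else 0) • (ε * Complex.I) • cur (r + u) n y =
        if n = m then (-(m : ℂ)) • (ε * Complex.I) • cur (r + u) m y else 0 := by
      intro n
      by_cases hn : n = m
      · subst hn
        simp
      · rw [if_neg hn, if_neg (by omega), zero_smul]
    simp only [e1, e2, Finset.sum_ite_eq']
    -- The bound on `k` ensures that both `m` and `-m` are inside the interval of summation.
    rw [if_pos (Finset.mem_Ioo.mpr (by omega)), if_pos (Finset.mem_Ioo.mpr (by omega)), smul_add]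
    congr 1
    rw [← two_smul ℂ, smul_smul, smul_smul, smul_smul]
    congr 1
    -- The terms at `n = m` and `n = -m` are equal, and the constants give `(ε i / 2) · 2 · (-m) ·
    -- (ε i) = m`.
    linear_combination (-(m : ℂ) * Complex.I * Complex.I) * hε - (m : ℂ) * Complex.I_mul_I
  have hw0 : ∀ n : ℤ, M + m.natAbs ≤ n.natAbs → Ideal.Quotient.mk (F M) (w n) = 0 := by
    intro n hn
    rw [Ideal.Quotient.eq_zero_iff_mem]
    refine sum_mem fun p _ => sum_mem fun q _ => ?_
    rw [Algebra.smul_def]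
    refine Ideal.mul_mem_left _ _ (sum_mem fun a _ => ?_)
    by_cases h1 : 0 ≤ n
    · exact hF M _ _ _ _ _ _ (by omega) (by omega)
    · rw [mul_comm]
      exact hF M _ _ _ _ _ _ (by omega) (by omega)
  -- Modulo `F M` the function `w` is supported in `|n| < M + |m|`. A shift by `m` costs another
  -- `|m|`, which accounts for the bound `M + 2 |m| + 1` on `k`.
  have := sum_Ioo_shift (fun n => Ideal.Quotient.mk (F M) (w n)) (M + m.natAbs) k m
    (fun n hn => hw0 n (by omega)) (by omega)
  rw [hsum, add_sub_cancel_right, Algebra.smul_def]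
  refine Ideal.mul_mem_left _ _ ?_
  rw [← Ideal.Quotient.eq, map_sum, map_sum, this]


variable {S' : Type*} [CommRing S'] [Algebra ℂ S']

/-- A derivation which acts on the currents as an element `D_r` annihilates the partial sums of
the Segal-Sugawara elements. -/
theorem derivation_segal (hv : ∀ p m x, N ≤ p → cur p m x = 0) (θ : S →ₐ[ℂ] S') (D : S →ₗ[ℂ] S')
    (hD : ∀ a b, D (a * b) = θ a * D b + θ b * D a) (r : ℕ)
    (hcur : ∀ p m y, lo ≤ p → D (cur p m y) = (m : ℂ) • θ (cur (r + p) m y)) (r' k : ℕ)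
    (hr' : lo ≤ r') : D (segal (cur := cur) B lo N ℓ ε r' k) = 0 := by
  -- The two factors have degrees `-n` and `n`, hence the opposite signs; only the position of the
  -- shift `r` distinguishes the two terms. After summation with the weights `κ` this position does
  -- not matter.
  have e1 : ∀ p q n, lo ≤ p → lo ≤ q → D (casimir B cur p q n) =
      (n : ℂ) • (θ (casimir B cur p (q + r) n) - θ (casimir B cur (p + r) q n)) := by
    intro p q n hp hq
    unfold casimir
    rw [map_sum, map_sum, map_sum, ← Finset.sum_sub_distrib, Finset.smul_sum]
    refine Finset.sum_congr rfl fun a _ => ?_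
    rw [hD, hcur _ _ _ hp, hcur _ _ _ hq, map_mul, map_mul, add_comm r, add_comm r]
    push_cast
    rw [mul_smul_comm, mul_smul_comm, smul_sub, neg_smul, sub_eq_add_neg, mul_comm (θ (cur q _ _))]
  rw [segal_eq]
  simp only [map_smul, map_sum]
  refine smul_eq_zero_of_right _ (Finset.sum_eq_zero fun n _ => ?_)
  have e2 : ∀ p ∈ Finset.Ico lo N, ∀ q ∈ Finset.Ico lo N,
      kappaShift N ℓ p q r' • D (casimir B cur p q n) =
      (n : ℂ) • (kappaShift N ℓ p q r' • θ (casimir B cur p (q + r) n) -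
        kappaShift N ℓ p q r' • θ (casimir B cur (p + r) q n)) := by
    intro p hp q hq
    rw [e1 p q n (Finset.mem_Ico.mp hp).1 (Finset.mem_Ico.mp hq).1, smul_comm, smul_sub]
  rw [Finset.sum_congr rfl fun p hp => Finset.sum_congr rfl (e2 p hp)]
  simp only [← Finset.smul_sum, Finset.sum_sub_distrib]
  rw [sum_kappaShift_swap N lo ℓ r' r hr' (fun p q => θ (casimir B cur p q n)), sub_self, smul_zero]
  · intro p q hp
    rw [casimir, Finset.sum_eq_zero fun a _ => by rw [hv p _ _ hp, zero_mul], map_zero]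
  · intro p q hq
    rw [casimir, Finset.sum_eq_zero fun a _ => by rw [hv q _ _ hq, mul_zero], map_zero]

/-- This covers the derivations attached to a different place, which annihilate all currents of the
given one. -/
theorem derivation_segal_of_zero (θ : S →ₐ[ℂ] S') (D : S →ₗ[ℂ] S')
    (hD : ∀ a b, D (a * b) = θ a * D b + θ b * D a)
    (hcur : ∀ p m y, lo ≤ p → D (cur p m y) = 0) (r' k : ℕ) :
    D (segal (cur := cur) B lo N ℓ ε r' k) = 0 := by
  unfold segal casimir
  simp only [map_smul, map_sum]
  refine smul_eq_zero_of_right _ (Finset.sum_eq_zero fun p hp => Finset.sum_eq_zero fun q hq =>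
    smul_eq_zero_of_right _ (Finset.sum_eq_zero fun n _ => Finset.sum_eq_zero fun a _ => ?_))
  rw [hD, hcur _ _ _ (Finset.mem_Ico.mp hp).1, hcur _ _ _ (Finset.mem_Ico.mp hq).1, mul_zero,
    mul_zero, add_zero]

end Currents
end AffineGaudin
end

noncomputable section
open scoped TensorProduct
namespace AffineGaudin

variable {𝔤 : Type*} [LieRing 𝔤] [LieAlgebra ℂ 𝔤] {T : ℕ} {G : DihedralLie 𝔤 T}

open DihedralLie

namespace DihedralLie

/-- The projection of an eigenvector is a multiple of it, hence lies in the eigenspaces of both `w`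
and `z`. -/
theorem eigProj_of_ne {z w : ℂ} (hz : z ^ T = 1) {y : 𝔤} (hy : G.σ y = w • y) (h : z ≠ w) :
    G.eigProj z y = 0 := by
  have e : ∃ c : ℂ, G.eigProj z y = c • y := by
    refine ⟨(T : ℂ)⁻¹ * ∑ k ∈ Finset.range T, z⁻¹ ^ k * w ^ k, ?_⟩
    rw [eigProj_apply, mul_smul, Finset.sum_smul]
    congr 1
    refine Finset.sum_congr rfl fun k _ => ?_
    rw [σEnd_pow_eig G hy, smul_smul]
  obtain ⟨c, hc⟩ := e
  have h1 := G.σ_eigProj hz y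
  rw [hc, map_smul, hy, smul_comm] at h1
  have h2 : (z - w) • c • y = 0 := by rw [sub_smul, h1, sub_self]
  rw [hc]
  exact (smul_eq_zero.mp h2).resolve_left (sub_ne_zero.mpr h)

end DihedralLie

namespace Poles

variable {P : Poles G}

open Place

theorem Place.sign_mul_self (s : Place P) : s.sign * s.sign = 1 := by
  match s with
  | .cpx _ _ true => simp [Place.sign]
  | .cpx _ _ false => simp [Place.sign]
  | .real .. => simp [Place.sign]
  | .fixed .. => simp [Place.sign]

theorem Place.genMem_hat {s : Place P} {p : ℕ} (hp : s.lo ≤ p) {X : Affine G} (hd : X.d = 0)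
    (h : p ∈ s.exps → s.Allowed p X) : GenMem P.hat s p X := by
  by_cases hm : p < s.mult
  · exact (h (mem_exps.mpr ⟨hp, hm⟩)).mem_hat hd
  · exact genMem_of_le s p X (not_lt.mp hm)

theorem Place.genMem_mono {s : Place P} {p : ℕ} (hp : s.lo ≤ p) (m : ℤ) {x : 𝔤}
    (hx : s.IsHomog p x) : GenMem P.hat s p (Affine.mono m x) :=
  genMem_hat hp rfl fun h => allowed_mono.mpr ⟨h, hx⟩

/-! ### The currents at a place, with values in the quotient at fixed levels. -/

section Level

variable (P) (ℓ : OnePoint ℂ → ℕ → ℂ)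

theorem levelι_br (X Y : Cx P.hat) : (P.levelPoisson ℓ).br (P.levelι ℓ X) (P.levelι ℓ Y) =
    P.levelι ℓ ⁅X, Y⁆ :=
  (PoissonBracket.quotient_mk _ _ _ _ _).trans
    (congrArg (Ideal.Quotient.mk (P.levelIdeal ℓ)) (symBr_ι_ι X Y))

variable {P}

theorem levelι_K {s : Place P} {p : ℕ} (h : s.Allowed p (Affine.K : Affine G)) :
    P.levelι ℓ (gen P.hat s p Affine.K) =
      algebraMap ℂ (P.LevelSym ℓ) (s.sign * (Complex.I * ℓ s.point p)) := by
  have : SymmetricAlgebra.ι ℂ _ (gen P.hat s p Affine.K) -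
      algebraMap ℂ _ (s.sign * (Complex.I * ℓ s.point p)) ∈ P.levelIdeal ℓ :=
    Ideal.subset_span ⟨s, p, h, rfl⟩
  exact (Ideal.Quotient.eq (I := P.levelIdeal ℓ)).mpr this

/-- The currents `x ↦ (x_m)_p` at a place, with values in the quotient of `S(𝔤̂)`. At a fixed point
the argument is projected to the eigenspace of `σ` attached to `p`. -/
def current (s : Place P) (p : ℕ) (m : ℤ) : 𝔤 →ₛₗ[conjIf s.flag] P.LevelSym ℓ :=
  if h : s.lo ≤ p then
    { toFun := fun x => P.levelι ℓ (gen P.hat s p (Affine.mono m (s.proj p x)))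
      map_add' := fun x y => by
        have hx := genMem_mono h m (s.isHomog_proj p x)
        have hy := genMem_mono h m (s.isHomog_proj p y)
        have hxy := genMem_mono h m (s.isHomog_proj p (x + y))
        rw [map_add, Affine.mono_add] at hxy ⊢
        rw [gen_add s p hx hy hxy, map_add]
      map_smul' := fun c x => by
        have hx := genMem_mono h m (s.isHomog_proj p x)
        have hcx := genMem_mono h m (s.isHomog_proj p (c • x))
        rw [map_smul, ← Affine.smul_mono] at hcx ⊢
        rw [gen_smul s p c hx hcx, map_smul] }
  -- Exponent `0` at infinity is absent from the algebra, so the current there gets a default value;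
  -- exponents from `mult` on give zero because the generator itself does.
  else 0

theorem current_apply {s : Place P} {p : ℕ} (h : s.lo ≤ p) (m : ℤ) (x : 𝔤) :
    current ℓ s p m x = P.levelι ℓ (gen P.hat s p (Affine.mono m (s.proj p x))) := by
  unfold current
  rw [dif_pos h]
  rfl

theorem current_of_homog {s : Place P} {p : ℕ} (h : s.lo ≤ p) (m : ℤ) {x : 𝔤}
    (hx : s.IsHomog p x) :
    current ℓ s p m x = P.levelι ℓ (gen P.hat s p (Affine.mono m x)) := by
  rw [current_apply ℓ h, hx.proj_eq]

theorem current_proj (s : Place P) (p : ℕ) (m : ℤ) (x : 𝔤) :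
    current ℓ s p m (s.proj p x) = current ℓ s p m x := by
  unfold current
  split_ifs with h
  · change P.levelι ℓ (gen P.hat s p (Affine.mono m (s.proj p (s.proj p x)))) =
      P.levelι ℓ (gen P.hat s p (Affine.mono m (s.proj p x)))
    rw [(s.isHomog_proj p x).proj_eq]
  · rfl

theorem current_vanish (s : Place P) (p : ℕ) (m : ℤ) (x : 𝔤) (hp : s.mult ≤ p) :
    current ℓ s p m x = 0 := by
  unfold current
  split_ifs with h
  · change P.levelι ℓ (gen P.hat s p (Affine.mono m (s.proj p x))) = 0
    rw [gen_eq_zero _ _ _ hp, map_zero]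
  · rfl

/-- Homogeneity of `y` alone suffices, since bracket and form with `y` see only the appropriate
component of `x`. The form is conjugated at the conjugate of a complex point because there the
generator of `K` takes scalars antilinearly. -/
theorem current_br {s : Place P} (hℓ : P.IsLevels ℓ) (p q : ℕ) (m n : ℤ) (x y : 𝔤)
    (hp : s.lo ≤ p) (hq : s.lo ≤ q) (hy : s.IsHomog q y) :
    (P.levelPoisson ℓ).br (current ℓ s p m x) (current ℓ s q n y) =
      current ℓ s (p + q) (m + n) ⁅x, y⁆ + algebraMap ℂ (P.LevelSym ℓ)
        (if m + n = 0 then m * conjIf s.flag (G.form x y) *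
          (s.sign * (Complex.I * ℓ s.point (p + q))) else 0) := by
  have hpq : s.lo ≤ p + q := le_add_right hp
  rw [current_apply ℓ hp, current_of_homog ℓ hq n hy, current_apply ℓ hpq, levelι_br]
  -- When `p + q` reaches the multiplicity, the power of `ε` and the level both vanish, so the
  -- relation holds without a restriction on exponents.
  by_cases hN : p + q < s.mult
  swap
  · have hN := not_lt.mp hN
    rw [lie_gen s p q (genMem_mono hp m (s.isHomog_proj p x)) (genMem_mono hq n hy)
      (genMem_of_le _ _ _ hN), gen_eq_zero _ _ _ hN, gen_eq_zero _ _ _ hN, hℓ.vanish s _ hN,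
      map_zero, mul_zero, mul_zero, mul_zero, ite_self, map_zero, add_zero]
  have hpe : p ∈ s.exps := mem_exps.mpr ⟨hp, by omega⟩
  have hqe : q ∈ s.exps := mem_exps.mpr ⟨hq, by omega⟩
  have hX : s.Allowed p (Affine.mono m (s.proj p x) : Affine G) :=
    allowed_mono.mpr ⟨hpe, s.isHomog_proj p x⟩
  have hY : s.Allowed q (Affine.mono n y : Affine G) := allowed_mono.mpr ⟨hqe, hy⟩
  have hXY := hX.lie hY hN
  have hZ : s.Allowed (p + q) (Affine.mono (m + n) (s.proj (p + q) ⁅x, y⁆) : Affine G) :=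
    allowed_mono.mpr ⟨hXY.1, s.isHomog_proj _ _⟩
  rw [lie_gen s p q (hX.mem_hat rfl) (hY.mem_hat rfl) (hXY.mem_hat rfl)]
  rw [Affine.mono_lie, s.proj_lie p q x hy, s.form_proj p q x hy] at hXY ⊢
  -- At a fixed point with `T ∤ p + q` there is no `K` of this exponent. The form on the eigenspaces
  -- is zero and so is the level, so the formula keeps its shape.
  by_cases hdiv : s.Div (p + q)
  · have hK := allowed_K.mpr ⟨hXY.1, hdiv⟩
    rw [if_pos hdiv] at hXY ⊢
    rw [gen_add s (p + q) (hZ.mem_hat rfl) ((hK.smul _).mem_hat (mul_zero _))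
      (hXY.mem_hat (by simp only [Affine.add_d, Affine.mono_d, Affine.smul_d, Affine.K_d,
        mul_zero, add_zero])), map_add, gen_smul s (p + q) _ (hK.mem_hat rfl)
      ((hK.smul _).mem_hat (mul_zero _)), map_smul, levelι_K ℓ hK, Algebra.smul_def, ← map_mul]
    congr 2
    split_ifs
    · rw [map_mul, map_intCast]
    · rw [map_zero, zero_mul]
  · have h0 : ℓ s.point (p + q) = 0 := by
      match s with
      | .fixed x hx => exact hℓ.fixed_vanish x hx _ hdiv
      | .cpx .. => exact absurd trivial hdiv
      | .real .. => exact absurd trivial hdiv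
    simp only [h0, if_neg hdiv, mul_zero, ite_self, zero_smul, add_zero, map_zero]

theorem isCurrents (s : Place P) (hℓ : P.IsLevels ℓ) :
    IsCurrents (G := G) (P.levelPoisson ℓ) (current ℓ s) s.lo s.mult
      (fun p => s.sign * (Complex.I * ℓ s.point p)) s.IsHomog where
  vanish p m x hp := current_vanish ℓ s p m x hp
  br_cur p q m n x y hp hq hy := current_br ℓ hℓ p q m n x y hp hq hy

theorem current_br_of_ne {s t : Place P} (hst : s ≠ t) (p q : ℕ) (m n : ℤ) (x y : 𝔤)
    (hp : s.lo ≤ p) (hq : t.lo ≤ q) :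
    (P.levelPoisson ℓ).br (current ℓ s p m x) (current ℓ t q n y) = 0 := by
  rw [current_apply ℓ hp, current_apply ℓ hq, levelι_br, lie_gen_of_ne hst p q
    (genMem_mono hp m (s.isHomog_proj p x)) (genMem_mono hq n (t.isHomog_proj q y)), map_zero]

theorem twist_mono (s : Place P) (p : ℕ) (m : ℤ) (x : 𝔤) :
    ∃ x', twist s p (Affine.mono m x) = Affine.mono (-m) x' := by
  have hτ : G.affτ (Affine.mono m x) = Affine.mono (-m) (G.τ x) := by
    ext1
    · exact G.loopτ_mono m x
    · change -starRingEnd ℂ 0 = 0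
      simp
    · change -starRingEnd ℂ 0 = 0
      simp
  have hσ : ∀ k (y : 𝔤), ∃ y', G.affσ^[k] (Affine.mono (-m) y) = Affine.mono (-m) y' := by
    intro k
    induction k with
    | zero => exact fun y => ⟨y, rfl⟩
    | succ k ih =>
      intro y
      rw [Function.iterate_succ_apply, Affine.affσ_mono]
      exact ih _
  match s with
  | .cpx .. => exact ⟨0, (Affine.mono_zero _).symm⟩
  | .fixed .. => exact ⟨_, hτ⟩
  | .real _ k _ _ _ _ =>
    obtain ⟨y', hy'⟩ := hσ k (G.τ x)
    refine ⟨(G.ω⁻¹ ^ k) ^ p • y', ?_⟩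
    rw [← Affine.smul_mono, ← hy', ← hτ]
    rfl

/-- `τ` reverses the powers of `t`. The coordinate selected by the flag has degree `m`, and the
other, if nonzero, has degree `-m`; this matches the opposite conditions in the definition of
`Cx.fil`. -/
theorem comp_mono (s : Place P) (b : Bool) (p : ℕ) (m : ℤ) (x : 𝔤) :
    ∃ x', comp s b p (Affine.mono m x) = Affine.mono (if b = s.flag then m else -m) x' := by
  match s, b with
  | .cpx _ _ c, b =>
    by_cases hbc : b = c
    · exact ⟨x, by simp only [comp, Place.flag, hbc, if_true]⟩
    · exact ⟨0, by simp only [comp, Place.flag, if_neg hbc, Affine.mono_zero]⟩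
  | .real .., false => exact ⟨x, rfl⟩
  | .real y k hk h0 hi h, true => exact twist_mono (.real y k hk h0 hi h) p m x
  | .fixed .., false => exact ⟨x, rfl⟩
  | .fixed y hy, true => exact twist_mono (.fixed y hy) p m x

theorem mono_mem_fil (b : Bool) (k : ℕ) (m : ℤ) (x : 𝔤) (h : (k : ℤ) ≤ sgnDeg b m) :
    Affine.mono m x ∈ Affine.fil G b k := by
  refine ⟨rfl, rfl, fun j hj => ?_⟩
  rw [Affine.mono_loop, loopCoeff_mono, Finsupp.single_apply, if_neg]
  rintro rfl
  exact absurd h (not_le.mpr hj)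

theorem single_mem_fil (b : Bool) (k : ℕ) (x : P.pts) (p : ℕ) (X : Affine G)
    (h : X ∈ Affine.fil G b k) : single x p X ∈ TakiffSum.fil P b k := by
  intro y q
  unfold single
  split_ifs
  · exact h
  · exact zero_mem _

theorem gen_mem_fil {s : Place P} {p : ℕ} {k : ℕ} {m : ℤ} {x : 𝔤}
    (h : GenMem P.hat s p (Affine.mono m x)) (hk : (k : ℤ) ≤ sgnDeg s.flag m) :
    gen P.hat s p (Affine.mono m x) ∈ Cx.fil P.hat k := by
  have key : ∀ b, Cx.coord b (gen P.hat s p (Affine.mono m x)) ∈ TakiffSum.fil P b k := by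
    intro b
    rw [coord_gen_comp _ _ _ h]
    obtain ⟨x', hx'⟩ := comp_mono s b p m x
    rw [hx']
    refine single_mem_fil _ _ _ _ _ (mono_mem_fil _ _ _ _ ?_)
    revert hk
    generalize s.flag = f
    cases f <;> cases b <;> simp [sgnDeg]
  exact ⟨key false, key true⟩

theorem gen_mem_conjFil {s : Place P} {p : ℕ} {k : ℕ} {m : ℤ} {x : 𝔤}
    (h : GenMem P.hat s p (Affine.mono m x)) (hk : sgnDeg s.flag m ≤ -(k : ℤ)) :
    gen P.hat s p (Affine.mono m x) ∈ Cx.conjFil P.hat k := by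
  have key : ∀ b, Cx.coord b (Cx.conj (gen P.hat s p (Affine.mono m x))) ∈
      TakiffSum.fil P b k := by
    intro b
    rw [Cx.coord_conj, coord_gen_comp _ _ _ h]
    obtain ⟨x', hx'⟩ := comp_mono s (!b) p m x
    rw [hx']
    refine single_mem_fil _ _ _ _ _ (mono_mem_fil _ _ _ _ ?_)
    revert hk
    generalize s.flag = f
    cases f <;> cases b <;> simp [sgnDeg] <;> omega
  exact ⟨_, ⟨key false, key true⟩, Cx.conj_conj _⟩

/-- One factor lies in the filtration and the other in its conjugate, so the product is in both
ideals. Which factor is which depends on the flag. -/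
theorem current_mul_mem (s : Place P) (k p q : ℕ) (i j : ℤ) (x y : 𝔤) (hi : i ≤ -(k : ℤ))
    (hj : (k : ℤ) ≤ j) : current ℓ s p i x * current ℓ s q j y ∈ P.filHat ℓ k := by
  by_cases hp : s.lo ≤ p
  swap
  · unfold current
    rw [dif_neg hp, LinearMap.zero_apply, zero_mul]
    exact zero_mem _
  by_cases hq : s.lo ≤ q
  swap
  · unfold current
    rw [dif_neg hq, LinearMap.zero_apply, mul_zero]
    exact zero_mem _
  have hx := genMem_mono hp i (s.isHomog_proj p x)
  have hy := genMem_mono hq j (s.isHomog_proj q y)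
  rw [current_apply ℓ hp, current_apply ℓ hq]
  cases hf : s.flag
  · refine ⟨Ideal.mul_mem_left _ _ (Ideal.subset_span ⟨_, gen_mem_fil hy ?_, rfl⟩),
      Ideal.mul_mem_right _ _ (Ideal.subset_span ⟨_, gen_mem_conjFil hx ?_, rfl⟩)⟩
    · rw [hf]; exact hj
    · rw [hf]; exact hi
  · refine ⟨Ideal.mul_mem_right _ _ (Ideal.subset_span ⟨_, gen_mem_fil hx ?_, rfl⟩),
      Ideal.mul_mem_left _ _ (Ideal.subset_span ⟨_, gen_mem_conjFil hy ?_, rfl⟩)⟩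
    · rw [hf]; simp only [sgnDeg, if_true]; omega
    · rw [hf]; simp only [sgnDeg, if_true]; omega

variable (B : DualBases G)

/-- Since `g` factors through the eigenprojection, `I_a` may be replaced by its expansion in the
basis `E`; the sum over `a` then reassembles the dual vectors `E'` inside `f`. -/
theorem sum_dualE {S : Type*} [CommRing S] [Algebra ℂ S] {φ : ℂ →+* ℂ} (z : OnePoint ℂ) (q : ℕ)
    (f g : 𝔤 →ₛₗ[φ] S) (hg : ∀ x, g (G.eigProj (root G z q) x) = g x) :
    ∑ a, f (B.I' a) * g (B.I a) =
      ∑ α, f (B.E' (grade z q) α) * g (B.E (grade z q) α) := by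
  have : NeZero T := ⟨G.T_pos.ne'⟩
  have hE' : ∀ α, G.σ (B.E' (grade z q) α) =
      G.ω ^ (-grade (T := T) z q).val • (B.E' (grade z q) α : 𝔤) := fun α =>
    Module.End.mem_eigenspace_iff.mp (B.E' (grade z q) α).2
  have hroot : root G z q * G.ω ^ (-grade (T := T) z q).val = 1 := by
    unfold root
    rw [← pow_add, G.ω_prim.pow_eq_one_iff_dvd, ← ZMod.natCast_eq_zero_iff, Nat.cast_add,
      ZMod.natCast_zmod_val, ZMod.natCast_zmod_val, add_neg_cancel]
  have hroot' : (G.ω ^ (-grade (T := T) z q).val) ^ T = 1 := by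
    rw [← pow_mul, mul_comm, pow_mul, G.ω_prim.pow_eq_one, one_pow]
  have h1 : ∀ x, G.eigProj (root G z q) x =
      ∑ α, G.form x (B.E' (grade z q) α) • (B.E (grade z q) α : 𝔤) := by
    intro x
    have hmem : G.eigProj (root G z q) x ∈
        Module.End.eigenspace (G.σ.toLinearEquiv : 𝔤 →ₗ[ℂ] 𝔤) (G.ω ^ (grade (T := T) z q).val) :=
      Module.End.mem_eigenspace_iff.mpr (G.σ_eigProj (root_pow G z q) x)
    have h2 := (B.E (grade z q)).sum_repr ⟨_, hmem⟩
    have h3 : ∀ α, (B.E (grade z q)).repr ⟨_, hmem⟩ α = G.form x (B.E' (grade z q) α) := by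
      intro α
      have h4 := G.form_eigProj (root_pow G z q) hroot' x (hE' α)
      rw [if_pos hroot] at h4
      rw [← h4]
      have h5 := congrArg (fun v : 𝔤 => G.form v (B.E' (grade z q) α)) (congrArg Subtype.val h2)
      simp only [Submodule.coe_sum, Submodule.coe_smul, map_sum, LinearMap.sum_apply, map_smul,
        LinearMap.smul_apply, B.dualE] at h5
      rw [← h5]
      simp
    have h6 := congrArg Subtype.val h2
    refine h6.symm.trans ?_
    simp only [Submodule.coe_sum, Submodule.coe_smul, h3]
  have h2 : ∀ a, f (B.I' a) * g (B.I a) = ∑ α, (φ (G.form (B.I a) (B.E' (grade z q) α)) • f (B.I' a)) *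
      g (B.E (grade z q) α) := by
    intro a
    rw [← hg, h1, map_sum, Finset.mul_sum]
    refine Finset.sum_congr rfl fun α _ => ?_
    rw [map_smulₛₗ, mul_smul_comm, smul_mul_assoc]
  rw [Finset.sum_congr rfl fun a _ => h2 a, Finset.sum_comm]
  refine Finset.sum_congr rfl fun α _ => ?_
  rw [← Finset.sum_mul]
  congr 1
  conv_rhs => rw [B.eq_sum_I' (B.E' (grade z q) α)]
  simp only [map_sum, map_smulₛₗ]

/-- At a fixed point, the dual vectors have the inverse of the eigenvalue attached to `q`. This
agrees with the eigenvalue attached to `p` exactly when `T ∣ p + q`; otherwise the projection in the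
current kills them, which explains the restriction in `quad`. -/
theorem quad_eq (s : Place P) (p q : ℕ) (n : ℤ) (hp : s.lo ≤ p) (hq : s.lo ≤ q) :
    P.quad B ℓ s p q n = casimir B (current ℓ s) p q n := by
  match s with
  | .cpx .. =>
    unfold casimir
    refine Finset.sum_congr rfl fun a _ => ?_
    rw [current_of_homog ℓ hp _ trivial, current_of_homog ℓ hq _ trivial]
  | .real .. =>
    unfold casimir
    refine Finset.sum_congr rfl fun a _ => ?_
    rw [current_of_homog ℓ hp _ trivial, current_of_homog ℓ hq _ trivial]
  | .fixed z hz =>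
    have : NeZero T := ⟨G.T_pos.ne'⟩
    have h := sum_dualE B z q (current ℓ (.fixed z hz) p (-n)) (current ℓ (.fixed z hz) q n)
      (current_proj ℓ (.fixed z hz) q n)
    refine Eq.trans ?_ h.symm
    have hE : ∀ α, (Place.fixed (P := P) z hz).IsHomog q (B.E (grade z q) α : 𝔤) := fun α =>
      Module.End.mem_eigenspace_iff.mp (B.E (grade z q) α).2
    have hE' : ∀ α, G.σ (B.E' (grade z q) α) =
        G.ω ^ (-grade (T := T) z q).val • (B.E' (grade z q) α : 𝔤) := fun α =>
      Module.End.mem_eigenspace_iff.mp (B.E' (grade z q) α).2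
    have hroot : G.ω ^ (-grade (T := T) z q).val * root G z q = 1 := by
      unfold root
      rw [← pow_add, G.ω_prim.pow_eq_one_iff_dvd, ← ZMod.natCast_eq_zero_iff, Nat.cast_add,
        ZMod.natCast_zmod_val, ZMod.natCast_zmod_val, neg_add_cancel]
    have hiff : root G z p = G.ω ^ (-grade (T := T) z q).val ↔ T ∣ p + q := by
      rw [← root_eq_one_iff G z, root_add, ← hroot]
      exact ⟨fun h => by rw [h], fun h => mul_right_cancel₀ (root_ne_zero G z q) h⟩
    simp only [quad]
    split_ifs with hdvd
    · refine Finset.sum_congr rfl fun α _ => ?_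
      have hE'' : (Place.fixed (P := P) z hz).IsHomog p (B.E' (grade z q) α : 𝔤) :=
        (hE' α).trans (by rw [hiff.mpr hdvd])
      rw [current_of_homog ℓ hp _ hE'', current_of_homog ℓ hq _ (hE α)]
    · refine (Finset.sum_eq_zero fun α _ => ?_).symm
      have h0 : (Place.fixed (P := P) z hz).proj p (B.E' (grade z q) α : 𝔤) = 0 :=
        G.eigProj_of_ne (root_pow G z p) (hE' α) fun h => hdvd (hiff.mp h)
      rw [← current_proj, h0, map_zero, zero_mul]

theorem sugawara_eq (s : Place P) (r k : ℕ) : P.sugawara B ℓ s r k =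
    segal (cur := current ℓ s) B s.lo s.mult (ℓ s.point) s.sign r k := by
  unfold sugawara segal
  rw [exps_eq]
  congr 1
  refine Finset.sum_congr rfl fun p hp => Finset.sum_congr rfl fun q hq => ?_
  rw [Finset.sum_congr rfl fun n _ =>
    quad_eq ℓ B s p q n (Finset.mem_Ico.mp hp).1 (Finset.mem_Ico.mp hq).1]

end Level
end Poles
end AffineGaudin
end

noncomputable section
open scoped TensorProduct
namespace AffineGaudin

variable {𝔤 : Type*} [LieRing 𝔤] [LieAlgebra ℂ 𝔤] {T : ℕ} {G : DihedralLie 𝔤 T}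

open DihedralLie

namespace Poles

variable {P : Poles G}

open Place

/-! ### The Segal-Sugawara elements of the completion and their brackets. -/

section SegalSugawara

variable (B : DualBases G) (ℓ : OnePoint ℂ → ℕ → ℂ)

theorem casimir_current_mem (s : Place P) (p q k : ℕ) (n : ℤ) (h : k ≤ n.natAbs) :
    casimir B (current ℓ s) p q n ∈ P.filHat ℓ k := by
  refine sum_mem fun a _ => ?_
  by_cases hn : 0 ≤ n
  · exact current_mul_mem ℓ s k _ _ _ _ _ _ (by omega) (by omega)
  · rw [mul_comm]
    exact current_mul_mem ℓ s k _ _ _ _ _ _ (by omega) (by omega)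

theorem sugawara_sub_mem (s : Place P) (r : ℕ) {k k' : ℕ} (h : k ≤ k') :
    P.sugawara B ℓ s r k' - P.sugawara B ℓ s r k ∈ P.filHat ℓ k := by
  have hsub : Finset.Ioo (-(k : ℤ)) k ⊆ Finset.Ioo (-(k' : ℤ)) k' :=
    Finset.Ioo_subset_Ioo (by omega) (by omega)
  rw [sugawara_eq, sugawara_eq, segal_eq, segal_eq, ← smul_sub, ← Finset.sum_sdiff_eq_sub hsub,
    Algebra.smul_def]
  refine Ideal.mul_mem_left _ _ (sum_mem fun n hn => sum_mem fun p _ => sum_mem fun q _ => ?_)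
  rw [Algebra.smul_def]
  refine Ideal.mul_mem_left _ _ (casimir_current_mem B ℓ s p q k n ?_)
  rw [Finset.mem_sdiff, Finset.mem_Ioo, Finset.mem_Ioo] at hn
  omega

/-- The generalised Segal-Sugawara elements of the completed algebra. -/
def sugawaraLim (s : Place P) (r : ℕ) : P.LocalObs ℓ :=
  ⟨fun k => Ideal.Quotient.mk (P.filHat ℓ k) (P.sugawara B ℓ s r k), fun _ _ h =>
    Ideal.Quotient.eq.mpr (sugawara_sub_mem B ℓ s r h)⟩

variable (P) in
/-- The canonical map to the completion of the quotient of `S(𝔤̂)`. -/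
abbrev toLocal : P.LevelSym ℓ →ₐ[ℂ] P.LocalObs ℓ :=
  toCompletion (P.filHat ℓ) (P.filHat_antitone ℓ)

variable {ℓ}

/-- A nonempty range of exponents at infinity means multiplicity at least two, which is the case in
which the top level is required to be nonzero. -/
theorem IsLevels.last_ne_zero (hℓ : P.IsLevels ℓ) (s : Place P) (h : s.lo < s.mult) :
    ℓ s.point (s.mult - 1) ≠ 0 :=
  hℓ.nonzero s fun h' => by
    unfold lo at h
    rw [if_pos h'] at h
    omega

theorem localBr_toLocal (a b : P.LevelSym ℓ) : (P.localPoisson ℓ).br (P.toLocal ℓ a)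
    (P.toLocal ℓ b) = P.toLocal ℓ ((P.levelPoisson ℓ).br a b) :=
  completionBr_toCompletion (P.filHat_continuous ℓ) a b

/-- The `k`-th partial sum represents the limit modulo the `k`-th ideal, so brackets with the limit
are computed from partial sums. -/
theorem sugawaraLim_br_toLocal (s : Place P) (r : ℕ) (a b : P.LevelSym ℓ)
    (h : ∀ M, ∃ K, ∀ k ≥ K, (P.levelPoisson ℓ).br (P.sugawara B ℓ s r k) a - b ∈ P.filHat ℓ M) :
    (P.localPoisson ℓ).br (sugawaraLim B ℓ s r) (P.toLocal ℓ a) = P.toLocal ℓ b := by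
  refine completion_ext fun N => ?_
  obtain ⟨M, hM⟩ := (P.filHat_continuous ℓ).limBr_rep (sugawaraLim B ℓ s r) (P.toLocal ℓ a) N
  obtain ⟨K, hK⟩ := h N
  exact (hM (max M K) (le_max_left _ _) _ _ rfl rfl).trans
    (Ideal.Quotient.eq.mpr (hK _ (le_max_right _ _)))

theorem sugawaraLim_br_current (hℓ : P.IsLevels ℓ) {s : Place P} {r u : ℕ} (hr : r ∈ s.exps)
    (hdiv : s.Div r) (hu : s.lo ≤ u) (m : ℤ) (y : 𝔤) :
    (P.localPoisson ℓ).br (sugawaraLim B ℓ s r) (P.toLocal ℓ (current ℓ s u m y)) =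
      (m : ℂ) • P.toLocal ℓ (current ℓ s (r + u) m y) := by
  -- The relation for partial sums requires a homogeneous `y`. Projecting `y` does not change the
  -- current, and as `r` is a multiple of `T` at a fixed point the same projection serves for `u`
  -- and `r + u`.
  rw [← current_proj ℓ s u, ← current_proj ℓ s (r + u), proj_add_of_div hdiv, ← map_smul]
  refine sugawaraLim_br_toLocal B s r _ _ fun M => ⟨M + 2 * m.natAbs + 1, fun k hk => ?_⟩
  rw [sugawara_eq]
  exact (isCurrents ℓ s hℓ).segal_br B _ (fun _ => rfl) s.sign_mul_self (hℓ.vanish s)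
    (hℓ.last_ne_zero s) (fun k p q i j x y => current_mul_mem ℓ s k p q i j x y) M r u
    (mem_exps.mp hr).1 (mem_exps.mp hr).2 hu m _ (s.isHomog_proj u y) k hk

theorem sugawaraLim_br_current_of_ne {s t : Place P} (hst : s ≠ t) (r : ℕ) {u : ℕ}
    (hu : t.lo ≤ u) (m : ℤ) (y : 𝔤) :
    (P.localPoisson ℓ).br (sugawaraLim B ℓ s r) (P.toLocal ℓ (current ℓ t u m y)) = 0 := by
  rw [← map_zero (P.toLocal ℓ)]
  refine sugawaraLim_br_toLocal B s r _ _ fun M => ⟨0, fun k _ => ?_⟩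
  have h : (P.levelPoisson ℓ).br.flip (current ℓ t u m y) (P.sugawara B ℓ s r k) = 0 := by
    rw [sugawara_eq]
    exact derivation_segal_of_zero B (AlgHom.id ℂ _) _ (fun a b => PoissonBracket.leibniz (P.levelPoisson ℓ) a b (current ℓ t u m y))
      (fun p n x hp => current_br_of_ne ℓ hst p u n m x y hp hu) r k
  rw [LinearMap.flip_apply] at h
  rw [h, sub_zero]
  exact zero_mem _

/-- The bracket with the first element is a derivation into the completion which acts on the
currents as `D_r`, or as zero at other places. It annihilates every partial sum of the second
element, hence the limit by continuity; no double infinite sum has to be rearranged. -/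
theorem sugawaraLim_br_sugawaraLim (hℓ : P.IsLevels ℓ) {s t : Place P} {r u : ℕ}
    (hr : r ∈ s.exps) (hdiv : s.Div r) (hu : u ∈ t.exps) :
    (P.localPoisson ℓ).br (sugawaraLim B ℓ s r) (sugawaraLim B ℓ t u) = 0 := by
  have key : ∀ k, (P.localPoisson ℓ).br (sugawaraLim B ℓ s r)
      (P.toLocal ℓ (P.sugawara B ℓ t u k)) = 0 := by
    intro k
    set D : P.LevelSym ℓ →ₗ[ℂ] P.LocalObs ℓ :=
      (P.localPoisson ℓ).br (sugawaraLim B ℓ s r) ∘ₗ (P.toLocal ℓ).toLinearMap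
    have hD : ∀ a b, D (a * b) = P.toLocal ℓ a * D b + P.toLocal ℓ b * D a := fun a b => by
      change (P.localPoisson ℓ).br _ (P.toLocal ℓ (a * b)) = _
      rw [map_mul, PoissonBracket.leibniz_right]
      rfl
    change D _ = 0
    rw [sugawara_eq]
    by_cases hst : s = t
    · subst hst
      exact derivation_segal B (current_vanish ℓ s) (P.toLocal ℓ) D hD r
        (fun p m y hp => sugawaraLim_br_current B hℓ hr hdiv hp m y) u k (mem_exps.mp hu).1
    · exact derivation_segal_of_zero B (P.toLocal ℓ) D hD
        (fun p m y hp => sugawaraLim_br_current_of_ne B hst r hp m y) u k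
  refine completion_ext fun N => ?_
  obtain ⟨M, hM⟩ := completionBr_congr (P.filHat_continuous ℓ) (sugawaraLim B ℓ s r)
    (sugawaraLim B ℓ t u) N
  refine (hM (sugawaraLim B ℓ s r) (P.toLocal ℓ (P.sugawara B ℓ t u M)) rfl rfl).symm.trans ?_
  exact congrArg (fun f : P.LocalObs ℓ => f.1 N) (key M)

end SegalSugawara

/-! ### The level-fixing map and its compatibility with brackets. -/

section LevelFixing

instance : Fintype (Place P) := Fintype.ofFinite _

/-- The coefficient of `D_p^{(x)}`. -/
def dCoeff (s : Place P) (p : ℕ) : Cx P.tilde →ₗ[ℂ] ℂ where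
  toFun ξ := conjIf s.flag (coeff s p ξ).d
  map_add' ξ η := by rw [coeff_add, Affine.add_d, map_add]
  map_smul' c ξ := by
    rw [coeff_smul, Affine.smul_d, map_mul, conjIf_conjIf]
    rfl

open Classical in
theorem dCoeff_gen (s t : Place P) (p q : ℕ) (hp : p < s.mult) {X : Affine G}
    (hX : t.Allowed q X) :
    dCoeff s p (gen P.tilde t q X) = if s = t ∧ p = q then conjIf s.flag X.d else 0 := by
  change conjIf s.flag (coeff s p (gen P.tilde t q X)).d = _
  rw [coeff_gen s t p q hp hX.mem_tilde]
  split_ifs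
  · rfl
  · exact map_zero _

variable (B : DualBases G) (ℓ : OnePoint ℂ → ℕ → ℂ)

/-- The level-fixing map, which is the identity on the currents and sends `D_r^{(x)}` to a
generalised Segal-Sugawara element. -/
def levelFix : Cx P.tilde →ₗ[ℂ] P.LocalObs ℓ :=
  (P.toLocal ℓ).toLinearMap ∘ₗ P.levelι ℓ ∘ₗ dropCx +
    ∑ s : Place P, ∑ p ∈ s.exps, (dCoeff s p).smulRight (sugawaraLim B ℓ s p)

theorem levelFix_apply (ξ : Cx P.tilde) : levelFix B ℓ ξ = P.toLocal ℓ (P.levelι ℓ (dropCx ξ)) +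
    ∑ s : Place P, ∑ p ∈ s.exps, dCoeff s p ξ • sugawaraLim B ℓ s p := by
  simp only [levelFix, LinearMap.add_apply, LinearMap.sum_apply, LinearMap.smulRight_apply]
  rfl

theorem levelFix_of_dCoeff (ξ : Cx P.tilde) (h : ∀ s : Place P, ∀ p ∈ s.exps, dCoeff s p ξ = 0) :
    levelFix B ℓ ξ = P.toLocal ℓ (P.levelι ℓ (dropCx ξ)) := by
  rw [levelFix_apply, Finset.sum_eq_zero fun s _ => Finset.sum_eq_zero fun p hp => ?_, add_zero]
  rw [h s p hp, zero_smul]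

theorem levelFix_gen {s : Place P} {p : ℕ} {X : Affine G} (h : s.Allowed p X) (hd : X.d = 0) :
    levelFix B ℓ (gen P.tilde s p X) = P.toLocal ℓ (P.levelι ℓ (gen P.hat s p X)) := by
  rw [levelFix_of_dCoeff, dropCx_gen h hd]
  intro t q hq
  rw [dCoeff_gen t s q p (mem_exps.mp hq).2 h, hd, map_zero, ite_self]

theorem levelFix_gen_D {s : Place P} {r : ℕ} (h : s.Allowed r (Affine.D : Affine G)) :
    levelFix B ℓ (gen P.tilde s r Affine.D) = sugawaraLim B ℓ s r := by
  classical
  rw [levelFix_apply, dropCx_gen_D h, map_zero, map_zero, zero_add, Finset.sum_eq_single s,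
    Finset.sum_eq_single r]
  · rw [dCoeff_gen _ _ _ _ (mem_exps.mp h.1).2 h, if_pos ⟨rfl, rfl⟩]
    change conjIf s.flag 1 • _ = _
    rw [map_one, one_smul]
  · intro p hp hpr
    rw [dCoeff_gen _ _ _ _ (mem_exps.mp hp).2 h, if_neg fun h' => hpr h'.2, zero_smul]
  · exact fun h' => absurd h.1 h'
  · intro t _ hts
    refine Finset.sum_eq_zero fun p hp => ?_
    rw [dCoeff_gen _ _ _ _ (mem_exps.mp hp).2 h, if_neg fun h' => hts h'.1, zero_smul]
  · exact fun h' => absurd (Finset.mem_univ s) h'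

theorem levelFix_gen_K {s : Place P} {p : ℕ} (h : s.Allowed p (Affine.K : Affine G)) :
    levelFix B ℓ (gen P.tilde s p Affine.K) =
      algebraMap ℂ _ (s.sign * (Complex.I * ℓ s.point p)) := by
  rw [levelFix_gen B ℓ h rfl, levelι_K ℓ h, AlgHom.commutes]

theorem levelFix_gen_mono {s : Place P} {p : ℕ} {m : ℤ} {x : 𝔤}
    (h : s.Allowed p (Affine.mono m x : Affine G)) :
    levelFix B ℓ (gen P.tilde s p (Affine.mono m x)) = P.toLocal ℓ (current ℓ s p m x) := by
  have h' := allowed_mono.mp h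
  rw [levelFix_gen B ℓ h rfl, current_of_homog ℓ (mem_exps.mp h'.1).1 m h'.2]

theorem isLevelFixing_levelFix : P.IsLevelFixing B ℓ (levelFix B ℓ) where
  map_loop _ _ _ _ h := levelFix_gen B ℓ h rfl
  map_K _ _ h := levelFix_gen_K B ℓ h
  map_D _ _ h k := by rw [levelFix_gen_D B ℓ h]; rfl

variable {B ℓ} in
theorem IsLevelFixing.unique {π π' : Cx P.tilde →ₗ[ℂ] P.LocalObs ℓ} (h : P.IsLevelFixing B ℓ π)
    (h' : P.IsLevelFixing B ℓ π') : π' = π := by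
  refine LinearMap.ext fun ξ => ?_
  induction ξ using gen_induction with
  | h0 => rw [map_zero, map_zero]
  | hadd ξ η hξ hη => rw [map_add, map_add, hξ, hη]
  | hsmul c ξ hξ => rw [map_smul, map_smul, hξ]
  | hloop s p m x hs => rw [h.map_loop s p m x hs, h'.map_loop s p m x hs]
  | hK s p hs => rw [h.map_K s p hs, h'.map_K s p hs]
  | hD s p hs => exact completion_ext fun k => (h'.map_D s p hs k).trans (h.map_D s p hs k).symm

variable {ℓ}

theorem lie_gen_allowed {s : Place P} {p q : ℕ} {X Y : Affine G} (hX : s.Allowed p X)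
    (hY : s.Allowed q Y) :
    ⁅gen P.tilde s p X, gen P.tilde s q Y⁆ = gen P.tilde s (p + q) ⁅X, Y⁆ := by
  refine lie_gen s p q hX.mem_tilde hY.mem_tilde ?_
  by_cases h : p + q < s.mult
  · exact (hX.lie hY h).mem_tilde
  · exact genMem_of_le _ _ _ (not_lt.mp h)

theorem levelFix_lie_D_mono (hℓ : P.IsLevels ℓ) {s t : Place P} {p q : ℕ} {m : ℤ} {x : 𝔤}
    (hs : s.Allowed p (Affine.D : Affine G)) (ht : t.Allowed q (Affine.mono m x : Affine G)) :
    levelFix B ℓ ⁅gen P.tilde s p Affine.D, gen P.tilde t q (Affine.mono m x)⁆ =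
      (P.localPoisson ℓ).br (levelFix B ℓ (gen P.tilde s p Affine.D))
        (levelFix B ℓ (gen P.tilde t q (Affine.mono m x))) := by
  have ht' := allowed_mono.mp ht
  rw [levelFix_gen_D B ℓ hs, levelFix_gen_mono B ℓ ht]
  by_cases hst : s = t
  swap
  · rw [lie_gen_of_ne hst p q hs.mem_tilde ht.mem_tilde, map_zero,
      sugawaraLim_br_current_of_ne B hst p (mem_exps.mp ht'.1).1]
  subst hst
  have hs' := allowed_D.mp hs
  rw [lie_gen_allowed hs ht, sugawaraLim_br_current B hℓ hs'.1 hs'.2 (mem_exps.mp ht'.1).1]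
  by_cases h : p + q < s.mult
  · have hl := hs.lie ht h
    rw [Affine.D_lie_mono, Affine.smul_mono] at hl ⊢
    -- The current may be antilinear, but the scalar is the integer `m`, which conjugation fixes.
    rw [levelFix_gen_mono B ℓ hl, map_smulₛₗ, map_intCast, map_smul]
  · rw [gen_eq_zero _ _ _ (not_lt.mp h), map_zero, current_vanish ℓ _ _ _ _ (not_lt.mp h), map_zero,
      smul_zero]

/-- Without `D`-components the map is the canonical one to the quotient of `S(𝔤̂)`, and the bracket
there comes from the Lie bracket. -/
theorem levelFix_lie_of_d {s t : Place P} {p q : ℕ} {X Y : Affine G}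
    (hs : s.Allowed p X) (ht : t.Allowed q Y) (hX : X.d = 0) (hY : Y.d = 0) :
    levelFix B ℓ ⁅gen P.tilde s p X, gen P.tilde t q Y⁆ =
      (P.localPoisson ℓ).br (levelFix B ℓ (gen P.tilde s p X))
        (levelFix B ℓ (gen P.tilde t q Y)) := by
  rw [levelFix_gen B ℓ hs hX, levelFix_gen B ℓ ht hY, localBr_toLocal, levelι_br]
  by_cases hst : s = t
  swap
  · rw [lie_gen_of_ne hst p q hs.mem_tilde ht.mem_tilde,
      lie_gen_of_ne hst p q (hs.mem_hat hX) (ht.mem_hat hY), map_zero, map_zero, map_zero]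
  subst hst
  rw [lie_gen_allowed hs ht]
  by_cases h : p + q < s.mult
  · have hl := hs.lie ht h
    rw [lie_gen s p q (hs.mem_hat hX) (ht.mem_hat hY) (hl.mem_hat rfl), levelFix_gen B ℓ hl rfl]
  · rw [lie_gen s p q (hs.mem_hat hX) (ht.mem_hat hY) (genMem_of_le _ _ _ (not_lt.mp h)),
      gen_eq_zero _ _ _ (not_lt.mp h), gen_eq_zero _ _ _ (not_lt.mp h), map_zero, map_zero, map_zero]

theorem levelFix_lie_gen_K (s : Place P) (p : ℕ) (hs : s.Allowed p (Affine.K : Affine G))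
    (ξ : Cx P.tilde) : levelFix B ℓ ⁅ξ, gen P.tilde s p Affine.K⁆ =
      (P.localPoisson ℓ).br (levelFix B ℓ ξ) (levelFix B ℓ (gen P.tilde s p Affine.K)) := by
  rw [lie_gen_K, levelFix_gen_K B ℓ hs, PoissonBracket.skew, PoissonBracket.br_algebraMap, map_zero,
    neg_zero]

theorem levelFix_lie_D_D (hℓ : P.IsLevels ℓ) {s t : Place P} {p q : ℕ}
    (hs : s.Allowed p (Affine.D : Affine G)) (ht : t.Allowed q (Affine.D : Affine G)) :
    levelFix B ℓ ⁅gen P.tilde s p Affine.D, gen P.tilde t q Affine.D⁆ =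
      (P.localPoisson ℓ).br (levelFix B ℓ (gen P.tilde s p Affine.D))
        (levelFix B ℓ (gen P.tilde t q Affine.D)) := by
  rw [levelFix_gen_D B ℓ hs, levelFix_gen_D B ℓ ht,
    sugawaraLim_br_sugawaraLim B hℓ hs.1 (allowed_D.mp hs).2 ht.1]
  by_cases hst : s = t
  · subst hst
    rw [lie_gen_allowed hs ht, lie_self, gen_zero, map_zero]
  · rw [lie_gen_of_ne hst p q hs.mem_tilde ht.mem_tilde, map_zero]

theorem levelFix_lie (hℓ : P.IsLevels ℓ) (ξ η : Cx P.tilde) :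
    levelFix B ℓ ⁅ξ, η⁆ = (P.localPoisson ℓ).br (levelFix B ℓ ξ) (levelFix B ℓ η) := by
  -- Antisymmetry leaves one order to be checked for each mixed pair of generators.
  have swap : ∀ ξ η : Cx P.tilde,
      levelFix B ℓ ⁅ξ, η⁆ = (P.localPoisson ℓ).br (levelFix B ℓ ξ) (levelFix B ℓ η) →
      levelFix B ℓ ⁅η, ξ⁆ = (P.localPoisson ℓ).br (levelFix B ℓ η) (levelFix B ℓ ξ) := by
    intro ξ η h
    rw [← lie_skew, map_neg, h, PoissonBracket.skew _ (levelFix B ℓ η)]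
  induction ξ using gen_induction with
  | h0 => rw [zero_lie, map_zero, map_zero, LinearMap.zero_apply]
  | hadd ξ ξ' h h' => rw [add_lie, map_add, map_add, map_add, LinearMap.add_apply, h, h']
  | hsmul c ξ h => rw [smul_lie, map_smul, map_smul, map_smul, LinearMap.smul_apply, h]
  | hK s p hs => exact swap _ _ (levelFix_lie_gen_K B s p hs η)
  | hloop s p m x hs =>
    induction η using gen_induction with
    | h0 => rw [lie_zero, map_zero, map_zero]
    | hadd η η' h h' => rw [lie_add, map_add, map_add, map_add, h, h']
    | hsmul c η h => rw [lie_smul, map_smul, map_smul, map_smul, h]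
    | hK t q ht => exact levelFix_lie_gen_K B t q ht _
    | hloop t q n y ht => exact levelFix_lie_of_d B hs ht rfl rfl
    | hD t q ht => exact swap _ _ (levelFix_lie_D_mono B hℓ ht hs)
  | hD s p hs =>
    induction η using gen_induction with
    | h0 => rw [lie_zero, map_zero, map_zero]
    | hadd η η' h h' => rw [lie_add, map_add, map_add, map_add, h, h']
    | hsmul c η h => rw [lie_smul, map_smul, map_smul, map_smul, h]
    | hK t q ht => exact levelFix_lie_gen_K B t q ht _
    | hloop t q n y ht => exact levelFix_lie_D_mono B hℓ hs ht
    | hD t q ht => exact levelFix_lie_D_D B hℓ hs ht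

end LevelFixing

/-! ### Extension to the completed symmetric algebras. -/

section Extension

variable (B : DualBases G) (ℓ : OnePoint ℂ → ℕ → ℂ)

theorem dCoeff_eq_zero {ξ : Cx P.tilde} (h : ∀ b x p, (Cx.coord b ξ x p).d = 0) (s : Place P)
    (p : ℕ) : dCoeff s p ξ = 0 := by
  change conjIf s.flag (coeff s p ξ).d = 0
  unfold coeff
  split_ifs
  · rw [h, map_zero]
  · exact map_zero _

/-- Elements of the filtration have no component along `D`, so the infinite sums never enter and the
same index `n` is preserved. -/
theorem levelFix_fil (n : ℕ) {ξ : Cx P.tilde} (hξ : ξ ∈ Cx.fil P.tilde n) :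
    dropCx ξ ∈ Cx.fil P.hat n ∧ levelFix B ℓ ξ = P.toLocal ℓ (P.levelι ℓ (dropCx ξ)) := by
  have hd : ∀ b x p, (Cx.coord b ξ x p).d = 0 := by
    intro b x p
    cases b
    · exact (hξ.1 x p).2.1
    · exact (hξ.2 x p).2.1
  refine ⟨⟨fun x p => ?_, fun x p => ?_⟩, levelFix_of_dCoeff B ℓ ξ fun s p _ => dCoeff_eq_zero hd s p⟩
  · rw [coord_dropCx, Affine.drop_of_d _ (hd _ x p)]
    exact hξ.1 x p
  · rw [coord_dropCx, Affine.drop_of_d _ (hd _ x p)]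
    exact hξ.2 x p

theorem levelFix_conjFil (n : ℕ) {ξ : Cx P.tilde} (hξ : ξ ∈ Cx.conjFil P.tilde n) :
    dropCx ξ ∈ Cx.conjFil P.hat n ∧ levelFix B ℓ ξ = P.toLocal ℓ (P.levelι ℓ (dropCx ξ)) := by
  obtain ⟨η, hη, rfl⟩ := hξ
  have hd : ∀ b x p, (Cx.coord b (Cx.conj η) x p).d = 0 := by
    intro b x p
    rw [Cx.coord_conj]
    cases b
    · exact (hη.2 x p).2.1
    · exact (hη.1 x p).2.1
  refine ⟨⟨Cx.conj (dropCx (Cx.conj η)), ⟨fun x p => ?_, fun x p => ?_⟩, Cx.conj_conj _⟩,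
    levelFix_of_dCoeff B ℓ _ fun s p _ => dCoeff_eq_zero hd s p⟩
  · rw [Cx.coord_conj, coord_dropCx, Affine.drop_of_d _ (hd _ x p), Cx.coord_conj]
    exact hη.1 x p
  · rw [Cx.coord_conj, coord_dropCx, Affine.drop_of_d _ (hd _ x p), Cx.coord_conj]
    exact hη.2 x p

/-- The extension of the level-fixing map to the symmetric algebra. -/
def levelFixSym : SymmetricAlgebra ℂ (Cx P.tilde) →ₐ[ℂ] P.LocalObs ℓ :=
  SymmetricAlgebra.lift (levelFix B ℓ)

theorem levelFixSym_ι (ξ : Cx P.tilde) :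
    levelFixSym B ℓ (SymmetricAlgebra.ι ℂ _ ξ) = levelFix B ℓ ξ :=
  SymmetricAlgebra.lift_ι_apply _ ξ

theorem levelFixSym_fil (n : ℕ) (f : SymmetricAlgebra ℂ (Cx P.tilde)) (hf : f ∈ P.filTilde n) :
    (levelFixSym B ℓ f).1 n = 0 := by
  refine spanFil_hom (levelFixSym B ℓ) _ _ n ?_ ?_ f hf
  · rintro _ ⟨ξ, hξ, rfl⟩
    obtain ⟨h1, h2⟩ := levelFix_fil B ℓ n hξ
    exact ⟨_, ⟨_, h1, rfl⟩, (levelFixSym_ι B ℓ ξ).trans h2⟩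
  · rintro _ ⟨ξ, hξ, rfl⟩
    obtain ⟨h1, h2⟩ := levelFix_conjFil B ℓ n hξ
    exact ⟨_, ⟨_, h1, rfl⟩, (levelFixSym_ι B ℓ ξ).trans h2⟩

variable {ℓ}

theorem levelFixSym_br (hℓ : P.IsLevels ℓ) (f g : SymmetricAlgebra ℂ (Cx P.tilde)) :
    levelFixSym B ℓ ((symPoisson (Cx P.tilde)).br f g) =
      (P.localPoisson ℓ).br (levelFixSym B ℓ f) (levelFixSym B ℓ g) :=
  symPoisson_hom _ (levelFixSym B ℓ) (fun X Y => by
    rw [levelFixSym_ι, levelFixSym_ι, levelFixSym_ι, levelFix_lie B hℓ]) f g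

end Extension

end Poles
end AffineGaudin
end

open AffineGaudin

theorem mainTheorem6 {𝔤 : Type*} [LieRing 𝔤] [LieAlgebra ℂ 𝔤] [FiniteDimensional ℂ 𝔤] {T : ℕ}
    (G : DihedralLie 𝔤 T) (B : DualBases G) (P : Poles G)
    (ℓ : OnePoint ℂ → ℕ → ℂ) (hℓ : P.IsLevels ℓ) :
    (∀ s : Poles.Place P, (s.point = OnePoint.infty → 2 ≤ s.mult) → ∀ κ : ℕ → ℂ,
      (∀ q < s.mult, ∀ r < s.mult, ∑ p ∈ Finset.range s.mult, κ (p + q) * ℓ s.point (p + r) =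
        if q = r then 1 else 0) ↔
      ∀ p ≤ 2 * s.mult - 2, κ p = kappa s.mult (ℓ s.point) p) ∧
    ∃ π : Poles.Cx P.tilde →ₗ[ℂ] P.LocalObs ℓ,
      P.IsLevelFixing B ℓ π ∧
      (∀ π' : Poles.Cx P.tilde →ₗ[ℂ] P.LocalObs ℓ, P.IsLevelFixing B ℓ π' → π' = π) ∧
      (∀ X Y : Poles.Cx P.tilde, π ⁅X, Y⁆ = (P.localPoisson ℓ).br (π X) (π Y)) ∧
      ∃ Φ : P.FormalObs →ₐ[ℂ] P.LocalObs ℓ,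
        (∀ X, Φ (toCompletion P.filTilde P.filTilde_antitone (SymmetricAlgebra.ι ℂ _ X)) = π X) ∧
        (∀ n f, f.1 n = 0 → (Φ f).1 n = 0) ∧
        (∀ f g, Φ (P.formalPoisson.br f g) = (P.localPoisson ℓ).br (Φ f) (Φ g)) ∧
        ∀ Φ' : P.FormalObs →ₐ[ℂ] P.LocalObs ℓ,
          (∀ X, Φ' (toCompletion P.filTilde P.filTilde_antitone (SymmetricAlgebra.ι ℂ _ X)) = π X) →
          (∀ n, ∃ m, ∀ f, f.1 m = 0 → (Φ' f).1 n = 0) → Φ' = Φ := by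

  refine ⟨fun s hs κ => kappa_unique s.mult (P.mult_pos _ s.base.2) (ℓ s.point) (hℓ.vanish s)
    (hℓ.nonzero s hs) κ, Poles.levelFix B ℓ, Poles.isLevelFixing_levelFix B ℓ,
    fun π' h => (Poles.isLevelFixing_levelFix B ℓ).unique h, Poles.levelFix_lie B hℓ,
    completionLift (Poles.levelFixSym B ℓ) (Poles.levelFixSym_fil B ℓ),
    fun X => ?_, fun n f hf => completionLift_val_zero n f hf,
    fun f g => completionLift_br P.filTilde_continuous (P.filHat_continuous ℓ)
      (Poles.levelFixSym_br B hℓ) f g,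
    fun Φ' h hc => completionLift_unique Φ' (fun a => ?_) hc⟩
  · rw [completionLift_toCompletion, Poles.levelFixSym_ι]
  · have e : Φ'.comp (toCompletion P.filTilde P.filTilde_antitone) = Poles.levelFixSym B ℓ :=
      SymmetricAlgebra.algHom_ext (LinearMap.ext fun X => by
        exact (h X).trans (Poles.levelFixSym_ι B ℓ X).symm)
    exact DFunLike.congr_fun e a
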